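/- Let $m_1 \ge m_2 \ge 3$ and let $\mathcal G$ be the $4$-connected $m_1\times m_2$ grid. A \emph{MAPF instance} on $\mathcal G$ consists of $n$ agents with pairwise distinct start vertices $s_1,\dots,s_n$ and pairwise distinct goal vertices $g_1,\dots,g_n$; suppose that every vertex of $\mathcal G$ is occupied by an agent (so $n=m_1m_2$). A \emph{solution} consists of paths $P_1,\dots,P_n:\mathbb N\to V(\mathcal G)$ such that (i) $P_i(0)=s_i$, (ii) $P_i(t)=g_i$ for all sufficiently large $t$, (iii) for every $t$, either $P_i(t+1)=P_i(t)$ or $P_i(t)$ and $P_i(t+1)$ are adjacent, and (iv) for all $i\neq j$ and all $t\ge 0$, neither $P_i(t)=P_j(t)$ nor both $P_i(t)=P_j(t+1)$ and $P_j(t)=P_i(t+1)$. The length of $P_i$ is the least $T$ such that $P_i(t)=g_i$ for all $t\ge T$, and the \emph{makespan} of the solution is the maximum of these lengths. Then there is a deterministic algorithm, the same for all $m_1, m_2$ and all instances, that on input of any such instance computes, in time polynomial in $m_1m_2$, a solution whose makespan is at most $4m_1+8m_2$. -/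

import Mathlib

/-! ### Multi-agent path finding (MAPF) -/

namespace MAPF

/-- A MAPF instance with `n` agents on the vertex set `V`: the start configuration and the goal
configuration, each of which puts the agents on pairwise distinct vertices. -/
structure Instance (V : Type) (n : ℕ) where
  /-- start vertex of each agent -/
  start : Fin n → V
  /-- goal vertex of each agent -/
  goal : Fin n → V
  /-- distinct agents have distinct starts -/
  start_injective : Function.Injective start
  /-- distinct agents have distinct goals -/
  goal_injective : Function.Injective goal

/-- The path `P : ℕ → V` is feasible for an agent travelling from `s` to `g`. -/
structure IsFeasiblePath {V : Type} (G : SimpleGraph V) (s g : V) (P : ℕ → V) : Prop where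
  /-- the path begins at the start vertex -/
  init : P 0 = s
  /-- the path reaches the goal vertex and stays there -/
  final : ∃ T : ℕ, ∀ t, T ≤ t → P t = g
  /-- in every step the agent waits or moves along an edge -/
  move : ∀ t, P (t + 1) = P t ∨ G.Adj (P t) (P (t + 1))

/-- The path set `P` (one path for each agent) is a feasible solution of the instance `I`:
every path is feasible, no two agents are at the same vertex at the same time, and no two agents
traverse the same edge in opposite directions in the same step. -/
structure IsFeasible {V : Type} {n : ℕ} (G : SimpleGraph V) (I : Instance V n)
    (P : Fin n → ℕ → V) : Prop where
  /-- every single path is feasible -/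
  path : ∀ i, IsFeasiblePath G (I.start i) (I.goal i) (P i)
  /-- no collision on a vertex -/
  vertex : ∀ i j, i ≠ j → ∀ t, P i t ≠ P j t
  /-- no head-on collision on an edge -/
  edge : ∀ i j, i ≠ j → ∀ t, ¬ (P i t = P j (t + 1) ∧ P j t = P i (t + 1))

/-- The length of a path with goal `g`: the first time from which on the agent rests at `g`
(meaningful for feasible paths, for which such a time exists). -/
noncomputable def pathLength {V : Type} (g : V) (P : ℕ → V) : ℕ :=
  sInf {T : ℕ | ∀ t, T ≤ t → P t = g}

/-- The makespan of a path set: the maximal length of its paths. -/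
noncomputable def makespan {V : Type} {n : ℕ} (I : Instance V n) (P : Fin n → ℕ → V) : ℕ :=
  Finset.univ.sup fun i => pathLength (I.goal i) (P i)

/-- The 4-connected grid with `m₁` rows and `m₂` columns. -/
abbrev grid (m₁ m₂ : ℕ) : SimpleGraph (Fin m₁ × Fin m₂) :=
  (SimpleGraph.pathGraph m₁).boxProd (SimpleGraph.pathGraph m₂)

end MAPF

/-! ### A random access machine with a step count -/

namespace RAM

/-- The memory: registers and arrays that hold natural numbers. -/
@[ext]
structure State where
  /-- contents of the registers -/
  reg : ℕ → ℕ
  /-- `arr a k` is the `k`-th entry of the array `a` -/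
  arr : ℕ → ℕ → ℕ

/-- Overwrite register `x`. -/
def State.setReg (σ : State) (x v : ℕ) : State :=
  ⟨Function.update σ.reg x v, σ.arr⟩

/-- Overwrite entry `k` of array `a`. -/
def State.setArr (σ : State) (a k v : ℕ) : State :=
  ⟨σ.reg, Function.update σ.arr a (Function.update (σ.arr a) k v)⟩

/-- Programs. Registers and arrays are named by fixed numbers in the program text; array entries
are addressed indirectly, through the contents of a register. There is no multiplication, so that
numbers grow by at most one bit per step, and unit cost is polynomially equivalent to time on a
Turing machine. -/
inductive Prog : Type
  /-- do nothing -/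
  | skip : Prog
  /-- `x := c` -/
  | const (x c : ℕ) : Prog
  /-- `x := y + z` -/
  | add (x y z : ℕ) : Prog
  /-- `x := y - z` (truncated at zero) -/
  | sub (x y z : ℕ) : Prog
  /-- `x := a[y]` -/
  | load (x a y : ℕ) : Prog
  /-- `a[y] := x` -/
  | store (a y x : ℕ) : Prog
  /-- first `p`, then `q` -/
  | seq (p q : Prog) : Prog
  /-- `if x ≠ 0 then p else q` -/
  | ite (x : ℕ) (p q : Prog) : Prog
  /-- `while x ≠ 0 do p` -/
  | loop (x : ℕ) (p : Prog) : Prog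

/-- `Runs p σ k τ`: started in memory `σ`, the program `p` halts after exactly `k` steps, in
memory `τ`. Every elementary instruction and every test counts as one step. -/
inductive Runs : Prog → State → ℕ → State → Prop
  | skip (σ : State) : Runs .skip σ 1 σ
  | const (σ : State) (x c : ℕ) : Runs (.const x c) σ 1 (σ.setReg x c)
  | add (σ : State) (x y z : ℕ) : Runs (.add x y z) σ 1 (σ.setReg x (σ.reg y + σ.reg z))
  | sub (σ : State) (x y z : ℕ) : Runs (.sub x y z) σ 1 (σ.setReg x (σ.reg y - σ.reg z))
  | load (σ : State) (x a y : ℕ) : Runs (.load x a y) σ 1 (σ.setReg x (σ.arr a (σ.reg y)))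
  | store (σ : State) (a y x : ℕ) : Runs (.store a y x) σ 1 (σ.setArr a (σ.reg y) (σ.reg x))
  | seq {p q : Prog} {σ τ ρ : State} {k l : ℕ} :
      Runs p σ k τ → Runs q τ l ρ → Runs (.seq p q) σ (k + l) ρ
  | ite_true {x : ℕ} {p q : Prog} {σ τ : State} {k : ℕ} :
      σ.reg x ≠ 0 → Runs p σ k τ → Runs (.ite x p q) σ (k + 1) τ
  | ite_false {x : ℕ} {p q : Prog} {σ τ : State} {k : ℕ} :
      σ.reg x = 0 → Runs q σ k τ → Runs (.ite x p q) σ (k + 1) τ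
  | loop_done {x : ℕ} {p : Prog} {σ : State} :
      σ.reg x = 0 → Runs (.loop x p) σ 1 σ
  | loop_step {x : ℕ} {p : Prog} {σ τ ρ : State} {k l : ℕ} :
      σ.reg x ≠ 0 → Runs p σ k τ → Runs (.loop x p) τ l ρ → Runs (.loop x p) σ (k + l + 1) ρ

/-- The machine is deterministic: number of steps and final memory are determined by the program
and the initial memory. -/
theorem Runs.det {p : Prog} {σ τ τ' : State} {k k' : ℕ} (h : Runs p σ k τ)
    (h' : Runs p σ k' τ') : k = k' ∧ τ = τ' := by
  induction h generalizing k' τ' with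
  | skip | const | add | sub | load | store => cases h'; exact ⟨rfl, rfl⟩
  | seq _ _ ih₁ ih₂ =>
    cases h' with
    | seq a b =>
      obtain ⟨rfl, rfl⟩ := ih₁ a
      obtain ⟨rfl, rfl⟩ := ih₂ b
      exact ⟨rfl, rfl⟩
  | ite_true hx _ ih =>
    cases h' with
    | ite_true _ a => obtain ⟨rfl, rfl⟩ := ih a; exact ⟨rfl, rfl⟩
    | ite_false hx' _ => exact absurd hx' hx
  | ite_false hx _ ih =>
    cases h' with
    | ite_true hx' _ => exact absurd hx hx'
    | ite_false _ a => obtain ⟨rfl, rfl⟩ := ih a; exact ⟨rfl, rfl⟩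
  | loop_done hx =>
    cases h' with
    | loop_done => exact ⟨rfl, rfl⟩
    | loop_step hx' => exact absurd hx hx'
  | loop_step hx _ _ ih₁ ih₂ =>
    cases h' with
    | loop_done hx' => exact absurd hx' hx
    | loop_step _ a b =>
      obtain ⟨rfl, rfl⟩ := ih₁ a
      obtain ⟨rfl, rfl⟩ := ih₂ b
      exact ⟨rfl, rfl⟩

end RAM

/-! ### Input and output of a MAPF algorithm on grids -/

namespace MAPF

/-- The array with entries `f 0, …, f (n - 1)`, padded with zeros. -/
def toArray {n : ℕ} (f : Fin n → ℕ) (k : ℕ) : ℕ :=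
  if h : k < n then f ⟨k, h⟩ else 0

/-- The initial memory on input `I`: registers `0, 1, 2` hold the number of rows, of columns and of
agents; arrays `0, 1` hold the rows and columns of the start vertices, and arrays `2, 3` those of
the goal vertices. Everything else is zero. -/
def inputState {m₁ m₂ n : ℕ} (I : Instance (Fin m₁ × Fin m₂) n) : RAM.State where
  reg := fun x => if x = 0 then m₁ else if x = 1 then m₂ else if x = 2 then n else 0
  arr := fun a =>
    if a = 0 then toArray fun i => ((I.start i).1 : ℕ)
    else if a = 1 then toArray fun i => ((I.start i).2 : ℕ)
    else if a = 2 then toArray fun i => ((I.goal i).1 : ℕ)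
    else if a = 3 then toArray fun i => ((I.goal i).2 : ℕ)
    else fun _ => 0

/-- The memory `σ` spells out the path set `P`: with `T` the contents of register `0`, arrays `4`
and `5` hold, at index `t * n + i`, the row and the column of agent `i` at time `t ≤ T`, and all
agents rest from time `T` on. -/
def IsOutput {m₁ m₂ n : ℕ} (σ : RAM.State) (P : Fin n → ℕ → Fin m₁ × Fin m₂) : Prop :=
  (∀ (i : Fin n) (t : ℕ), t ≤ σ.reg 0 →
    σ.arr 4 (t * n + i) = ((P i t).1 : ℕ) ∧ σ.arr 5 (t * n + i) = ((P i t).2 : ℕ)) ∧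
  ∀ (i : Fin n) (t : ℕ), σ.reg 0 ≤ t → P i t = P i (σ.reg 0)

end MAPF

/-! ### A structured language of bounded loops, compiled to the random access machine -/

namespace LoopLang

open RAM

/-! Routing on a full grid reduces to sorting lines. Regard every agent as an edge between its start
row and its goal row. This bipartite multigraph has degrees at most `m₂`, so by König's theorem its
edges can be properly coloured with `m₂` colours. Agents of one start row have different colours, so
the rows can be permuted until each agent stands in the column numbered by its colour. Agents of one
column then have different goal rows, so the columns can be permuted to bring each agent to its goal
row; a last permutation of the rows finishes the routing. If all lines of length `L` can be permuted
simultaneously within `4 * L` steps, the total is `4 * m₂ + 4 * m₁ + 4 * m₂`.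

Without empty vertices agents can only rotate along cycles, so neighbouring lines must cooperate.
Lines are grouped in pairs, with one triple if their number is odd, and these bands are cut into
windows of three or four columns. A finite check shows that any permutations of the rows of such a
block can be carried out in eight steps (`exists_full_plan`), and that six steps suffice to
separate, in each row, the agents meant for the first two columns from the others
(`exists_split_plan`).

A line is sorted by odd-even transposition sort on cells of two positions, comparisons being
replaced by sorting a window of two cells; consecutive rounds use windows shifted by one cell. A 0-1
argument (`Run.le_count`) shows that `(L + 1) / 2` rounds bring each item to its cell. This costs `4
* L` steps for even `L` and four too many for odd `L`. The order inside cells matters only at the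
end, so for odd `L ≥ 5` the first two rounds merely split the windows, which saves these four steps.

For the algorithm, edges are coloured one at a time with Kempe chains (`Chain.step`). There are only
finitely many situations of a block, so all motion plans are part of the program text, as constant
tables indexed by lists of hexadecimal digits; at run time only ranks are computed and looked up.
The program is written in a language whose loops are bounded by constants or by input registers, so
that a polynomial bound for the running time follows by recursion on the program
(`Stmt.compile_runs`). -/

@[simp] theorem setReg_reg (σ : State) (x v y : ℕ) :
    (σ.setReg x v).reg y = if y = x then v else σ.reg y := by
  simp [State.setReg, Function.update_apply]

@[simp] theorem setReg_arr (σ : State) (x v : ℕ) : (σ.setReg x v).arr = σ.arr := rfl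

@[simp] theorem setArr_reg (σ : State) (a k v : ℕ) : (σ.setArr a k v).reg = σ.reg := rfl

@[simp] theorem setArr_arr (σ : State) (a k v b l : ℕ) :
    (σ.setArr a k v).arr b l = if b = a ∧ l = k then v else σ.arr b l := by
  by_cases hb : b = a
  · subst hb; by_cases hl : l = k <;> simp [State.setArr, hl]
  · simp [State.setArr, hb]

/-- Expressions over registers and arrays. -/
inductive Expr : Type
  | reg (x : ℕ)
  | lit (c : ℕ)
  | add (a b : Expr)
  | sub (a b : Expr)
  | arr (a : ℕ) (e : Expr)

/-- Programs with assignments of expressions and loops with bounds fixed on entry. -/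
inductive Stmt : Type
  | skip
  | set (x : ℕ) (e : Expr)
  | store (a : ℕ) (i e : Expr)
  | seq (p q : Stmt)
  | ite (e : Expr) (p q : Stmt)
  /-- `for x = 0, …, reg b - 1 do p` -/
  | rep (x b : ℕ) (p : Stmt)
  /-- `for x = 0, …, c - 1 do p` -/
  | repc (x c : ℕ) (p : Stmt)

/-- Registers below this number are visible to structured programs. -/
def userRegs : ℕ := 50

namespace Expr

/-- The value of an expression. -/
@[simp] def eval : Expr → State → ℕ
  | reg x, σ => σ.reg x
  | lit c, _ => c
  | add a b, σ => a.eval σ + b.eval σ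
  | sub a b, σ => a.eval σ - b.eval σ
  | arr a e, σ => σ.arr a (e.eval σ)

/-- All registers are visible ones. -/
@[simp] def ok : Expr → Bool
  | reg x => decide (x < userRegs)
  | lit _ => true
  | add a b => a.ok && b.ok
  | sub a b => a.ok && b.ok
  | arr _ e => e.ok

/-- Code that puts the value into register `s`, using only registers from `s` on. -/
def compile : Expr → ℕ → Prog
  | reg x, s => .seq (.const s 0) (.add s x s)
  | lit c, s => .const s c
  | add a b, s => .seq (a.compile s) (.seq (b.compile (s + 1)) (.add s s (s + 1)))
  | sub a b, s => .seq (a.compile s) (.seq (b.compile (s + 1)) (.sub s s (s + 1)))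
  | arr a e, s => .seq (e.compile s) (.load s a s)

/-- Running time of the code of an expression. -/
def cost : Expr → ℕ
  | reg _ => 2
  | lit _ => 1
  | add a b => a.cost + (b.cost + 1)
  | sub a b => a.cost + (b.cost + 1)
  | arr _ e => e.cost + 1

theorem eval_congr {σ τ : State} (hr : ∀ x < userRegs, σ.reg x = τ.reg x) (ha : σ.arr = τ.arr)
    (e : Expr) (he : e.ok) : e.eval σ = e.eval τ := by
  induction e with
  | reg x => exact hr x (by simpa using he)
  | lit c => rfl
  | add a b iha ihb => simp at he; simp [iha he.1, ihb he.2]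
  | sub a b iha ihb => simp at he; simp [iha he.1, ihb he.2]
  | arr a e ih => simp at he; simp [ih he, ha]

/-- Scratch registers form a stack: the second operand is evaluated from `s + 1` on, so the first
result survives in register `s`. As there is no move instruction, a copy is an assignment of `0`
followed by an addition. -/
theorem compile_runs (e : Expr) (he : e.ok) (s : ℕ) (hs : userRegs ≤ s) (σ : State) :
    ∃ τ, Runs (e.compile s) σ e.cost τ ∧ τ.arr = σ.arr ∧ (∀ x < s, τ.reg x = σ.reg x) ∧
      τ.reg s = e.eval σ := by
  induction e generalizing s σ with
  | reg x =>
    have hx : x < userRegs := by simpa using he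
    refine ⟨_, .seq (.const _ _ _) (.add _ _ _ _), rfl, fun y hy => ?_, ?_⟩
    · simp [hy.ne]
    · simp [(hx.trans_le hs).ne]
  | lit c => exact ⟨_, .const _ _ _, rfl, fun y hy => by simp [hy.ne], by simp⟩
  | add a b iha ihb =>
    simp at he
    obtain ⟨τ, h1, h2, h3, h4⟩ := iha he.1 s hs σ
    obtain ⟨ρ, g1, g2, g3, g4⟩ := ihb he.2 (s + 1) (by omega) τ
    refine ⟨_, .seq h1 (.seq g1 (.add _ _ _ _)), by simp [g2, h2], fun y hy => ?_, ?_⟩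
    · simp [hy.ne, g3 y (by omega), h3 y hy]
    · simp [g3 s (by omega), h4, g4]
      exact eval_congr (fun x hx => h3 x (by omega)) h2 b he.2
  | sub a b iha ihb =>
    simp at he
    obtain ⟨τ, h1, h2, h3, h4⟩ := iha he.1 s hs σ
    obtain ⟨ρ, g1, g2, g3, g4⟩ := ihb he.2 (s + 1) (by omega) τ
    refine ⟨_, .seq h1 (.seq g1 (.sub _ _ _ _)), by simp [g2, h2], fun y hy => ?_, ?_⟩
    · simp [hy.ne, g3 y (by omega), h3 y hy]
    · simp [g3 s (by omega), h4, g4]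
      rw [eval_congr (fun x hx => h3 x (by omega)) h2 b he.2]
  | arr a e ih =>
    simp at he
    obtain ⟨τ, h1, h2, h3, h4⟩ := ih he s hs σ
    exact ⟨_, .seq h1 (.load _ _ _ _), by simp [h2], fun y hy => by simp [hy.ne, h3 y hy],
      by simp [h4, h2]⟩

end Expr

/-- Apply `f 0`, …, `f (N - 1)` in turn. -/
def iter (f : ℕ → State → State) : ℕ → State → State
  | 0, σ => σ
  | N + 1, σ => f N (iter f N σ)

/-- The invariant rule by which most loops below are verified. -/
theorem iter_inv {f : ℕ → State → State} {N : ℕ} {σ : State} (I : ℕ → State → Prop) (h0 : I 0 σ)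
    (hs : ∀ k τ, k < N → I k τ → I (k + 1) (f k τ)) : I N (iter f N σ) := by
  induction N with
  | zero => exact h0
  | succ N ih => exact hs N _ N.lt_succ_self (ih fun k τ hk => hs k τ (hk.trans N.lt_succ_self))

namespace Stmt

/-- The final memory of a structured program. -/
@[simp] def eval : Stmt → State → State
  | skip, σ => σ
  | set x e, σ => σ.setReg x (e.eval σ)
  | store a i e, σ => σ.setArr a (i.eval σ) (e.eval σ)
  | seq p q, σ => q.eval (p.eval σ)
  | ite e p q, σ => if e.eval σ ≠ 0 then p.eval σ else q.eval σ
  | rep x b p, σ => iter (fun k τ => p.eval (τ.setReg x k)) (σ.reg b) σ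
  | repc x c p, σ => iter (fun k τ => p.eval (τ.setReg x k)) c σ

/-- Only visible registers occur, the input registers `0, 1, 2` are never written, and they are
the only loop bounds apart from constants. -/
@[simp] def ok : Stmt → Bool
  | skip => true
  | set x e => decide (x < userRegs) && decide (3 ≤ x) && e.ok
  | store _ i e => i.ok && e.ok
  | seq p q => p.ok && q.ok
  | ite e p q => e.ok && p.ok && q.ok
  | rep x b p => decide (x < userRegs) && decide (3 ≤ x) && decide (b < 3) && p.ok
  | repc x _ p => decide (x < userRegs) && decide (3 ≤ x) && p.ok

/-- The registers that a program may change. -/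
@[simp] def writes : Stmt → ℕ → Bool
  | skip, _ => false
  | set x _, y => decide (y = x)
  | store _ _ _, _ => false
  | seq p q, y => p.writes y || q.writes y
  | ite _ p q, y => p.writes y || q.writes y
  | rep x _ p, y => decide (y = x) || p.writes y
  | repc x _ p, y => decide (y = x) || p.writes y

theorem eval_reg (p : Stmt) {x : ℕ} (h : p.writes x = false) (σ : State) :
    (p.eval σ).reg x = σ.reg x := by
  induction p generalizing σ with
  | skip => rfl
  | set y e => simp at h; simp [h]
  | store => rfl
  | seq p q ihp ihq => simp at h; simp [ihp h.1, ihq h.2]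
  | ite e p q ihp ihq => simp at h; by_cases he : e.eval σ = 0 <;> simp [he, ihp h.1, ihq h.2]
  | rep y b p ih | repc y c p ih =>
    simp at h
    exact iter_inv (fun _ τ => τ.reg x = σ.reg x) rfl fun k τ _ hτ => by
      simp [ih h.2, h.1, hτ]

/-- Keeps the variable loop bounds constant throughout a program, which makes the polynomial `cost`
a valid bound. -/
theorem writes_of_ok (p : Stmt) (h : p.ok) {x : ℕ} (hx : x < 3) : p.writes x = false := by
  induction p with
  | skip => rfl
  | set y e => simp at h ⊢; omega
  | store => rfl
  | seq p q ihp ihq => simp at h; simp [ihp h.1, ihq h.2]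
  | ite e p q ihp ihq => simp at h; simp [ihp h.1.2, ihq h.2]
  | rep y b p ih => simp at h; simp [ih h.2]; omega
  | repc y c p ih => simp at h; simp [ih h.2]; omega

/-- The body of a compiled loop: register `s` counts down, register `s + 1` counts up. -/
def loopBody (x s : ℕ) (c : Prog) : Prog :=
  .seq (.const x 0) <| .seq (.add x x (s + 1)) <| .seq c <| .seq (.const (s + 2) 1) <|
    .seq (.add (s + 1) (s + 1) (s + 2)) (.sub s s (s + 2))

/-- Machine code of a structured program, with scratch registers from `s` on. -/
def compile : Stmt → ℕ → Prog
  | skip, _ => .skip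
  | set x e, s => .seq (e.compile s) (.seq (.const x 0) (.add x x s))
  | store a i e, s => .seq (i.compile s) (.seq (e.compile (s + 1)) (.store a s (s + 1)))
  | seq p q, s => .seq (p.compile s) (q.compile s)
  | ite e p q, s => .seq (e.compile s) (.ite s (p.compile s) (q.compile s))
  | rep x b p, s => .seq (.const s 0) <| .seq (.add s b s) <| .seq (.const (s + 1) 0) <|
      .loop s (loopBody x s (p.compile (s + 2)))
  | repc x c p, s => .seq (.const s c) <| .seq (.const (s + 1) 0) <|
      .loop s (loopBody x s (p.compile (s + 2)))

open Polynomial in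
/-- A bound for the running time, in terms of a bound for the input registers. -/
noncomputable def cost : Stmt → Polynomial ℕ
  | skip => 1
  | set _ e => C (e.cost + 2)
  | store _ i e => C (i.cost + (e.cost + 1))
  | seq p q => p.cost + q.cost
  | ite e p q => C e.cost + (p.cost + q.cost + 1)
  | rep _ _ p => 4 + X * (p.cost + 6)
  | repc _ c p => 3 + C c * (p.cost + 6)

/-- Two memories with the same arrays and the same visible registers. -/
def Agree (σ τ : State) : Prop := σ.arr = τ.arr ∧ ∀ x < userRegs, σ.reg x = τ.reg x

/-- The counters survive the body because the body preserves the scratch registers below `s + 2`.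
Apart from the body, an iteration costs six steps: five instructions and the loop test. The start
index `j` is general so that induction on the number of remaining iterations works. -/
theorem loop_runs {x s : ℕ} {c : Prog} {f : State → State} {B R : ℕ} (hx : x < userRegs)
    (hs : userRegs ≤ s)
    (hf : ∀ σ τ, Agree σ τ → (∀ y < 3, τ.reg y ≤ R) →
      ∃ k ρ, Runs c σ k ρ ∧ k ≤ B ∧ Agree ρ (f τ) ∧ ∀ y, userRegs ≤ y → y < s + 2 → ρ.reg y = σ.reg y)
    (hfR : ∀ τ, (∀ y < 3, τ.reg y ≤ R) → ∀ y < 3, (f τ).reg y ≤ R) (hx3 : 3 ≤ x)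
    (N j : ℕ) (σ τ : State)
    (hστ : Agree σ (iter (fun k τ => f (τ.setReg x k)) j τ)) (hR : ∀ y < 3, τ.reg y ≤ R)
    (h0 : σ.reg s = N) (h1 : σ.reg (s + 1) = j) :
    ∃ k ρ, Runs (.loop s (loopBody x s c)) σ k ρ ∧ k ≤ 1 + N * (B + 6) ∧
      Agree ρ (iter (fun k τ => f (τ.setReg x k)) (j + N) τ) ∧
      ∀ y, userRegs ≤ y → y < s → ρ.reg y = σ.reg y := by
  induction N generalizing j σ with
  | zero => exact ⟨1, σ, .loop_done h0, by simp, hστ, fun _ _ _ => rfl⟩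
  | succ N ih =>
    set g := fun k τ => f (State.setReg τ x k) with hg
    have hRi : ∀ y < 3, (iter g j τ).reg y ≤ R := by
      refine iter_inv (fun _ ρ => ∀ y < 3, ρ.reg y ≤ R) hR fun k ρ _ h => hfR _ fun y hy => ?_
      simp [show y ≠ x by omega, h y hy]
    -- The first two instructions of the body copy the up-counter into the loop variable.
    have hA : Agree ((σ.setReg x 0).setReg x (0 + j)) ((iter g j τ).setReg x j) := by
      refine ⟨by simpa using hστ.1, fun y hy => ?_⟩
      by_cases hyx : y = x <;> simp [hyx]
      exact hστ.2 y hy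
    obtain ⟨k, ρ, r1, r2, r3, r4⟩ := hf _ _ hA (fun y hy => by
      simp [show y ≠ x by omega, hRi y hy])
    set ρ' := ((ρ.setReg (s + 2) 1).setReg (s + 1) (ρ.reg (s + 1) + 1)).setReg s (ρ.reg s - 1) with hρ'
    have e1 : ρ.reg (s + 1) = j := by
      rw [r4 _ (by omega) (by omega)]; simp [show s + 1 ≠ x by omega, h1]
    have e0 : ρ.reg s = N + 1 := by
      rw [r4 _ (by omega) (by omega)]; simp [show s ≠ x by omega, h0]
    have hbody : Runs (loopBody x s c) σ (1 + (1 + (k + (1 + (1 + 1))))) ρ' := by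
      have a1 := Runs.add (σ.setReg x 0) x x (s + 1)
      have a2 := Runs.add (ρ.setReg (s + 2) 1) (s + 1) (s + 1) (s + 2)
      have a3 := Runs.sub ((ρ.setReg (s + 2) 1).setReg (s + 1) (ρ.reg (s + 1) + 1)) s s (s + 2)
      simp only [setReg_reg, show s + 1 ≠ x by omega, h1, if_true, if_false] at a1
      simp at a2 a3
      exact .seq (.const _ _ _) (.seq a1 (.seq r1 (.seq (.const _ _ _) (.seq a2 a3))))
    obtain ⟨k', ρ'', q1, q2, q3, q4⟩ := ih (j + 1) ρ' ⟨r3.1, fun y hy => by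
        simp [hρ', show y ≠ s by omega, show y ≠ s + 1 by omega, show y ≠ s + 2 by omega]
        exact r3.2 y hy⟩ (by simp [hρ', e0]) (by simp [hρ', e1])
    refine ⟨_, ρ'', .loop_step (by omega) hbody q1, ?_, by rwa [show j + (N + 1) = j + 1 + N by ring],
      fun y hy hys => ?_⟩
    · have : (N + 1) * (B + 6) = N * (B + 6) + (B + 6) := by ring
      omega
    · rw [q4 y hy hys]
      simp [hρ', show y ≠ s by omega, show y ≠ s + 1 by omega, show y ≠ s + 2 by omega]
      rw [r4 y hy (by omega)]; simp [show y ≠ x by omega]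

/-- Source and machine memory need to agree only on arrays and visible registers, while scratch
registers below `s` are untouched; this is what makes nested code composable. The input registers
never change, so the same `R` bounds the loops at every depth. -/
theorem compile_runs (p : Stmt) (hp : p.ok) (R s : ℕ) (hs : userRegs ≤ s) (σ τ : State)
    (hστ : Agree σ τ) (hR : ∀ y < 3, τ.reg y ≤ R) :
    ∃ k ρ, Runs (p.compile s) σ k ρ ∧ k ≤ p.cost.eval R ∧ Agree ρ (p.eval τ) ∧
      ∀ y, userRegs ≤ y → y < s → ρ.reg y = σ.reg y := by
  induction p generalizing s σ τ with
  | skip => exact ⟨1, σ, .skip _, by simp [cost], hστ, fun _ _ _ => rfl⟩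
  | set x e =>
    simp at hp
    obtain ⟨ρ, h1, h2, h3, h4⟩ := e.compile_runs hp.2 s hs σ
    refine ⟨_, _, .seq h1 (.seq (.const _ _ _) (.add _ _ _ _)), by simp [cost], ⟨?_, fun y hy => ?_⟩,
      fun y hy hys => ?_⟩
    · simp [h2, hστ.1]
    · by_cases hyx : y = x
      · simp [hyx, show s ≠ x by omega, h4]
        exact Expr.eval_congr hστ.2 hστ.1 e hp.2
      · simp [hyx, h3 y (by omega)]; exact hστ.2 y hy
    · simp [show y ≠ x by omega, h3 y hys]
  | store a i e =>
    simp at hp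
    obtain ⟨ρ, h1, h2, h3, h4⟩ := i.compile_runs hp.1 s hs σ
    obtain ⟨ρ', g1, g2, g3, g4⟩ := e.compile_runs hp.2 (s + 1) (by omega) ρ
    have ei : ρ'.reg s = i.eval τ := by
      rw [g3 s (by omega), h4]; exact Expr.eval_congr hστ.2 hστ.1 i hp.1
    have ee : ρ'.reg (s + 1) = e.eval τ := by
      rw [g4]
      exact Expr.eval_congr (fun x hx => (h3 x (by omega)).trans (hστ.2 x hx)) (h2.trans hστ.1) e hp.2
    refine ⟨_, _, .seq h1 (.seq g1 (.store _ _ _ _)), by simp [cost], ⟨?_, fun y hy => ?_⟩,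
      fun y hy hys => ?_⟩
    · simp [ei, ee, State.setArr, g2, h2, hστ.1]
    · simp [g3 y (by omega), h3 y (by omega)]; exact hστ.2 y hy
    · simp [g3 y (by omega), h3 y (by omega)]
  | seq p q ihp ihq =>
    simp at hp
    obtain ⟨k, ρ, h1, h2, h3, h4⟩ := ihp hp.1 s hs σ τ hστ hR
    obtain ⟨k', ρ', g1, g2, g3, g4⟩ := ihq hp.2 s hs ρ _ h3 (fun y hy => by
      rw [eval_reg p (writes_of_ok p hp.1 hy)]; exact hR y hy)
    exact ⟨_, _, .seq h1 g1, by simp [cost]; omega, g3, fun y hy hys => (g4 y hy hys).trans (h4 y hy hys)⟩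
  | ite e p q ihp ihq =>
    simp at hp
    obtain ⟨ρ, h1, h2, h3, h4⟩ := e.compile_runs hp.1.1 s hs σ
    have ee : ρ.reg s = e.eval τ := by rw [h4]; exact Expr.eval_congr hστ.2 hστ.1 e hp.1.1
    have hρ : Agree ρ τ := ⟨h2.trans hστ.1, fun x hx => (h3 x (by omega)).trans (hστ.2 x hx)⟩
    by_cases he : e.eval τ = 0
    · obtain ⟨k', ρ', g1, g2, g3, g4⟩ := ihq hp.2 s hs ρ τ hρ hR
      exact ⟨_, _, .seq h1 (.ite_false (ee.trans he) g1), by simp [cost]; omega, by simpa [he] using g3,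
        fun y hy hys => (g4 y hy hys).trans (h3 y hys)⟩
    · obtain ⟨k', ρ', g1, g2, g3, g4⟩ := ihp hp.1.2 s hs ρ τ hρ hR
      exact ⟨_, _, .seq h1 (.ite_true (ee ▸ he) g1), by simp [cost]; omega, by simpa [he] using g3,
        fun y hy hys => (g4 y hy hys).trans (h3 y hys)⟩
  | rep x b p ih =>
    simp at hp
    set σ' := ((σ.setReg s 0).setReg s (σ.reg b + 0)).setReg (s + 1) 0 with hσ'
    have hb : b < s := by have := hp.1.2; have : 3 ≤ userRegs := by decide
                          omega
    have hA : Agree σ' τ := ⟨hστ.1, fun y hy => by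
      simp [hσ', show y ≠ s by omega, show y ≠ s + 1 by omega]; exact hστ.2 y hy⟩
    obtain ⟨k, ρ, h1, h2, h3, h4⟩ := loop_runs (B := p.cost.eval R) (f := p.eval) (R := R) hp.1.1.1 hs
      (fun σ τ h hR => ih hp.2 (s + 2) (by omega) σ τ h hR)
      (fun τ h y hy => by rw [eval_reg p (writes_of_ok p hp.2 hy)]; exact h y hy) hp.1.1.2
      (σ.reg b) 0 σ' τ hA hR (by simp [hσ']) (by simp [hσ'])
    have hbσ : σ.reg b = τ.reg b := hστ.2 b (by have : 3 ≤ userRegs := by decide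
                                                omega)
    have a1 := Runs.add (σ.setReg s 0) s b s
    simp only [setReg_reg, hb.ne, if_true, if_false] at a1
    refine ⟨_, ρ, .seq (.const _ _ _) (.seq a1 (.seq (.const _ _ _) h1)), ?_, ?_,
      fun y hy hys => ?_⟩
    · have := Nat.mul_le_mul_right (p.cost.eval R + 6) (hR b hp.1.2)
      simp [cost]; rw [hbσ] at h2; omega
    · simpa [hbσ] using h3
    · rw [h4 y hy hys]; simp [hσ', show y ≠ s by omega, show y ≠ s + 1 by omega]
  | repc x c p ih =>
    simp at hp
    set σ' := (σ.setReg s c).setReg (s + 1) 0 with hσ'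
    have hA : Agree σ' τ := ⟨hστ.1, fun y hy => by
      simp [hσ', show y ≠ s by omega, show y ≠ s + 1 by omega]; exact hστ.2 y hy⟩
    obtain ⟨k, ρ, h1, h2, h3, h4⟩ := loop_runs (B := p.cost.eval R) (f := p.eval) (R := R) hp.1.1 hs
      (fun σ τ h hR => ih hp.2 (s + 2) (by omega) σ τ h hR)
      (fun τ h y hy => by rw [eval_reg p (writes_of_ok p hp.2 hy)]; exact h y hy) hp.1.2
      c 0 σ' τ hA hR (by simp [hσ']) (by simp [hσ'])
    refine ⟨_, ρ, .seq (.const _ _ _) (.seq (.const _ _ _) h1), ?_, ?_, fun y hy hys => ?_⟩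
    · simp [cost]; omega
    · simpa using h3
    · rw [h4 y hy hys]; simp [hσ', show y ≠ s by omega, show y ≠ s + 1 by omega]

/-- Sequential composition of a list of programs. -/
def seqs : List Stmt → Stmt
  | [] => skip
  | p :: l => seq p (seqs l)

end Stmt

end LoopLang

/-! ### Motion plans for small blocks -/

namespace BlockPlan

/-- Equal or neighbouring cells of a block with `w` columns, where the cell in row `r` and column
`c` has number `w * r + c`. -/
def near (w a b : ℕ) : Bool :=
  Nat.beq a b || Nat.beq a (b + w) || Nat.beq b (a + w) ||
    (Nat.beq (a / w) (b / w) && (Nat.beq a (b + 1) || Nat.beq b (a + 1)))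

/-- `F s q` is the cell at time `s` of the agent that starts in cell `q` of an `h × w` block, in a
collision-free motion of `T` steps. -/
structure IsPlan (h w T : ℕ) (F : ℕ → ℕ → ℕ) : Prop where
  init : ∀ q < h * w, F 0 q = q
  bound : ∀ s ≤ T, ∀ q < h * w, F s q < h * w
  inj : ∀ s ≤ T, ∀ q < h * w, ∀ p < h * w, F s q = F s p → q = p
  move : ∀ s < T, ∀ q < h * w, near w (F s q) (F (s + 1) q)
  noswap : ∀ s < T, ∀ q < h * w, ∀ p < h * w, q ≠ p → ¬ (F s q = F (s + 1) p ∧ F s p = F (s + 1) q)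

/-- `f k` holds for all `k < n`. -/
def allBelow (n : ℕ) (f : ℕ → Bool) : Bool :=
  Nat.rec true (fun k r => f k && r) n

theorem allBelow_iff {n : ℕ} {f : ℕ → Bool} : allBelow n f = true ↔ ∀ k < n, f k = true := by
  induction n with
  | zero => simp [allBelow]
  | succ n ih =>
    have : allBelow (n + 1) f = (f n && allBelow n f) := rfl
    rw [this, Bool.and_eq_true, ih]
    constructor
    · rintro ⟨h1, h2⟩ k hk
      rcases Nat.lt_succ_iff_lt_or_eq.1 hk with h | rfl
      exacts [h2 k h, h1]
    · exact fun h => ⟨h n n.lt_succ_self, fun k hk => h k (hk.trans n.lt_succ_self)⟩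

/-- The `i`-th hexadecimal digit. -/
def dig (N i : ℕ) : ℕ := Nat.mod (Nat.shiftRight N (Nat.mul 4 i)) 16

/-- The `s`-th letter of a word over an alphabet of at most 128 letters. -/
def letter (word s : ℕ) : ℕ := (word >>> (7 * s)) % 128

/-- Apply the moves `mv 0`, …, `mv (s - 1)`, where move `m` takes cell `q` of a block of `n` cells
to the cell given by digit `n * m + q` of `M`. -/
def walk (M n : ℕ) (mv : ℕ → ℕ) (s q : ℕ) : ℕ :=
  Nat.rec q (fun s z => dig M (n * mv s + z)) s

theorem walk_succ (M n : ℕ) (mv : ℕ → ℕ) (s q : ℕ) :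
    walk M n mv (s + 1) q = dig M (n * mv s + walk M n mv s q) := rfl

theorem walk_add (M n : ℕ) (mv : ℕ → ℕ) (s t q : ℕ) :
    walk M n mv (s + t) q = walk M n (fun i => mv (s + i)) t (walk M n mv s q) := by
  induction t with
  | zero => rfl
  | succ t ih => rw [← add_assoc, walk_succ, ih, walk_succ]

theorem walk_congr {M n : ℕ} {mv mv' : ℕ → ℕ} {s : ℕ} (h : ∀ i < s, mv i = mv' i) (q : ℕ) :
    walk M n mv s q = walk M n mv' s q := by
  induction s with
  | zero => rfl
  | succ s ih => rw [walk_succ, walk_succ, ih fun i hi => h i (by omega), h s (by omega)]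

/-- The move `m` is a collision-free step on a block of `n` cells with `w` columns. -/
def moveOK (M n w m : ℕ) : Bool :=
  allBelow n fun q => Nat.blt (dig M (n * m + q)) n && near w q (dig M (n * m + q)) &&
    allBelow n fun p => Nat.beq q p || (!Nat.beq (dig M (n * m + q)) (dig M (n * m + p)) &&
      !(Nat.beq q (dig M (n * m + p)) && Nat.beq p (dig M (n * m + q))))

/-- A valid move permutes the cells, so every prefix of the walk does. Hence the conditions on pairs
of agents at all times reduce to conditions on pairs of cells for each single move. -/
theorem isPlan_walk {M h w T : ℕ} {mv : ℕ → ℕ} (hmv : ∀ s < T, moveOK M (h * w) w (mv s)) :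
    IsPlan h w T (walk M (h * w) mv) := by
  have key : ∀ s < T, ∀ q < h * w, dig M (h * w * mv s + q) < h * w ∧
      near w q (dig M (h * w * mv s + q)) = true ∧ ∀ p < h * w, q ≠ p →
      dig M (h * w * mv s + q) ≠ dig M (h * w * mv s + p) ∧
      ¬ (q = dig M (h * w * mv s + p) ∧ p = dig M (h * w * mv s + q)) := by
    intro s hs q hq
    have := allBelow_iff.1 (hmv s hs) q hq
    simp only [Bool.and_eq_true, allBelow_iff, Bool.or_eq_true, Nat.blt_eq, Nat.beq_eq,
      Bool.not_eq_true', Bool.and_eq_false_iff] at this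
    refine ⟨this.1.1, this.1.2, fun p hp hqp => ?_⟩
    have h2 := (this.2 p hp).resolve_left hqp
    refine ⟨fun h => ?_, fun h => ?_⟩
    · have := h2.1; rw [← Bool.not_eq_true, Nat.beq_eq] at this; exact this h
    · rcases h2.2 with h3 | h3 <;> rw [← Bool.not_eq_true, Nat.beq_eq] at h3
      exacts [h3 h.1, h3 h.2]
  have bound : ∀ s ≤ T, ∀ q < h * w, walk M (h * w) mv s q < h * w := by
    intro s hs q hq
    induction s with
    | zero => exact hq
    | succ s ih => exact (key s (by omega) _ (ih (by omega))).1
  have inj : ∀ s ≤ T, ∀ q < h * w, ∀ p < h * w,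
      walk M (h * w) mv s q = walk M (h * w) mv s p → q = p := by
    intro s hs q hq p hp
    induction s with
    | zero => exact id
    | succ s ih =>
      intro h
      refine ih (by omega) ?_
      by_contra hne
      exact ((key s (by omega) _ (bound s (by omega) q hq)).2.2 _ (bound s (by omega) p hp) hne).1 h
  refine ⟨fun _ _ => rfl, bound, inj, fun s hs q hq => (key s hs _ (bound s hs.le q hq)).2.1,
    fun s hs q hq p hp hqp => ?_⟩
  exact ((key s hs _ (bound s hs.le q hq)).2.2 _ (bound s hs.le p hp)
    fun h => hqp (inj s hs.le q hq p hp h)).2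

/-- Data from which collision-free motions for all row-preserving permutations of an `h × w` block
can be read off. Permutations of cells are coded by hexadecimal digits, `96` bits of `ents` hold a
permutation, the number of a group of permutations in `wperm`, a mask, and a word of four moves. -/
structure Cert where
  /-- number of rows -/
  h : ℕ
  /-- number of columns -/
  w : ℕ
  /-- number of ways to choose the cells of a row whose agents go to the first two columns -/
  np : ℕ
  /-- number of permutations for each such choice -/
  nv : ℕ
  /-- number of moves -/
  nm : ℕ
  /-- number of entries -/
  ne : ℕ
  /-- number of words in `wword` -/
  nw : ℕ
  /-- list of the permutations of a row -/
  rows : ℕ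
  /-- list of the moves -/
  moves : ℕ
  /-- entries for the first half of a motion -/
  ents : ℕ
  /-- additional entries -/
  extras : List (ℕ × ℕ)
  /-- permutations for the second half of a motion -/
  wperm : ℕ
  /-- words of four moves for these permutations -/
  wword : ℕ
  /-- words of six moves -/
  splits : ℕ

namespace Cert

variable (c : Cert)

/-- number of permutations of a row -/
def R : ℕ := c.np * c.nv

/-- The target column of cell `j` of a row under permutation `k`. -/
def row (k j : ℕ) : ℕ := dig c.rows (Nat.add (Nat.mul c.w k) j)

/-- Target of the cell `q` under the row permutations given by the digits of `K` in base `R`. -/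
def target (K q : ℕ) : ℕ :=
  Nat.add (Nat.mul c.w (Nat.div q c.w))
    (c.row (Nat.mod (Nat.div K (Nat.pow c.R (Nat.div q c.w))) c.R) (Nat.mod q c.w))

/-- Numbers that combine the choices and the variants of the rows. -/
def patIdx (K : ℕ) : ℕ :=
  K % c.R / c.nv + c.np * (K / c.R % c.R / c.nv + c.np * (K / c.R ^ 2 % c.R / c.nv))

/-- Like `patIdx`, for the variants. -/
def varIdx (K : ℕ) : ℕ :=
  K % c.R % c.nv + c.nv * (K / c.R % c.R % c.nv + c.nv * (K / c.R ^ 2 % c.R % c.nv))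

/-- The four-letter word `word` is valid and has the effect `perm`. -/
def wordOK (word perm : ℕ) : Bool :=
  allBelow 4 (fun s => Nat.blt (letter word s) c.nm) &&
    allBelow (c.h * c.w) fun q =>
      Nat.beq (walk c.moves (c.h * c.w) (letter word) 4 q) (dig perm q)

/-- first half of the motion of an entry -/
def entPerm (e : ℕ) : ℕ := Nat.mod (Nat.shiftRight c.ents (Nat.mul 96 e)) 0x1000000000000

/-- word for the first half of the motion of an entry -/
def entWord (e : ℕ) : ℕ := (c.ents >>> (96 * e + 64)) % 2 ^ 28

/-- second half of the motion of an entry -/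
def second (e v : ℕ) : ℕ :=
  (c.ents >>> (96 * e + 48)) % 256 * c.nv ^ c.h + (v ^^^ ((c.ents >>> (96 * e + 56)) % 256))

/-- permutation number `i` for the second half of a motion -/
def wPerm (i : ℕ) : ℕ := Nat.mod (Nat.shiftRight c.wperm (Nat.mul 48 i)) 0x1000000000000

/-- word number `i` for the second half of a motion -/
def wWord (i : ℕ) : ℕ := (c.wword >>> (28 * i)) % 2 ^ 28

/-- Entry `e` works for the row permutations `K`. -/
def entOK (K e : ℕ) : Bool :=
  Nat.blt e c.ne && Nat.blt (c.second e (c.varIdx K)) c.nw &&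
    allBelow (c.h * c.w) fun q =>
      Nat.beq (dig (c.wPerm (c.second e (c.varIdx K))) (dig (c.entPerm e) q)) (c.target K q)

/-- There is a motion for every list of row permutations. -/
def fullOK : Bool :=
  -- The two nested ranges cover all `K < R ^ h` with shallow recursion; surplus indices are
  -- accepted by the first alternative.
  allBelow (Nat.div (Nat.pow c.R c.h) 128 + 1) fun a => allBelow 128 fun b =>
    Nat.ble (c.R ^ c.h) (Nat.add (Nat.mul 128 a) b) ||
      c.entOK (Nat.add (Nat.mul 128 a) b) (c.patIdx (Nat.add (Nat.mul 128 a) b)) ||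
        c.extras.any fun x => Nat.beq x.1 (c.patIdx (Nat.add (Nat.mul 128 a) b)) &&
          c.entOK (Nat.add (Nat.mul 128 a) b) x.2

/-- The word for sorting into the first two columns and the rest. -/
def splitWord (i : ℕ) : ℕ := (c.splits >>> (42 * i)) % 2 ^ 42

/-- There is a motion for every choice of the cells whose agents go to the first two columns. -/
def splitOK : Bool :=
  allBelow (c.np ^ c.h) fun i =>
    allBelow 6 (fun s => Nat.blt (letter (c.splitWord i) s) c.nm) &&
      allBelow (c.h * c.w) fun q =>
        Nat.beq (walk c.moves (c.h * c.w) (letter (c.splitWord i)) 6 q / c.w) (q / c.w) &&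
          (Nat.blt (walk c.moves (c.h * c.w) (letter (c.splitWord i)) 6 q % c.w) 2 ==
            Nat.blt (c.row (i / c.np ^ (q / c.w) % c.np * c.nv) (q % c.w)) 2)

/-- Everything but `fullOK` and `splitOK`. -/
def baseOK : Bool :=
  allBelow c.nm (moveOK c.moves (c.h * c.w) c.w) &&
    allBelow c.ne (fun e => c.wordOK (c.entWord e) (c.entPerm e)) &&
      allBelow c.nw (fun i => c.wordOK (c.wWord i) (c.wPerm i))

end Cert

/-- Certificate for blocks of 2 rows and 3 columns. -/
def cert23 : Cert where
  h := 2
  w := 3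
  np := 3
  nv := 2
  nm := 7
  ne := 9
  nw := 4
  rows := 0x12102021120201210
  moves := 0x430521530241254103514203413520253140543210
  ents := 0x804286000000000043510200a0420102000000003451200080430600000000004352100060830201000000004530120080c106030000000035402100200186000000000045321000c082040000000000543102004002840000000000543120000000000000000000543210
  extras := []
  wperm := 0x534201000000534210000000543201000000543210
  wword := 0x2183010c0418008082800000000
  splits := 0x30206100000a0420100001840608000060830200001860c0c000020c30000002860a04000041420000000000000000

/-- Certificate for blocks of 3 rows and 3 columns. -/
def cert33 : Cert where
  h := 3
  w := 3
  np := 3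
  nv := 2
  nm := 27
  ne := 27
  nw := 16
  rows := 0x12102021120201210
  moves := 0x876430521746830521863470521763840521763850241876530241863570241876254103586274103847256103587246103876514203587416203847516203763814520876413520746813520587236140876253140586273140763854210863574210587436210847536210746853210586473210876543210
  ents := 0x2220a99040000046783510202c4c994020100073846512000a00305000000064783521001e04616000000064785310202400316000000064785312000200918040000046785321003028990040000046758310201e04297000000064758312000a00c91000000064758321002220b15050000047683501202218a03040000047683512000600105040000047683521001a04516040000047685310201c00098040000047685312000000186040000047685321001a28a08050000047658301201c04a0b040000047658312000600608040000047658321002220a19040000074683510202618a03000000076483512000c00301000000076483521001a04616000000076485310202000316000000076485312000000100040000074685321000e08611040000074658310201400b100400000746583120000005080400000746583210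
  extras := []
  wperm := 0x863547201000863547210000864537201000864537210000873546201000873546210000874536201000874536210000386574201000386574210000486573201000486573210000387564201000387564210000487563201000487563210
  wword := 0x161498002180002430a030a180802430a051a54280320c3800410000125cd073204900300c380161c00032104800a48c021a24c022e04800
  splits := 0x9960c3c2812c4c99602003020610000302c9100400b1304240000a04201000061606240001c10c82000008d2a080002220a9a02008862c0c000060830200008960c340001804d0e000018c1008000306848800006813008000020c3000000d0a1e48000284c30700002860a040001c28a0800009822a0400002284000000514061c000145080000000000000000

/-- Certificate for blocks of 2 rows and 4 columns. -/
def cert24 : Cert where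
  h := 2
  w := 4
  np := 6
  nv := 4
  nm := 17
  ne := 42
  nw := 128
  rows := 0x12310230132103202131203031213022013210330123102023112300321132020312130302131202301231032013210
  moves := 0x6540732175403621624073513740265176403251621573043765210472653104371526047615320465147320751436203764215072643150625473103754261076543210
  ents := 0x2008000010700005340672100c24504090500002765043101c10080040600003720564102014683020300007461520300414383010400006251703400c1c000010400006521730401028503090000006427053100a205010505000056720341014245850f0100001457302601a105030a000000642751300200830b04000000467235100141c18205030000147632050203c684060500005762401301000508090000006247035101a0078e020100004715320601a00208080000006247531001424105050300001746302501e0478e030200004712360501624503050000007462053101600488010000007642035101600507010000007642305101c00188000000007642531001c0020700000000764235100120c3850100000076423105014106850f010000157402360160030e04010000175426030100c803090000006274305101a005010800000062745310002041840a00000062741530002002010a000000627413500203078d02000000762450130203c08300030000746153020160c784010000007624305100c00281020000007624513000000808000000007624351000000104000000007624315002030281000300007641503201208488030200007241035600e0048705000000724630510060848d0000000072645310000006090000000072643510000001800000000072643150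
  extras := [(30, 36), (25, 37), (10, 38), (34, 39), (5, 40), (29, 41)]
  wperm := 0x76543210000076543210000076543210000076543210000001546237000076543210000001546327000076543210000076543210000010457236000076543210000010457326000076543210000010547236000001547326000010547326000042015637000076543210000043015627000076543210000076543210000076543210000076543210000076543210000042015736000076543210000043015726000076543210000052014736000076543210000053014726000076543210000064502731000076543210000064503721000076543210000065402731000065412730000065403721000065413720000074502631000076543210000074503621000074513620000075402631000075412630000075403621000075413620000024503671000076543210000034502671000076543210000025403671000025413670000035402671000035412670000076543210000076543210000034502761000034512760000076543210000076543210000035402761000035412760000067042351000076543210000067043251000067143250000076543210000067152340000067053241000067153240000076042351000076142350000076043251000076143250000076052341000076152340000076053241000076153240000062043751000062143750000063042751000063142750000062053741000062153740000063052741000063152740000072043651000072143650000073042651000073142650000072053641000072153640000073052641000073152640000062743051000062743150000063742051000063742150000062753041000062753140000063752041000063752140000072643051000072643150000073642051000073642150000072653041000072653140000073652041000073652140000064052731000064152730000064053721000064153720000065042731000065142730000065043721000065143720000074052631000074152630000074053621000074153620000075042631000075142630000075043621000075143620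
  wword := 0x141020d000000014143100000000000000008204050000000082c3860000000101810f1210681120c700201830c0000000200828e000000000000000000000000000000000001e1880000000001e1870000000001e1411000000001e146810000000180c30600000001a0c30500000000618800121861020181810c401881c14205000000018140000c34287200c08510107901e000000a3c1871c0c30600000001a043000000000200c106160c8101a28700141460f000000000000001a14000122c48b00000000000000023c000121468f1218803000000010243071a2430000000001e10505083c700102430c1c3c207163c20012147830e3c1800c244001c3c20c0a243801e0c485100c7031640181183c208064058004184881c4018d0a28400183c20d0e1070314381801c4018b16401820a285801818405041848b1c1440514147030814103183c20a0a10200041848a1c184840a285001e10384121460306000001c3c20908102820a244801e0c3830c24089200c40306408000e24310083c10f102430f1218606061830014147050c181810210790200c405063c7801e0c38510107860c0c08512146050a00000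
  splits := 0xa2050a060070414280801628509040060314100800e2450304006041208000101881004002881420000063478e000028d08200001a3c710020068410040001a4080f020028b12200000a2c507000040a1014000180c483000060416000000e14806040018b0c380001c40703000028d14040000610182000008f1600000183c805020060f1c0c080184068300002860a04000062080000000900e000000e1878100005861a040000e1868000001091a00000042860000000000000000

/-- Certificate for blocks of 3 rows and 4 columns. -/
def cert34 : Cert where
  h := 3
  w := 4
  np := 6
  nv := 4
  nm := 117
  ne := 221
  nw := 1024
  rows := 0x12310230132103202131203031213022013210330123102023112300321132020312130302131202301231032013210
  moves := 0xba9865407321a698b5407321b9586a407321a958b6407321ba8465907321a684b5907321b9846a507321a984b6507321a958b7403621ba9875403621b9587a403621ba8475903621a984b7503621b9847a503621a984b2607351ba9862407351a698b2407351ba8462907351a684b2907351ba98374026517b983a402651ba84379026517b843a902651a984b7603251b9847a603251a698b74032517b986a403251ba9876403251a684b79032517b846a903251ba8476903251ba9862157304a698b2157304ba5962187304a659b2187304ba98376521047b983a652104b6a8379521047ba836952104ba59376821047b593a682104b6a9375821047ba936582104ba98726531047ba862953104b6a872953104ba59726831047ba962583104b6a972583104ba98371526047b983a152604ba59371826047b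a9351826047b593a182604a698b71532047b986a153204ba9876153204a659b71832047ba965183204b6a9751832047b596a183204ba5976183204b9846a157320a984b6157320ba9865147320a698b5147320b9586a147320a958b6147320a984b7153620b9847a153620a958b7143620ba9875143620b9587a143620b6a9374821507ba936482150ba98376421507b983a642150b6a8379421507ba8369421507ba962483150b6a972483150ba98726431507ba862943150b6a872943150a984b2657310ba8462957310a684b2957310ba5962487310a659b2487310a958b2647310ba9862547310a698b2547310ba84379526107b843a952610ba59374826107ba9354826107b593a4826107ba835942610ba98375426107b983a542610a984b7653210b9847a653210a684b79532107b846a953210ba8476953210a659b74832107ba965483210b6a9754832107b596a483210ba5976483210a958b7643210b9587a6432107ba865943210b6a875943210a698b75432107b986a543210ba9876543210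
  ents := 0xbb74781200fa90184b73265094fd66c210e504a329817b605240781080cba46983721500e828201140a45b906a8732102aaca003908278b659a134007eb38a0000d109452b873a6059066cc13096b72a93104850a32239e2506108934ba7256038b83200802419852ab67300a31509e0506109834ba72650d7cf9f40e0154980126ab730b6855ab3f03ab27538649010b6865ab3d03ab2753864190010bb9f2200154891602b73a0662c335180214985a2b6730016cb9f2220154891602a7b3066278f2220154891602ab73010b347400015498610273ba013bedeb0401549860127b3a0982052a2b00ba3728561094098222952b00ba3728560149098225093b00ab3728561049050205402b00ba37285614090b6853cb3d03ab27536849100bea66cd2600ba37562891040bf466cd2700ba37562810940682598e100214985ba26730016c99ee020154981620a7b3066258ee020154981620ab730b6850ca2d03ba27356849100a0351152b00ba3728650194050067243f00ab3725681094098052c02b00ba3728650149098055393b00ab37286510490380d9ef1a0145982160ab73084352aa2f00ba37265809140840512a2f00ba37265801940220642a2f00ba372658109407e052ca2b00ba37268501490980454a2b00ba3726851049028052ca2b00ba372685140905850ac0320b637ba82194050585204a3207637ba42190850d5ab9f40c0159480126b73a0a5b08201802194852ab67300d9cb9f40e0159480126a7b30d9ab9f40f0159480126ab370b0ad5ab3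c00a3b7528690410b09e5cb3e00a3b7528691040b69d5ab3c00a3b7528649010bb30b2b2e00b3a7528691400b6ad5cb3d00a3b7528640190b69e5ab3c00a3b75286419007c9c5152f00b3a72586091401c9d2c02e00b3a72586910405215c153e00a3b725861904098222153b00a3b72856014909a1444a3f00a3b725861049050204c03b00a3b7285614090bc9534d3e00a3b7526890140be8e6cb2e00b3a752689104050889c13e00a3b7526819040bc9674d3e00a3b7526891400c08934d3c00a3b7526849100c08a74d3d00a3b7526841090b0ad14a2e00b3a7256890140a0350953b00a3b7286501940520a7242f00b3a725681094098052403b00a3b72865014909a095392b00b3a7286510490b69e44a2d00b3a7256841090bc289c13600a3b762589014084050aa3f00a3b726580194022063aa3f00a3b72658109407e0524a3b00a3b726850149098044ca3b00a3b7268510490280524a3b00a3b726851409020d97c202057a56b43298010d5b3a740c01954801267b3a059af8f4080195481026b73a0d9c7a740e01954801267ab30d9b35f40f0195480126a3b705daf8f40b0195481026ab370b09152a2c003ba75286904104e865162e003ba75286910401c84ac52a003ba78256190407684ac52f003ba75286014904e84aab3e003ab75286194001684ac52f003ba75286140900c15faa2e003ba72586901401c0caca2a003ba7285691040040e52a2f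003ba7258610940760d5402b003ba7285601490040d52a2e003ba7258619400160d5402b003ba7285614090b09134a2e003ba7526890140b08e64a26003ba756289104026453cd26003ba756281904076909c52b003ba782650149026467cd27003ba7562810490b68674a2d003ba75268410905c3dfca26003ba7652890140d015fca22003ba768259104026050cd2e003ba72568190409a092c02b003ba728650149026063cd2f003ba725681049016249ca29003ba7286541090b0249c02e003ba726589014084053ab37003ab762580194022067ab37003ab76258109407e055cb33003ab762850149026067cd27003ba762581049028055cb33003ab7628514090c09d4d03d0467b85a2349100a4baea01802198452ab67030599f9f4080159841026b73a0761aea01a02198452ab6370047312ba3f00a37b5826104905d9f9f40b0159841026ab3704e866ab2e00b37a528690140be866cf2e00b37a5286910408c505253b00a37b8256109404f1e6ab2d00b37a52860419092505453f00a37b5286104908c51d253b00a37b82561409070b346e00015984610273ba09e84b092f00b37a2586019404e0e0892e00b37a258619040981e2953b00a37b285601490960cb442f00b37a258610490560cb392b00b37a285614090be914cb2e00b37a526890140bc8a5513e00a37b526891040064a5a72f00b37a52681094072495cf2f00b37a52680149006495a72e00b37a52681940012495cf2f00b37a526814090bc296c03e00a37b256890140a0311153b00a37b2865019404e025a12f0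0b37a25681094098012c03b00a37b2865014904e015a12e00b37a25681940056015c72f00b37a256814090860d4ab2700b37a625809140840112a3f00a37b265801940220242a3f00a37b2658109407e012ca3b00a37b268501490980054a3b00a37b26851049028012ca3b00a37b26851409021b964200057a65b4329810059a3a740801958410267b3a059a35f4090195841026b37a05db7a740a01958410267ab30473523a2f003b7a58261049048ac1c82b003b7a852614090064dfab2e003b7a528690140d24dfcf26003b7a568291040064e62b2f003b7a528610940064ca2b2e003b7a528691400724ca4b2f003b7a528610490124ca4b2d003b7a5286410901e2202a3e003a7b2586901409e843952f003b7a2586019404e0db952e003b7a2586190409a1e2152b003b7a285601490960c3ca2f003b7a258610490560c3c02b003b7a2856140904c8e6272e003b7a526890140064c9cb3e003a7b526891040064544b2e003b7a52681904080455d127003b7a562801490064684b2f003b7a5268104902a455d127003b7a562814090ce209c036003a7b6528901409e012132f003b7a2568019404c014442e003b7a2568190409a012402b003b7a2865014904c028442f003b7a2568104902a052512f003b7a2568140900a0602a3a003a7b268590140840132b37003a7b625801940220272b37003a7b6258109407e0154b33003a7b628501490260284b27003b7a625810490280154b33003a7b628514090c8854503d047b685a2349100de4e04a2e0037ba5826910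405f9f9f4380189451026b73a067015402f0037ba58260149088249c82b0037ba8526104906654ac02f0037ba582614090064e0ab0e0073ba528690140d24e0cf060073ba5682910408c1caa52b0037ba825610940064cb2b0e0073ba528691400921cac52f0037ba5286104908c1e0252b0037ba825614090060dfaa2e0037ba258690140d20dfce260037ba658291040060e62a2f0037ba258610940060ca2a2e0037ba258691400720ca4a2f0037ba258610490120ca4a2d0037ba258641090264e0a9360037ab562890140264c94d360037ab5628910408e1c9a22f0037ba52681094072455512f0037ba5268014908800ac82f0037ba5268104908c26022230037ba862514090080e0a83e0037ab2568901409e012930f0073ba25680194006025262f0037ba256810940720154e2f0037ba25680149006015262e0037ba256819400120154e2f0037ba2568140900c0602a2a0037ba268590140780132a2f0037ba265801940000272a2f0037ba2658109406e0154a2b0037ba268501490060284a2f0037ba2658104900e0154a2b0037ba26851409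
  extras := [(178, 216), (214, 217), (179, 218), (215, 219), (215, 220)]
  wperm := 0xba9876543210ba9876543210ba9876543210ba9876543210ba9876543210ba9876543210ba9876543210ba9876543210ba9876543210ba9876543210ba9876543210ba9876543210ba9876543210ba9876543210ba9876543210ba9876543210ba9876543210ba9876543210ba9876543210ba9876543210ba9876543210ba9876543210ba9876543210ba9876543210ba9876543210ba9876543210ba9876543210ba9876543210ba9876543210ba9876543210ba9876543210ba9876543210ba9876543210ba9876543210ba9876543210ba98765432106895723401ba6895723410baba98765432106895732410baba9876543210ba9876543210ba9876543210ba9876543210ba98765432107895623410ba7895632401ba7895632410ba6984723501ba6984723510baba98765432106984732510baba9876543210ba9876543210ba98765432106985732410baba98765432107984623510ba7984632501ba7984632510ba7985623401ba7985623410baba98765432107985632410baba98765432102a67138b4509ba98765432103a67128b4509ba9876543210ba98765432103a67028b54193a67128b5409ba9876543210ba9876543210ba98765432103a76128b4509ba98765432102a76138b5409ba9876543210ba9876543210ba9876543210ba98765432103a67029b45183a67129b4508ba98765432102a67139b54083a67029b54183a67129b54082a76039b4518ba98765432103a76029b4518ba9876543210ba98765432102a76139b5408ba98765432103a76129b5408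2b67038a45192b67138a4509ba98765432103b67128a4509ba98765432102b67138a5409ba98765432103b67128a5409ba98765432102b76138a45093b76028a45193b76128a45092b76038a54192b76138a54093b76028a54193b76128a54092b67039a45182b67139a45083b67029a45183b67129a45082b67039a54182b67139a5408ba98765432103b67129a54082b76039a45182b76139a45083b76029a45183b76129a4508ba98765432102b76139a54083b76029a54183b76129a540862a7034b158962a7134b0589ba987654321063a7124b058962a7035b1489ba987654321063a7025b148963a7125b0489ba987654321072a6134b058973a6024b158973a6124b058972a6035b148972a6135b0489ba9876543210ba9876543210ba987654321062a7134b0598ba9876543210ba987654321062a7035b149862a7135b0498ba987654321063a7125b0498ba9876543210ba9876543210ba987654321073a6124b0598ba987654321072a6135b049873a6025b149873a6125b0498ba987654321062b7134a058963b7024a158963b7124a058962b7035a148962b7135a048963b7025a148963b7125a048972b6034a158972b6134a058973b6024a158973b6124a058972b6035a148972b6135a048973b6025a148973b6125a048962b7034a159862b7134a0598ba987654321063b7124a059862b7035a149862b7135a0498ba987654321063b7125a049872b6034a159872b6134a059873b6024a159873b6124a059872b6035a149872b6135a049873b6025a149873b6125a0498ba98765432108a456b297103ba98765432108a456b397102b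a9876543210ba9876543210ba98765432108a546b397102ba9876543210ba9876543210ba98765432108a457b396102ba9876543210ba9876543210ba9876543210ba98765432109a456b287013ba9876543210ba98765432109a456b3871029a546b287013ba9876543210ba98765432109a546b387102ba9876543210ba9876543210ba98765432109a457b3861029a547b286013ba98765432109a547b3860129a547b386102ba9876543210ba9876543210ba98765432108b456a397102ba9876543210ba9876543210ba9876543210ba9876543210ba9876543210ba9876543210ba9876543210ba9876543210ba9876543210ba9876543210ba9876543210ba9876543210ba9876543210ba9876543210ba98765432109b456a3871029b546a287013ba9876543210ba98765432109b546a3871029b457a286013ba9876543210ba98765432109b457a3861029b547a286013ba9876543210ba98765432109b547a386102a4058921b673a4158920b673a4058931b672a4158930b672a5048921b673a5148920b673ba9876543210a5148930b672a4058921b763a4158920b763a4058931b762a4158930b762a5048921b763ba9876543210a5048931b762a5148930b762a4059821b673a4159820b673a4059831b672a4159830b672a5049821b673a5149820b673a5049831b672a5149830b672a4059821b763a4159820b763a4059831b762a4159830b762a5049821b763a5149820b763a5049831b762a5149830b762b4058921a673b4158920a673b4058931a672b4158930a672b5048921a673ba9876543210b5048931a672b5148930a672b4058921a763b4158920a763b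4058931a762b4158930a762b5048921a763b5148920a763b5048931a762b5148930a762b4059821a673b4159820a673b4059831a672b4159830a672b5049821a673b5149820a673b5049831a672b5149830a672b4059821a763b4159820a763b4059831a762b4159830a762b5049821a763ba9876543210b5049831a762b5149830a762ba9876543210ba9876543210ba9876543210ba9876543210ba9876543210ba9876543210ba9876543210ba9876543210ba9876543210ba9876543210a7b604893125ba9876543210ba9876543210ba9876543210ba9876543210ba9876543210ba9876543210ba9876543210ba9876543210ba9876543210ba9876543210ba9876543210ba9876543210ba9876543210ba9876543210ba9876543210ba9876543210a7b614983025ba9876543210ba9876543210a7b605983124a7b615983024ba9876543210ba9876543210ba9876543210b6a714893025ba9876543210b6a715892034ba9876543210ba9876543210b7a604892135ba9876543210b7a604893125b7a614893025ba9876543210ba9876543210b7a605893124b7a615893024b6a704982135ba9876543210ba9876543210b6a714983025ba9876543210ba9876543210ba9876543210ba9876543210ba9876543210ba9876543210b7a604983125b7a614983025b7a605982134ba9876543210ba9876543210b7a6159830248450a9236b718451a9236b708450a9326b718451a9326b708540a9236b718541a9236b708540a9326b718541a9326b708450a9237b618451a9237b608450a9327b618451a9327b608540a9237b618541a9237b6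08540a9327b618541a9327b609450a8236b719451a8236b709450a8326b719451a8326b709540a8236b719541a8236b709540a8326b719541a8326b70ba98765432109451a8237b609450a8327b619451a8327b609540a8237b619541a8237b609540a8327b619541a8327b608450b9236a718451b9236a708450b9326a718451b9326a708540b9236a718541b9236a708540b9326a718541b9326a708450b9237a61ba98765432108450b9327a618451b9327a60ba98765432108541b9237a608540b9327a61ba98765432109450b8236a719451b8236a709450b8326a719451b8326a709540b8236a719541b8236a709540b8326a719541b8326a709450b8237a619451b8237a609450b8327a619451b8327a609540b8237a619541b8237a609540b8327a619541b8327a60ba9876543210ba9876543210a678b4503912a678b4513902a678b5402913ba9876543210a678b5403912a678b5413902ba9876543210ba9876543210a768b4503912ba9876543210ba9876543210ba9876543210a768b5403912ba9876543210ba9876543210ba9876543210ba9876543210a679b4513802ba9876543210ba9876543210a679b5403812ba9876543210ba9876543210ba9876543210ba9876543210a769b4513802ba9876543210ba9876543210ba9876543210a769b5413802ba9876543210ba9876543210b678a4503912ba9876543210ba9876543210ba9876543210b678a5403912ba9876543210ba9876543210ba9876543210ba9876543210ba9876543210ba9876543210ba9876543210ba9876543210ba9876543210ba9876543210ba9876543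210ba9876543210b679a4513802ba9876543210ba9876543210ba9876543210b679a5413802ba9876543210ba9876543210ba9876543210ba9876543210ba9876543210ba9876543210b769a5403812ba9876543210a4018925b673a4108925b673a4018935b672a4108935b672a5018924b673a5108924b673a5018934b672a5108934b672a4018925b763a4108925b763a4018935b762a4108935b762a5018924b763a5108924b763a5018934b762a5108934b762a4019825b673a4109825b673a4019835b672a4109835b672a5019824b673a5109824b673a5019834b672a5109834b672a4019825b763a4109825b763a4019835b762a4109835b762a5019824b763a5109824b763a5019834b762a5109834b762b4018925a673b4108925a673b4018935a672b4108935a672b5018924a673b5108924a673b5018934a672b5108934a672b4018925a763b4108925a763b4018935a762b4108935a762b5018924a763b5108924a763b5018934a762b5108934a762b4019825a673b4109825a673b4019835a672b4109835a672b5019824a673b5109824a673b5019834a672b5109834a672b4019825a763b4109825a763b4019835a762b4109835a762ba9876543210b5109824a763b5019834a762b5109834a76267ab2304518967ab2314508967ab3204518967ab3214508967ab2305418967ab2315408967ab3205418967ab3215408976ab2304518976ab2314508976ab3204518976ab3214508976ab2305418976ab2315408976ab3205418976ab3215408967ab2304519867ab2314509867ab3204519867ab3214509867ab2305419867ab2315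409867ab3205419867ab3215409876ab2304519876ab2314509876ab3204519876ab3214509876ab2305419876ab2315409876ab3205419876ab3215409867ba2304518967ba2314508967ba3204518967ba3214508967ba2305418967ba2315408967ba3205418967ba3215408976ba2304518976ba2314508976ba3204518976ba3214508976ba2305418976ba2315408976ba3205418976ba3215408967ba2304519867ba2314509867ba3204519867ba3214509867ba2305419867ba2315409867ba3205419867ba3215409876ba2304519876ba2314509876ba3204519876ba3214509876ba2305419876ba2315409876ba3205419876ba321540984801ab9567234810ab9567234801ab9567324810ab9567325801ab9467235810ab9467235801ab9467325810ab9467324801ab9576234810ab9576234801ab9576324810ab9576325801ab9476235810ab9476235801ab9476325810ab9476324901ab8567234910ab8567234901ab8567324910ab8567325901ab8467235910ab8467235901ab8467325910ab8467324901ab8576234910ab8576234901ab8576324910ab8576325901ab8476235910ab8476235901ab8476325910ab8476324801ba9567234810ba9567234801ba9567324810ba9567325801ba9467235810ba9467235801ba9467325810ba9467324801ba9576234810ba9576234801ba9576324810ba9576325801ba9476235810ba9476235801ba9476325810ba9476324901ba8567234910ba8567234901ba8567324910ba8567325901ba8467235910ba8467235901ba8467325910ba8467324901ba8576234910ba8576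234901ba8576324910ba8576325901ba8476235910ba8476235901ba8476325910ba847632a408b9516723a418b9506723a408b9516732a418b9506732a508b9416723a518b9406723a508b9416732a518b9406732a408b9517623a418b9507623a408b9517632a418b9507632a508b9417623a518b9407623a508b9417632a518b9407632a409b8516723a419b8506723a409b8516732a419b8506732a509b8416723a519b8406723a509b8416732a519b8406732a409b8517623a419b8507623a409b8517632a419b8507632a509b8417623a519b8407623a509b8417632a519b8407632b408a9516723b418a9506723b408a9516732b418a9506732b508a9416723b518a9406723b508a9416732b518a9406732b408a9517623b418a9507623b408a9517632b418a9507632b508a9417623b518a9407623b508a9417632b518a9407632b409a8516723b419a8506723b409a8516732b419a8506732b509a8416723b519a8406723b509a8416732b519a8406732b409a8517623b419a8507623b409a8517632b419a8507632b509a8417623b519a8407623b509a8417632b519a84076328904a6517b238914a6507b238904a6517b328914a6507b328905a6417b238915a6407b238905a6417b328915a6407b328904a7516b238914a7506b238904a7516b328914a7506b328905a7416b238915a7406b238905a7416b328915a7406b329804a6517b239814a6507b239804a6517b329814a6507b329805a6417b239815a6407b239805a6417b329815a6407b329804a7516b239814a7506b239804a7516b329814a7506b329805a7416b239815a7406b2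39805a7416b329815a7406b328904b6517a238914b6507a238904b6517a328914b6507a328905b6417a238915b6407a238905b6417a328915b6407a328904b7516a238914b7506a238904b7516a328914b7506a328905b7416a238915b7406a238905b7416a328915b7406a329804b6517a239814b6507a239804b6517a329814b6507a329805b6417a239815b6407a239805b6417a329815b6407a329804b7516a239814b7506a239804b7516a329814b7506a329805b7416a239815b7406a239805b7416a329815b7406a3267ab2048359167ab2148359067ab3048259167ab3148259067ab2058349167ab2158349067ab3058249167ab3158249076ab2048359176ab2148359076ab3048259176ab3148259076ab2058349176ab2158349076ab3058249176ab3158249067ab2049358167ab2149358067ab3049258167ab3149258067ab2059348167ab2159348067ab3059248167ab3159248076ab2049358176ab2149358076ab3049258176ab3149258076ab2059348176ab2159348076ab3059248176ab3159248067ba2048359167ba2148359067ba3048259167ba3148259067ba2058349167ba2158349067ba3058249167ba3158249076ba2048359176ba2148359076ba3048259176ba3148259076ba2058349176ba2158349076ba3058249176ba3158249067ba2049358167ba2149358067ba3049258167ba3149258067ba2059348167ba2159348067ba3059248167ba3159248076ba2049358176ba2149358076ba3049258176ba3149258076ba2059348176ba2159348076ba3059248176ba3159248023ab0689174523ab1689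074532ab0689174532ab1689074523ab0689175423ab1689075432ab0689175432ab1689075423ab0789164523ab1789064532ab0789164532ab1789064523ab0789165423ab1789065432ab0789165432ab1789065423ab0698174523ab1698074532ab0698174532ab1698074523ab0698175423ab1698075432ab0698175432ab1698075423ab0798164523ab1798064532ab0798164532ab1798064523ab0798165423ab1798065432ab0798165432ab1798065423ba0689174523ba1689074532ba0689174532ba1689074523ba0689175423ba1689075432ba0689175432ba1689075423ba0789164523ba1789064532ba0789164532ba1789064523ba0789165423ba1789065432ba0789165432ba1789065423ba0698174523ba1698074532ba0698174532ba1698074523ba0698175423ba1698075432ba0698175432ba1698075423ba0798164523ba1798064532ba0798164532ba1798064523ba0798165423ba1798065432ba0798165432ba179806548904a652b7318914a652b7308904a653b7218914a653b7208905a642b7318915a642b7308905a643b7218915a643b7208904a752b6318914a752b6308904a753b6218914a753b6208905a742b6318915a742b6308905a743b6218915a743b6209804a652b7319814a652b7309804a653b7219814a653b7209805a642b7319815a642b7309805a643b7219815a643b7209804a752b6319814a752b6309804a753b6219814a753b6209805a742b6319815a742b6309805a743b6219815a743b6208904b652a7318914b652a7308904b653a7218914b653a7208905b642a7318915b642a7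308905b643a7218915b643a7208904b752a6318914b752a6308904b753a6218914b753a6208905b742a6318915b742a6308905b743a6218915b743a6209804b652a7319814b652a7309804b653a7219814b653a7209805b642a7319815b642a7309805b643a7219815b643a7209804b752a6319814b752a6309804b753a6219814b753a6209805b742a6319815b742a6309805b743a6219815b743a620
  wword := 0x9d1efdd9d3eb5d00000009d3ec5c00000000000000000000000000000000000913ac5c911ef5d913ab5d9486fdd949eb5d0000000949ec5c000000000000000000000a132edd00000008a9ac5c8a86f5d8a9ab5d7aa14dd03414dd0000000900d35800000004a10acb0000000108954a00000000000000b494ac5453a024000000000000000000000540cacb00000004d3e0240000000000000000000000000000712152aa10222b00000008a1202b7538aab50a9c967d3e6ce0000000a11262b00000000000000512dfa400000005129bab9f266aa56ae394000000014a154b000000056ae70700000005626716000000056ae2119d2662b48ae49496926a656ae50072a9fa748aa603831d5aa56a6315753132b56e4996968e6aa572c194000000054a25879f126a656a6214732d41656e4a92000000056a650773288ab4329fa1949a2b88a9a5b700000002f3a5aa809a54c00000007eaa5aa232a5ca0000000a12e0c4a1120cb949e5b7a49e64f992e6890000000000000000000004d3a2bf000000000000009d3a2b8913a5b7000000029295a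a0000000000000000000004d3e2410000000992cb249910b2b992c3ab0000000552a41495149c18aa25b9952a4088b2a78780a25ca54ea7168e9302b9729d119716012552e396972a281892a5808904245892a68394aa4388aaa7b70000000942a74180aa74c832caa5000000027327aa8f2604b4f3a2c28f0dd4556e95298910a2789283a79714aa98928b210000000439b55800000003e3cf4d00000000000000000000042817bb000000000000000000000457b6660000000000000000000000000000e5cedaa0000000000000065903a9e5c6cab00000000000000e4c5e4b000000000000000000000d4ca44ce3b30a40000000d5c92a8e2ba1c40000000000000000000003e8084b0000000000000000000000000000000000000000000000000000000000000000000000000000000000000000000000000000000006368ea8e5c70a400000000000000e4c61c4e3aedab00000000000000e2b5f4be3b2cab00000000000000e2b9e4b3f9f9b16cc77861fb79ae6b5d9b2dcc7986e1bf98800000006dc5982dabf39a6b9f39d1fb72065fb4c86dbab39d0000000cfc4c86cfb4e06419fa2c3ecf7056589a8f6c67685c6cf905ddbf987e1cd8816589885dabf7006ab380559bd00f6b9d900e2bf681639f688dba9900639d881dcdb39a6dbb39d6bb0f306db961addcb39d0000000ddc961adba0e2e41a32066abb7861fc35b26a1b106dabb9866bb378bda1b2066bb1982dcdb7006ccb8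051fbba2c6db9900e4db68165bb688ddc990065b9881ced99566ccb1ac1fbb2855fb8d05dccb2ac0000000cfc8d05cfb8e850000000000000000000000000000000000000000000000000000000000000000000000a14d68a0000000000000000000000000000000000000000000000000000000000000000000000000000000000000000000000000000000000000000a14dd6b000000000000008d43184921528400000000000000000000060e528900000004e1a325000000000000009f3e3650000000933521a3d3528a0000000000000076d098a333510a9f364e3000000000000009f1aae90000000000000000000000000000000000000000008f4509d4135284969e365000000000000009e84ead3e6eeaf6ad988ce0c482c6ad9a80dac988c62d990edac9a8062d9b026b9eeeb6ac1898d0c8f0560d8c8fdab9898dbaaeebd0c8c8f60d8f053482eaf3cb1b355d7f405604980fab9aeaf688032fd04970f5c6170f00000006ac160cd0d10056ac1780dab960c62c170ddab978062c18016dbaeeb3ec980fdcc872c6ad5812c6c970fddcaeebdac58126cd872c4198318000000041988121ac5aaf0000000dbc6ee1aec58af0000000dd52e2f6cd560cdcc462c6cd5780dcc560c64d570ddcc578064d580141994af6bb61afdac4c2c6ad492f3798317ddb2e5937988116ad4c2c00000000000000d761221b7c6e14046d66000000000c15659b0ccad900000000000000b7bf0240000000000000000000001c256d9000000000000000000000000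000017ceca60000000000000077cc9eb000000000000000000000000000017cf02100000000000000000000013aada100000000000000b7bf0a5000000000000000000000041996000000000000000000000000000000000000000000000000000000000000000000000000000000000000017cf0a200000000000000000000015aad2200000000000000000000000000000000000000000099c9a600000000dcc7790c79f9b1db5d9b6b9b79ae6dc798b6cd77901fb77b06a377b66b9f51dcda75b2cfb4c905fc4f0641a74b6dbab51d5fc4e066a334b6c7cf705cd9fa2cdc6768f6589a85419f82fe1cf888e58988f6a3f82f6b9f907cd9f285db9db0059bd005639f888dbab907e39da816a3f18f6dbb51dcda39aeddb979a6bb0f2e41a37b0ddcb51d6bb0e2e6a437b0dabb790cda3206da1b110b9c35b26bb398b6ac37901fc34b66a431106dbb907cb9f932ddb9b00b9bba2c65bb888ddcb907e5b9a81aabdb6edccb1afb9d17eecfb8d0f5fc8f8500000006cdb1af5fc8e85cfcb937c65e5ab1520ec9e05e5a4b491cc210e60128316414108e23f7112211bc3222bc091cc3c65e22ae851cc098e62127f122128cea396a72a394af3a8b7bd3e1c5ad22737af1de4ad4aa7aa10e4aa971112280e963ccad3a7b7bd1de4bc73a737af1e1c47f1122910e4b27e4aa3aa3aaa3cc4b1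61024b168024b121004b128009aea29183162918ae63176f1621155121805512880551210255128023b020126f2a2128cea212a72a2114c9672c0896aa3af1e7374491e2883152a83b00b276f1522810923ccbd1e7b74c91e294c9272e2696a236f292290ee4a27a7292283ae4a263baf78ec7a7886e1b428eadc3886e8cab8fa6d4c6de9bc30c69c8685c59f382cda7506db9c782afbf88639ab48ea4bc668e39c80063a8606c7a7682cbc47d8adc3682e9c478ee8cee8ca6d4856e1b418ee9cc80ccda7382c59f506afbf682adb7506e2b2c0c6ed5856e39c700e3a8587c79f702b3c9b5dddb8782cba9b5d3bab80ea6bc66de5b880065c8606afb5958b5c5b5dafb7702b9c3506e6caf0fa6bc76711c780e67c8b85cab370ec79f906ddc028eadbb906e4cac0c6ed9ad6e5b8700e5c8587b9c1658b5c5b58b9c3382afb7906e2cac1870d5ad611b768cd59578ee8c6c85c7a7887e9c428069cc183cab788534c42d9e3698806207880e2bad05cda7507e3b0085e3a0405e2b6c8562b2c80e3ac28063a8000e0d6e006831adc69bc78f68539b3e0319d6706766be033780681f883c4bf380c59f507de3f38006db405e0396d6a5ab580e03b4806fc7580e4c6d05c7a751de5c4085e5b4405e4d2c8564cac80e5d0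28065c80001fc17d65e7d7d611b7905b9c3507ce756595869659d595600586b500c6bf700c79f907e03f700adbb9073f9c66ea7aba0019b866e6fcba00aed595608817f2aed7700afb790790d73f271c5a59199cfe771c7a00c5b36963cbb892d1959021ccb880b0c9ad6c5b36987cdb70b7dbb902c8bf7196acb20009bb6066bc8c80dadb100a99f9196bc8e07afcb698cdb340840bb601db6d6006a0b500cda358ccdb340dda434807dbb880e6d6e9a6abb002dbd0d806bb0882dac2f02c5ab71e6bb0a0b7bbb892cabf3826cb2d80ddac2826da8100dcbec00ab9f5026da858779bb502c5b369d3cbb89ab4d73821ac7600aec5856c5b369f7ad738b7bb7502cabf4006cbac80ddac3006db0000dcc2b00ab9f600dc3348279bb600c8c369a32c389ab4d740002d7600a8c369da9a389a7ad74077bb7600ae905004488380c64558902991877a3222590f2437aa5e5a49d56737c6a82074205087bc904804c84380aa5e2258ef63b784322249cf23b77086ca58b65107dc995899595307711e28010843a2753a30010985a2dc9920a89690877e86ca49565087a73a40764a92257f1e20028843a1ac94500449400009805844c69500d685284082d122096c51308551a3c6a85004205200aca84804c90000aa325258ce9259d685503262d121b80d28a4a1d10074f200054753006f222804a9508575424871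4a91806e86d2448210807309c80541d080a73a2800e8442181262005491085a300188a3289879121fe031315ab82893948a984118a88a119aa13a4a0e4a818510a8192e8988a2a25899a990889498a00989d2818c893089f0818891384119120a119012611749a6604f090948b20a6031313cb9cf09889d38a00a09e281928a708a084aa82f12511989e2da4d0d114a300481a328a80a30420a932c88982895918aa80918a9489188acb89a0e49887928a8192e8a81a12c2149a9920194a8880989d1088c895019efc18191280919114891933ca0396fc1da9e510918b1701190294119cdc9819d288809d04201928a5019513011952b0009288aa89c59111c83db02a83f70ee27c28e6bc9d8cdad87006231b0ec4b1a8c627c78ed87d60eadb326ae88029eaa82e1ec6c500c5c7d78ee06d00c688079ec83da8066c8705e27828c6bc5b8cdad46006ac4783da6478c627878ce8d500068c461be880d8c6dc698cdcd4f805c7978cddb6a8c688100ce43588eadab2f1dfa97556ba9d9fdc05a8e5ec9a83c4b181fcdaac70ca3db19aa3f71ee47c29e6dca90cdcd8f006431b1eddbaa0c647c79e598f9853619b0537b1b0f6bb298cdac0f80587da8cdba2a8c6dc19c7e4c089064b8b86e47cd8c6db1f8edcc0b826ab9b21dc6900c647d00c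
  splits := 0xde13a0ad703351214471320cb00a4a0d3833a29a035f9a8900a0428814281808025a73d60b7eb08555805d7430b48037eb0901580de4dd250200704142808080d0574e609add1690a80cc1a8c60e01c8a15cc5805f9a88e080058a1424100e1d3a1380089cb2cbae80364084d1602009e8cc10026e79ad04006031410080cd2684e7209b3d91001806d5c52a0601d0a15bc100722b58304001bab20c1006ba2da45401ad714948805f704250201140b6b4100d20dd2202006041208000984289086cf98ad655586d6e474920082d192cb8010aa479f58044062040100cc1a4cd560365b56acb00ded274b16019f0272c580149d02f04002881420000a1461acde037ad9110a00e36d5a40e012223ed8100b86e6a4000079b2c24000e1d32a198033059138b00740d85c0402596d8b810026e79ae0000239b6180006cf644c4601b57149098074117dc0401346cac8100d20e9a8000348488180006bc0a042801b3d90fc0005f98b240001957905000045039860000684100400067aca892c1585d3890a84d6e10511e00b40ded9b006628a8b0a00690203c080cc1a4cc56038db48a8b005d6c4a50e015a13ed8000560cfaf000028b1220000b9c79952a02350bba8380d96d2250e012131cbc000b86e624000028b141c00074d057236010d36994280e0b67cd00013c6cac80007427606000040a1014000a081ae9260239f6d98080dcce3cc00010c6b46c00088538850000603120c00078d34931601b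6f2aac0005f6052400016628e5000042ff985000060416000005dcfa65420cab4dfb1482b79a648900149e75d02008c42e8b06003852018100d5cf5e14e02073e9c9100d8b1ec8000141f75d0080d815ea2000260fda2c0006bbca8a2a01654930c180d4ce1c700010054a54000401958900007101c0c000dfac51324019f02a9c1005d704220001ff408d00800d9dc22000028d140400067c0a8422018ef2c9c180db6d5a1000100f445400081c160200001840608000352545c160196f2c9c0005988b2100019578a44000595e281000008f1600000366e4d07a0f52ea91c981d6b9f4708028a3e5cc2004747308060060f201408080d37ea24039aca11c900d8b5ec700015a33ec800021b1ca50000188366000037254dd1002328bba8000c8168470000dc9bc24000474330700006101a0c00072d34910c019e92a9c00072d2f0600019e9809c0005bc200200002860a040006ecf5930601cadae6c00074cef850001046c00c0004303780000018820000006ed359304018e9289c00072cef050000dc6bc0c0004251a8000000900e000005b0e8d14602329bba8200c93084902017735b382003932e8f02003861e0400080d39ea24016c3a30c0005b5683e00016e19a60000470f78800005861a04000372545d10016d4930800048a103c0000dc9be24000546d80100003861a0000072d35910c019e928a400072d300600016df9a48000470778100001091a00000331945d0201cadb46c00074cf0850001046c20c000383d400000010a18000006ecf4910002933bc440006ecef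000000cc6bc00000321530000000000000000

/-! ### Verification of the four certificates by computation -/

theorem cert23_base : cert23.baseOK = true := by decide +kernel
theorem cert33_base : cert33.baseOK = true := by decide +kernel
theorem cert24_base : cert24.baseOK = true := by decide +kernel
theorem cert34_base : cert34.baseOK = true := by decide +kernel
theorem cert23_split : cert23.splitOK = true := by decide +kernel
theorem cert33_split : cert33.splitOK = true := by decide +kernel
theorem cert24_split : cert24.splitOK = true := by decide +kernel
theorem cert34_split : cert34.splitOK = true := by decide +kernel
theorem cert23_full : cert23.fullOK = true := by decide +kernel
theorem cert33_full : cert33.fullOK = true := by decide +kernel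
theorem cert24_full : cert24.fullOK = true := by decide +kernel
-- The largest check: all `24 ^ 3` triples of row permutations of a `3 × 4` block.
theorem cert34_full : cert34.fullOK = true := by decide +kernel

/-! ### Motion plans read off from the certificates -/

namespace Cert

variable {c : Cert}

theorem walk_of_wordOK {word perm q : ℕ} (h : c.wordOK word perm = true) (hq : q < c.h * c.w) :
    walk c.moves (c.h * c.w) (letter word) 4 q = dig perm q := by
  simp only [wordOK, Bool.and_eq_true, allBelow_iff, Nat.beq_eq] at h
  exact h.2 q hq

theorem letter_of_wordOK {word perm s : ℕ} (h : c.wordOK word perm = true) (hs : s < 4) :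
    letter word s < c.nm := by
  simp only [wordOK, Bool.and_eq_true, allBelow_iff, Nat.blt_eq] at h
  exact h.1 s hs

/-- Eight moves are composed of two words of four. The entry `e` supplies the first word; the second
comes from a group of permutations attached to the entry, where the variants of the rows, altered by
the mask of the entry, select the member. The check `entOK` compares the composition of both effects
with the target. -/
theorem exists_plan_of_entOK (hb : c.baseOK = true) {K e : ℕ} (he : c.entOK K e = true) :
    ∃ F, IsPlan c.h c.w 8 F ∧ ∀ q < c.h * c.w, F 8 q = c.target K q := by
  simp only [baseOK, Bool.and_eq_true, allBelow_iff] at hb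
  simp only [entOK, Bool.and_eq_true, allBelow_iff, Nat.blt_eq, Nat.beq_eq] at he
  obtain ⟨⟨h1, h2⟩, h3⟩ := he
  obtain ⟨⟨b1, b2⟩, b3⟩ := hb
  set i := c.second e (c.varIdx K) with hi
  set mv : ℕ → ℕ := fun s => if s < 4 then letter (c.entWord e) s else letter (c.wWord i) (s - 4)
    with hmv
  have hlt : ∀ s < 8, mv s < c.nm := by
    intro s hs
    by_cases h4 : s < 4
    · simpa [hmv, h4] using letter_of_wordOK (b2 e h1) h4
    · simpa [hmv, h4] using letter_of_wordOK (b3 i h2) (show s - 4 < 4 by omega)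
  have hp : IsPlan c.h c.w 8 (walk c.moves (c.h * c.w) mv) :=
    isPlan_walk fun s hs => b1 _ (hlt s hs)
  refine ⟨_, hp, fun q hq => ?_⟩
  have e4 : walk c.moves (c.h * c.w) mv 4 q = dig (c.entPerm e) q := by
    rw [← walk_of_wordOK (b2 e h1) hq]
    exact walk_congr (fun i hi => by simp [hmv, hi]) q
  rw [show (8 : ℕ) = 4 + 4 from rfl, walk_add, ← h3 q hq, e4,
    ← walk_of_wordOK (b3 i h2) (e4 ▸ hp.bound 4 (by norm_num) q hq)]
  exact walk_congr (fun i hi => by simp [hmv]) _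

theorem exists_plan_of_fullOK (hb : c.baseOK = true) (hf : c.fullOK = true) {K : ℕ}
    (hK : K < c.R ^ c.h) :
    ∃ F, IsPlan c.h c.w 8 F ∧ ∀ q < c.h * c.w, F 8 q = c.target K q := by
  have := allBelow_iff.1 (allBelow_iff.1 hf (K / 128)
    (Nat.lt_succ_of_le (Nat.div_le_div_right hK.le))) (K % 128) (Nat.mod_lt _ (by norm_num))
  rw [show Nat.add (Nat.mul 128 (K / 128)) (K % 128) = K from Nat.div_add_mod K 128] at this
  rw [Bool.or_eq_true, Bool.or_eq_true, List.any_eq_true, Nat.ble_eq] at this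
  rcases this with (h | h) | ⟨x, _, hx⟩
  · omega
  · exact exists_plan_of_entOK hb h
  · rw [Bool.and_eq_true] at hx
    exact exists_plan_of_entOK hb hx.2

theorem exists_plan_of_splitOK (hb : c.baseOK = true) (hs : c.splitOK = true) {i : ℕ}
    (hi : i < c.np ^ c.h) :
    ∃ F, IsPlan c.h c.w 6 F ∧ ∀ q < c.h * c.w, F 6 q / c.w = q / c.w ∧
      (F 6 q % c.w < 2 ↔ c.row (i / c.np ^ (q / c.w) % c.np * c.nv) (q % c.w) < 2) := by
  simp only [baseOK, Bool.and_eq_true, allBelow_iff] at hb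
  have := (allBelow_iff.1 hs) i hi
  simp only [Bool.and_eq_true, allBelow_iff, Nat.blt_eq, Nat.beq_eq, beq_iff_eq] at this
  refine ⟨_, isPlan_walk fun s h6 => hb.1.1 _ (this.1 s h6), fun q hq => ?_⟩
  refine ⟨(this.2 q hq).1, ?_⟩
  have h := (this.2 q hq).2
  rw [← Nat.blt_eq, ← Nat.blt_eq, h]

end Cert

/-- Codes the choices made for all rows as a single number, the form in which certificates are
indexed. -/
theorem exists_digits (R h : ℕ) (k : ℕ → ℕ) (hk : ∀ r < h, k r < R) :
    ∃ K < R ^ h, ∀ r < h, K / R ^ r % R = k r := by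
  induction h with
  | zero => exact ⟨0, by simp, by simp⟩
  | succ h ih =>
    obtain ⟨K, hK, hd⟩ := ih fun r hr => hk r (by omega)
    have hR : 0 < R := (Nat.zero_le _).trans_lt (hk h (by omega))
    refine ⟨K + R ^ h * k h, ?_, fun r hr => ?_⟩
    · calc K + R ^ h * k h < R ^ h * 1 + R ^ h * k h := by omega
        _ = R ^ h * (k h + 1) := by ring
        _ ≤ R ^ h * R := Nat.mul_le_mul_left _ (hk h (by omega))
        _ = R ^ (h + 1) := by ring
    · rcases Nat.lt_succ_iff_lt_or_eq.1 hr with hr' | rfl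
      · obtain ⟨d, rfl⟩ := Nat.exists_eq_add_of_lt hr'
        rw [← hd r hr', show R ^ (r + d + 1) * k (r + d + 1) = R ^ r * (R * (R ^ d * k (r + d + 1))) by ring,
          Nat.add_mul_div_left _ _ (pow_pos hR r), Nat.add_mul_mod_self_left]
      · rw [Nat.add_mul_div_left _ _ (pow_pos hR r), Nat.div_eq_of_lt hK, zero_add,
          Nat.mod_eq_of_lt (hk r (by omega))]

theorem exists_row_three : ∀ a b d : Fin 3, a ≠ b → a ≠ d → b ≠ d →
    ∃ k < 6, dig cert23.rows (3 * k) = a ∧ dig cert23.rows (3 * k + 1) = b ∧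
      dig cert23.rows (3 * k + 2) = d := by decide +kernel

theorem exists_row_four : ∀ a b d e : Fin 4, a ≠ b → a ≠ d → a ≠ e → b ≠ d → b ≠ e → d ≠ e →
    ∃ k < 24, dig cert24.rows (4 * k) = a ∧ dig cert24.rows (4 * k + 1) = b ∧
      dig cert24.rows (4 * k + 2) = d ∧ dig cert24.rows (4 * k + 3) = e := by decide +kernel

/-- For a split it only matters which cells of the row go to the first two columns; each such set is
represented by a permutation whose number is a multiple of `nv`, here `2`. -/
theorem exists_choice_three : ∀ k < 6, ∃ i < 3, ∀ j < 3,
    (dig cert23.rows (3 * k + j) < 2 ↔ dig cert23.rows (3 * (i * 2) + j) < 2) := by decide +kernel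

theorem exists_choice_four : ∀ k < 24, ∃ i < 6, ∀ j < 4,
    (dig cert24.rows (4 * k + j) < 2 ↔ dig cert24.rows (4 * (i * 4) + j) < 2) := by decide +kernel

/-- The certificate for given dimensions. -/
theorem exists_cert {h w : ℕ} (hh : h = 2 ∨ h = 3) (hw : w = 3 ∨ w = 4) :
    ∃ c : Cert, c.h = h ∧ c.w = w ∧ c.baseOK = true ∧ c.fullOK = true ∧ c.splitOK = true ∧
      (w = 3 ∧ c.np = 3 ∧ c.nv = 2 ∧ c.rows = cert23.rows ∨
        w = 4 ∧ c.np = 6 ∧ c.nv = 4 ∧ c.rows = cert24.rows) := by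
  rcases hh with rfl | rfl <;> rcases hw with rfl | rfl
  · exact ⟨cert23, rfl, rfl, cert23_base, cert23_full, cert23_split, .inl ⟨rfl, rfl, rfl, rfl⟩⟩
  · exact ⟨cert24, rfl, rfl, cert24_base, cert24_full, cert24_split, .inr ⟨rfl, rfl, rfl, rfl⟩⟩
  · exact ⟨cert33, rfl, rfl, cert33_base, cert33_full, cert33_split, .inl ⟨rfl, rfl, rfl, rfl⟩⟩
  · exact ⟨cert34, rfl, rfl, cert34_base, cert34_full, cert34_split, .inr ⟨rfl, rfl, rfl, rfl⟩⟩

theorem exists_row {c : Cert} {w : ℕ} (hcw : c.w = w)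
    (hc : w = 3 ∧ c.np = 3 ∧ c.nv = 2 ∧ c.rows = cert23.rows ∨
      w = 4 ∧ c.np = 6 ∧ c.nv = 4 ∧ c.rows = cert24.rows) (ρ : ℕ → ℕ) (hρ : ∀ j < w, ρ j < w)
    (inj : ∀ j < w, ∀ i < w, ρ j = ρ i → j = i) : ∃ k < c.R, ∀ j < w, c.row k j = ρ j := by
  subst hcw
  rcases hc with ⟨h, h1, h2, h3⟩ | ⟨h, h1, h2, h3⟩
  · rw [h] at hρ inj
    have ne : ∀ i j (hi : i < 3) (hj : j < 3), i ≠ j →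
        (⟨ρ i, hρ i hi⟩ : Fin 3) ≠ ⟨ρ j, hρ j hj⟩ := fun i j hi hj hij h => hij
          (inj i hi j hj (congrArg Fin.val h))
    obtain ⟨k, hk, e0, e1, e2⟩ := exists_row_three ⟨ρ 0, hρ 0 (by omega)⟩ ⟨ρ 1, hρ 1 (by omega)⟩
      ⟨ρ 2, hρ 2 (by omega)⟩ (ne 0 1 (by omega) (by omega) (by omega)) (ne 0 2 (by omega) (by omega) (by omega)) (ne 1 2 (by omega) (by omega) (by omega))
    refine ⟨k, by rw [Cert.R, h1, h2]; exact hk, fun j hj => ?_⟩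
    rw [h] at hj
    simp only [Cert.row, h, h3]
    interval_cases j
    exacts [e0, e1, e2]
  · rw [h] at hρ inj
    have ne : ∀ i j (hi : i < 4) (hj : j < 4), i ≠ j →
        (⟨ρ i, hρ i hi⟩ : Fin 4) ≠ ⟨ρ j, hρ j hj⟩ := fun i j hi hj hij h => hij
          (inj i hi j hj (congrArg Fin.val h))
    obtain ⟨k, hk, e0, e1, e2, e3⟩ := exists_row_four ⟨ρ 0, hρ 0 (by omega)⟩
      ⟨ρ 1, hρ 1 (by omega)⟩ ⟨ρ 2, hρ 2 (by omega)⟩ ⟨ρ 3, hρ 3 (by omega)⟩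
      (ne 0 1 (by omega) (by omega) (by omega)) (ne 0 2 (by omega) (by omega) (by omega)) (ne 0 3 (by omega) (by omega) (by omega))
      (ne 1 2 (by omega) (by omega) (by omega)) (ne 1 3 (by omega) (by omega) (by omega)) (ne 2 3 (by omega) (by omega) (by omega))
    refine ⟨k, by rw [Cert.R, h1, h2]; exact hk, fun j hj => ?_⟩
    rw [h] at hj
    simp only [Cert.row, h, h3]
    interval_cases j
    exacts [e0, e1, e2, e3]

theorem exists_choice {c : Cert} {w : ℕ} (hcw : c.w = w)
    (hc : w = 3 ∧ c.np = 3 ∧ c.nv = 2 ∧ c.rows = cert23.rows ∨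
      w = 4 ∧ c.np = 6 ∧ c.nv = 4 ∧ c.rows = cert24.rows) {k : ℕ} (hk : k < c.R) :
    ∃ i < c.np, ∀ j < w, (c.row k j < 2 ↔ c.row (i * c.nv) j < 2) := by
  subst hcw
  rcases hc with ⟨h, h1, h2, h3⟩ | ⟨h, h1, h2, h3⟩
  · rw [Cert.R, h1, h2] at hk
    simp only [Cert.row, h, h1, h2, h3]
    exact exists_choice_three k hk
  · rw [Cert.R, h1, h2] at hk
    simp only [Cert.row, h, h1, h2, h3]
    exact exists_choice_four k hk

/-- Any permutations of the rows of a block can be carried out in eight steps. -/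
theorem exists_full_plan {h w : ℕ} (hh : h = 2 ∨ h = 3) (hw : w = 3 ∨ w = 4) (ρ : ℕ → ℕ → ℕ)
    (hρ : ∀ r < h, ∀ j < w, ρ r j < w)
    (inj : ∀ r < h, ∀ j < w, ∀ i < w, ρ r j = ρ r i → j = i) :
    ∃ F, IsPlan h w 8 F ∧ ∀ q < h * w, F 8 q = w * (q / w) + ρ (q / w) (q % w) := by
  obtain ⟨c, rfl, rfl, hb, hf, -, hc⟩ := exists_cert hh hw
  have hw0 : 0 < c.w := by omega
  choose! k hkR hk using fun r (hr : r < c.h) => exists_row rfl hc (ρ r) (hρ r hr) (inj r hr)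
  obtain ⟨K, hK, hKd⟩ := exists_digits c.R c.h k hkR
  obtain ⟨F, hF, hF8⟩ := Cert.exists_plan_of_fullOK hb hf hK
  refine ⟨F, hF, fun q hq => ?_⟩
  have hr : q / c.w < c.h := Nat.div_lt_of_lt_mul (by rwa [mul_comm] at hq)
  rw [hF8 q hq, ← hk _ hr _ (Nat.mod_lt q hw0), ← hKd _ hr]
  rfl

/-- In six steps the agents of each row of a block can be sorted into the first two columns and
the others. -/
theorem exists_split_plan {h w : ℕ} (hh : h = 2 ∨ h = 3) (hw : w = 3 ∨ w = 4) (ρ : ℕ → ℕ → ℕ)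
    (hρ : ∀ r < h, ∀ j < w, ρ r j < w)
    (inj : ∀ r < h, ∀ j < w, ∀ i < w, ρ r j = ρ r i → j = i) :
    ∃ F, IsPlan h w 6 F ∧ ∀ q < h * w, F 6 q / w = q / w ∧
      (F 6 q % w < 2 ↔ ρ (q / w) (q % w) < 2) := by
  obtain ⟨c, rfl, rfl, hb, -, hs, hc⟩ := exists_cert hh hw
  have hw0 : 0 < c.w := by omega
  choose! k hkR hk using fun r (hr : r < c.h) => exists_row rfl hc (ρ r) (hρ r hr) (inj r hr)
  choose! i hiR hi using fun r (hr : r < c.h) => exists_choice rfl hc (hkR r hr)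
  obtain ⟨K, hK, hKd⟩ := exists_digits c.np c.h i hiR
  obtain ⟨F, hF, hF6⟩ := Cert.exists_plan_of_splitOK hb hs hK
  refine ⟨F, hF, fun q hq => ⟨(hF6 q hq).1, ?_⟩⟩
  have hr : q / c.w < c.h := Nat.div_lt_of_lt_mul (by rwa [mul_comm] at hq)
  rw [(hF6 q hq).2, hKd _ hr, ← hi _ hr _ (Nat.mod_lt q hw0), hk _ hr _ (Nat.mod_lt q hw0)]

end BlockPlan

/-! ### Sorting lines with windows of four positions -/

namespace LineSort

/-- The left end of the window of position `p` in round `r`. -/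
def base (r p : ℕ) : ℕ := 4 * ((p - 2 * (r % 2)) / 4) + 2 * (r % 2)

/-- Position `p` of a line of length `L` belongs to a window of at least three positions. -/
def Active (L r p : ℕ) : Prop := 2 * (r % 2) ≤ p ∧ base r p + 3 ≤ L

instance (L r p : ℕ) : Decidable (Active L r p) := by unfold Active; infer_instance

/-- The number of rounds for a line of length `L`. -/
def rounds (L : ℕ) : ℕ := if L = 3 then 1 else (L + 1) / 2

/-- The rounds in which windows are completely sorted; in the other rounds only the two smallest
keys are moved to the left. -/
def Full (L r : ℕ) : Prop := ¬ (L % 2 = 1 ∧ 5 ≤ L ∧ r < 2)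

theorem exists_pos_eq {ι : Type*} [Fintype ι] {L : ℕ} (hc : Fintype.card ι = L) {f : ι → ℕ}
    (hf : Function.Injective f) (hL : ∀ i, f i < L) {p : ℕ} (hp : p < L) : ∃ i, f i = p := by
  have : Function.Bijective fun i => (⟨f i, hL i⟩ : Fin L) :=
    (Fintype.bijective_iff_injective_and_card _).2
      ⟨fun i j h => hf (congrArg Fin.val h), by simp [hc]⟩
  obtain ⟨i, hi⟩ := this.2 ⟨p, hp⟩
  exact ⟨i, congrArg Fin.val hi⟩

theorem card_ge_eq {ι : Type*} [Fintype ι] {L : ℕ} (hc : Fintype.card ι = L) {f : ι → ℕ}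
    (hf : Function.Injective f) (hL : ∀ i, f i < L) (m : ℕ) :
    (Finset.univ.filter fun i => m ≤ f i).card = L - m := by
  rw [← Finset.card_image_of_injective _ hf, ← Nat.card_Ico]
  congr 1
  ext p
  simp only [Finset.mem_image, Finset.mem_filter, Finset.mem_univ, true_and, Finset.mem_Ico]
  constructor
  · rintro ⟨i, h, rfl⟩; exact ⟨h, hL i⟩
  · rintro ⟨h1, h2⟩
    obtain ⟨i, rfl⟩ := exists_pos_eq hc hf hL h2
    exact ⟨i, h1, rfl⟩

/-- A round leaves only cells at the ends of the line idle: the first one if the windows are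
shifted, and the last one if its window has no second cell. In the round before, the windows are
shifted by one cell and cover it. -/
theorem active_of_idle {L S p q : ℕ} (hS : rounds L = S + 2) (hpq : p / 2 = q / 2) (hlt : p < q)
    (hq : q < L) (h : ¬ Active L (S + 1) p) : Active L S p ∧ Active L S q := by
  unfold rounds at hS
  split_ifs at hS
  · omega
  · unfold Active base at *
    rcases Nat.mod_two_eq_zero_or_one S with e | e
    · rw [show (S + 1) % 2 = 1 by omega] at h
      rw [e]
      omega
    · rw [show (S + 1) % 2 = 0 by omega] at h
      rw [e]
      omega

/-- A run of the windowed sorting process for the keys `key`; `pos r i` is the position of item `i`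
before round `r`. -/
structure Run {ι : Type*} (L : ℕ) (key : ι → ℕ) (pos : ℕ → ι → ℕ) : Prop where
  inj : ∀ r ≤ rounds L, Function.Injective (pos r)
  lt : ∀ r ≤ rounds L, ∀ i, pos r i < L
  idle : ∀ r < rounds L, ∀ i, ¬ Active L r (pos r i) → pos (r + 1) i = pos r i
  window : ∀ r < rounds L, ∀ i, Active L r (pos r i) →
    base r (pos r i) ≤ pos (r + 1) i ∧ pos (r + 1) i < base r (pos r i) + 4
  split : ∀ r < rounds L, ∀ i j, Active L r (pos r i) → Active L r (pos r j) →
    base r (pos r i) = base r (pos r j) → pos (r + 1) i / 2 < pos (r + 1) j / 2 → key i < key j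
  full : ∀ r < rounds L, Full L r → ∀ i j, Active L r (pos r i) → Active L r (pos r j) →
    base r (pos r i) = base r (pos r j) → pos (r + 1) i < pos (r + 1) j → key i < key j

namespace Run

/-- The windows of round `r` begin at positions `2 * y` with `y` of the parity of `r`, so no item
crosses such a boundary. -/
theorem boundary {ι : Type*} {L : ℕ} {key : ι → ℕ} {pos : ℕ → ι → ℕ} (H : Run L key pos) {r : ℕ}
    (hr : r < rounds L) {y : ℕ} (hy : y % 2 = r % 2) (i : ι) : 2 * y ≤ pos (r + 1) i ↔ 2 * y ≤ pos r i := by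
  by_cases h : Active L r (pos r i)
  · have := H.window r hr i h
    unfold Active base at *
    omega
  · rw [H.idle r hr i h]

variable {ι : Type*} [Fintype ι] {L : ℕ} {key : ι → ℕ} {pos : ℕ → ι → ℕ}

/-- The number of items with large keys in the cells from `y` on. -/
def count (key : ι → ℕ) (pos : ℕ → ι → ℕ) (θ r y : ℕ) : ℕ :=
  (Finset.univ.filter fun i => 2 * y ≤ pos r i ∧ θ ≤ key i).card

theorem count_boundary (H : Run L key pos) (θ : ℕ) {r : ℕ} (hr : r < rounds L) {y : ℕ}
    (hy : y % 2 = r % 2) : count key pos θ (r + 1) y = count key pos θ r y := by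
  unfold count
  congr 1
  ext i
  simp only [Finset.mem_filter, Finset.mem_univ, true_and, H.boundary hr hy i]

/-- Call items with key at least `θ` large, and consider the window of the cells `y` and `y + 1`
after the round. If the right cell holds only large items, it adds its whole size to the large items
beyond it. If it holds a small item, the left cell holds only small ones, so all large items counted
from `y` on lie beyond the boundary `y + 1`. -/
theorem count_middle (H : Run L key pos) (hc : Fintype.card ι = L) (θ : ℕ) {r : ℕ}
    (hr : r < rounds L) {y : ℕ} (hy : (y + 1) % 2 ≠ r % 2) (hyL : 2 * (y + 1) < L) :
    min (count key pos θ r y) (count key pos θ r (y + 2) + min 2 (L - 2 * (y + 1))) ≤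
      count key pos θ (r + 1) (y + 1) := by
  classical
  have hy0 : y % 2 = r % 2 := by omega
  have hy2 : (y + 2) % 2 = r % 2 := by omega
  have occ : ∀ {p}, p < L → ∃ i, pos (r + 1) i = p := exists_pos_eq hc (H.inj (r + 1) hr) (H.lt (r + 1) hr)
  rw [← H.count_boundary θ hr hy0, ← H.count_boundary θ hr hy2]
  by_cases hall : ∀ i, pos (r + 1) i / 2 = y + 1 → θ ≤ key i
  · refine (min_le_right _ _).trans ?_
    obtain ⟨i, hi⟩ := occ hyL
    have hi' := hall i (by omega)
    by_cases h2 : 2 * (y + 1) + 1 < L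
    · obtain ⟨j, hj⟩ := occ h2
      have hj' := hall j (by omega)
      have hsub : insert i (insert j (Finset.univ.filter fun a => 2 * (y + 2) ≤ pos (r + 1) a ∧ θ ≤ key a))
          ⊆ Finset.univ.filter fun a => 2 * (y + 1) ≤ pos (r + 1) a ∧ θ ≤ key a := by
        intro a
        simp only [Finset.mem_insert, Finset.mem_filter, Finset.mem_univ, true_and]
        rintro (rfl | rfl | h) <;> constructor <;> first | assumption | omega
      have := Finset.card_le_card hsub
      rw [Finset.card_insert_of_notMem, Finset.card_insert_of_notMem] at this
      · unfold count; omega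
      · simp; omega
      · simp only [Finset.mem_insert, Finset.mem_filter, Finset.mem_univ, true_and, not_or]
        exact ⟨fun h => by rw [h] at hi; omega, by omega⟩
    · have hsub : insert i (Finset.univ.filter fun a => 2 * (y + 2) ≤ pos (r + 1) a ∧ θ ≤ key a)
          ⊆ Finset.univ.filter fun a => 2 * (y + 1) ≤ pos (r + 1) a ∧ θ ≤ key a := by
        intro a
        simp only [Finset.mem_insert, Finset.mem_filter, Finset.mem_univ, true_and]
        rintro (rfl | h) <;> constructor <;> first | assumption | omega
      have := Finset.card_le_card hsub
      rw [Finset.card_insert_of_notMem] at this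
      · unfold count; omega
      · simp; omega
  · push Not at hall
    obtain ⟨j, hj, hjk⟩ := hall
    refine (min_le_left _ _).trans (Finset.card_le_card fun i => ?_)
    simp only [Finset.mem_filter, Finset.mem_univ, true_and]
    rintro ⟨h1, h2⟩
    refine ⟨?_, h2⟩
    by_contra hlt
    have b0 := H.boundary hr hy0 i
    have b1 := H.boundary hr hy2 i
    have b2 := H.boundary hr hy0 j
    have b3 := H.boundary hr hy2 j
    have li := H.lt r hr.le i
    have lj := H.lt r hr.le j
    have := H.split r hr i j (by unfold Active base; omega) (by unfold Active base; omega)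
      (by unfold base; omega) (by omega)
    omega

/-- The offset in the lower bound for `count`. -/
def offset (k : ℕ) : ℕ := 2 * (k / 4) + min 2 (k % 4)

/-- Every two rounds the guaranteed number of large items beyond a boundary grows by two, until all
of them have arrived or the space is full. Integer division rounds down, so the bound is also
meaningful for `y > r`. The offset is small enough for the pigeonhole bound at time zero and large
enough to yield `L - 2 * y` for `θ = 2 * y` after the last round. -/
theorem le_count (H : Run L key pos) (hc : Fintype.card ι = L) (hk : Function.Injective key)
    (hkL : ∀ i, key i < L) (θ : ℕ) (hθ : θ ≤ L) (r : ℕ) (hr : r ≤ rounds L) (y : ℕ) :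
    min ((L : ℤ) - θ) (min ((L : ℤ) - 2 * y) (2 * (((r : ℤ) - y) / 2) + offset (L - θ))) ≤
      count key pos θ r y := by
  classical
  have zero : ∀ r, count key pos θ r 0 = L - θ := fun r => by
    simp only [count, mul_zero, zero_le, true_and]; exact card_ge_eq hc hk hkL θ
  induction r generalizing y with
  | zero =>
    -- Only `θ` items are small, and they are all that can be missing among the last `L - 2 * y`
    -- positions.
    have h1 : L - 2 * y ≤ count key pos θ 0 y + θ := by
      have e1 := card_ge_eq hc (H.inj 0 (Nat.zero_le _)) (H.lt 0 (Nat.zero_le _)) (2 * y)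
      have e2 := card_ge_eq hc hk hkL θ
      have e3 : (Finset.univ.filter fun i => ¬ θ ≤ key i).card = θ := by
        have := Finset.card_filter_add_card_filter_not (s := Finset.univ) (fun i : ι => θ ≤ key i)
        rw [Finset.card_univ, hc] at this
        omega
      rw [← e1]
      have : (Finset.univ.filter fun i => 2 * y ≤ pos 0 i) ⊆
          (Finset.univ.filter fun i => 2 * y ≤ pos 0 i ∧ θ ≤ key i) ∪
            Finset.univ.filter fun i => ¬ θ ≤ key i := by
        intro i
        simp only [Finset.mem_union, Finset.mem_filter, Finset.mem_univ, true_and]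
        tauto
      have := (Finset.card_le_card this).trans (Finset.card_union_le _ _)
      rw [e3] at this
      exact this
    rcases Nat.eq_zero_or_pos y with rfl | hy
    · rw [zero]; omega
    · unfold offset; omega
  | succ r ih =>
    have hr' : r < rounds L := hr
    rcases Nat.eq_zero_or_pos y with rfl | hy
    · rw [zero]; omega
    -- With equal parities `r - y` is even, and the quotient by two does not change when `r` grows
    -- by one.
    by_cases hyr : y % 2 = r % 2
    · rw [H.count_boundary θ hr' hyr]
      have := ih hr'.le y
      push_cast
      omega
    · by_cases hyL : 2 * y < L
      · obtain ⟨z, rfl⟩ : ∃ z, y = z + 1 := ⟨y - 1, by omega⟩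
        have h := H.count_middle hc θ hr' hyr hyL
        have h1 := ih hr'.le z
        have h2 := ih hr'.le (z + 2)
        push_cast at *
        omega
      · omega

/-- For `θ = 2 * y` the lower bound equals both the number of places beyond the boundary and the
number of large items. Hence position and key of every item lie on the same side of every cell
boundary. -/
theorem half_eq (H : Run L key pos) (hc : Fintype.card ι = L)
    (hk : Function.Injective key) (hkL : ∀ i, key i < L) (i : ι) :
    pos (rounds L) i / 2 = key i / 2 := by
  have main : ∀ y, 1 ≤ y → 2 * y < L → ∀ i, (2 * y ≤ pos (rounds L) i ↔ 2 * y ≤ key i) := by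
    intro y hy hyL
    have h1 : L - 2 * y ≤ count key pos (2 * y) (rounds L) y := by
      have h := H.le_count hc hk hkL (2 * y) hyL.le (rounds L) le_rfl y
      unfold rounds offset at *
      split_ifs at * <;> push_cast at * <;> omega
    have e1 := card_ge_eq hc (H.inj _ le_rfl) (H.lt _ le_rfl) (2 * y)
    have e2 := card_ge_eq hc hk hkL (2 * y)
    have s1 : (Finset.univ.filter fun i => 2 * y ≤ pos (rounds L) i ∧ 2 * y ≤ key i) =
        Finset.univ.filter fun i => 2 * y ≤ pos (rounds L) i :=
      Finset.eq_of_subset_of_card_le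
        (fun i => by simp only [Finset.mem_filter, Finset.mem_univ, true_and]; tauto) (by rw [e1]; exact h1)
    have s2 : (Finset.univ.filter fun i => 2 * y ≤ pos (rounds L) i ∧ 2 * y ≤ key i) =
        Finset.univ.filter fun i => 2 * y ≤ key i :=
      Finset.eq_of_subset_of_card_le
        (fun i => by simp only [Finset.mem_filter, Finset.mem_univ, true_and]; tauto) (by rw [e2]; exact h1)
    intro i
    have := Finset.ext_iff.1 (s1.symm.trans s2) i
    simpa using this
  have hp := H.lt _ le_rfl i
  have hki := hkL i
  by_contra hne
  rcases Nat.lt_or_gt_of_ne hne with h | h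
  · have := (main (key i / 2) (by omega) (by omega) i).2 (by omega)
    omega
  · have := (main (pos (rounds L) i / 2) (by omega) (by omega) i).1 (by omega)
    omega

/-- At the end every item is at the position given by its key. -/
theorem sorted (H : Run L key pos) (hL : 3 ≤ L) (hc : Fintype.card ι = L)
    (hk : Function.Injective key) (hkL : ∀ i, key i < L) (i : ι) : pos (rounds L) i = key i := by
  have inner : ∀ i j, pos (rounds L) i / 2 = pos (rounds L) j / 2 →
      pos (rounds L) i < pos (rounds L) j → key i < key j := by
    intro i j hij hlt
    have hR : 1 ≤ rounds L := by unfold rounds; split_ifs <;> omega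
    obtain ⟨R, hR⟩ : ∃ R, rounds L = R + 1 := ⟨rounds L - 1, by omega⟩
    have hlast : R < rounds L := by omega
    -- For odd `L ≥ 5` there are at least three rounds, so the last one is not among the two split
    -- rounds.
    have fullR : Full L R := by
      unfold Full; unfold rounds at hR; split_ifs at hR <;> omega
    have lj := H.lt _ le_rfl j
    rw [hR] at hij hlt lj
    by_cases ha : Active L R (pos R i)
    · have wi := H.window R hlast i ha
      by_cases hb : Active L R (pos R j)
      · have wj := H.window R hlast j hb
        exact H.full R hlast fullR i j ha hb (by unfold base at *; omega) hlt
      · rw [H.idle R hlast j hb] at *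
        unfold Active base at *; omega
    · have ei := H.idle R hlast i ha
      have hb : ¬ Active L R (pos R j) := by
        intro hb
        have wj := H.window R hlast j hb
        unfold Active base at *; omega
      have ej := H.idle R hlast j hb
      -- There is a single round only for `L = 3`, and then one window covers the line and nothing
      -- is idle.
      obtain ⟨S, hS⟩ : ∃ S, R = S + 1 := by
        refine ⟨R - 1, ?_⟩
        rcases Nat.eq_zero_or_pos R with h | h
        · exfalso
          unfold rounds Active base at *
          split_ifs at hR <;> omega
        · omega
      have hS' : S < rounds L := by omega
      have li := H.lt S hS'.le i
      have ljS := H.lt S hS'.le j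
      -- For odd `L ≥ 7` this round has number at least two. For `L = 5` the idle position of the
      -- last round is alone in its cell, so there is no pair to consider.
      have fullS : Full L S := by
        unfold Full
        unfold rounds Active base at *
        split_ifs at hR <;> omega
      rw [ei, ej] at hij hlt
      rw [ej] at lj
      rw [hS] at hij hlt lj ha hb
      obtain ⟨aS', bS'⟩ := active_of_idle (by omega : rounds L = S + 2) hij hlt lj ha
      have aS : Active L S (pos S i) := by
        by_contra h
        rw [H.idle S hS' i h] at aS'
        exact h aS'
      have bS : Active L S (pos S j) := by
        by_contra h
        rw [H.idle S hS' j h] at bS'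
        exact h bS'
      have wi := H.window S hS' i aS
      have wj := H.window S hS' j bS
      exact H.full S hS' fullS i j aS bS (by unfold base at *; omega) hlt
  have hi := H.half_eq hc hk hkL i
  have li := H.lt _ le_rfl i
  have ki := hkL i
  by_contra hne
  have occ : ∀ {p}, p < L → ∃ j, pos (rounds L) j = p :=
    exists_pos_eq hc (H.inj _ le_rfl) (H.lt _ le_rfl)
  -- The item found at the place of the key of `i` is in the same cell, so the two items of this
  -- cell are interchanged, which contradicts `inner`.
  obtain ⟨j, hj⟩ := occ ki
  have hjh := H.half_eq hc hk hkL j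
  have hjk : key j ≠ key i := fun h => hne (hk h ▸ hj)
  rcases Nat.lt_or_gt_of_ne hne with h | h
  · have := inner i j (by omega) (by omega)
    omega
  · have := inner j i (by omega) (by omega)
    omega

end Run

end LineSort

/-! ### Derived tests and search loops of the structured language -/

namespace LoopLang

open RAM

namespace Expr

/-- nonzero iff the values differ -/
def ne (a b : Expr) : Expr := add (sub a b) (sub b a)
/-- nonzero iff the values agree -/
def eq (a b : Expr) : Expr := sub (lit 1) (ne a b)
/-- nonzero iff the first value is smaller -/
def lt (a b : Expr) : Expr := sub b a
/-- nonzero iff the first value is not larger -/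
def le (a b : Expr) : Expr := sub (add b (lit 1)) a
/-- negation -/
def not (a : Expr) : Expr := sub (lit 1) a
/-- conjunction -/
def and (a b : Expr) : Expr := sub (lit 1) (add (sub (lit 1) a) (sub (lit 1) b))
/-- disjunction -/
def or (a b : Expr) : Expr := add a b

variable {a b : Expr} {σ : State}

@[simp] theorem ne_eval : (ne a b).eval σ = 0 ↔ a.eval σ = b.eval σ := by simp [ne]; omega
@[simp] theorem eq_eval : (eq a b).eval σ = 0 ↔ a.eval σ ≠ b.eval σ := by simp [eq, ne]; omega
@[simp] theorem lt_eval : (lt a b).eval σ = 0 ↔ b.eval σ ≤ a.eval σ := by simp [lt]; omega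
@[simp] theorem le_eval : (le a b).eval σ = 0 ↔ b.eval σ < a.eval σ := by simp [le]; omega
@[simp] theorem not_eval : (not a).eval σ = 0 ↔ a.eval σ ≠ 0 := by simp [not]; omega
@[simp] theorem and_eval : (and a b).eval σ = 0 ↔ a.eval σ = 0 ∨ b.eval σ = 0 := by
  simp [and]; omega
@[simp] theorem or_eval : (or a b).eval σ = 0 ↔ a.eval σ = 0 ∧ b.eval σ = 0 := by simp [or]
@[simp] theorem ne_ok : (ne a b).ok = (a.ok && b.ok) := by
  simp [ne]; tauto
@[simp] theorem lt_ok : (lt a b).ok = (a.ok && b.ok) := by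
  simp [lt]; cases a.ok <;> cases b.ok <;> rfl
@[simp] theorem le_ok : (le a b).ok = (a.ok && b.ok) := by
  simp [le]; cases a.ok <;> cases b.ok <;> rfl
@[simp] theorem not_ok : (not a).ok = a.ok := by simp [not]
@[simp] theorem and_ok : (and a b).ok = (a.ok && b.ok) := by simp [and]
@[simp] theorem or_ok : (or a b).ok = (a.ok && b.ok) := by simp [or]

end Expr

namespace Stmt

/-- One-sided conditional. -/
def when (e : Expr) (p : Stmt) : Stmt := ite e p skip

@[simp] theorem when_eval (e : Expr) (p : Stmt) (σ : State) :
    (when e p).eval σ = if e.eval σ = 0 then σ else p.eval σ := by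
  by_cases h : e.eval σ = 0 <;> simp [when, h]
@[simp] theorem when_ok (e : Expr) (p : Stmt) : (when e p).ok = (e.ok && p.ok) := by simp [when]

@[simp] theorem seqs_eval_nil (σ : State) : (seqs []).eval σ = σ := rfl
@[simp] theorem seqs_eval_cons (p : Stmt) (l : List Stmt) (σ : State) :
    (seqs (p :: l)).eval σ = (seqs l).eval (p.eval σ) := rfl
@[simp] theorem seqs_ok_nil : (seqs []).ok = true := rfl
@[simp] theorem seqs_ok_cons (p : Stmt) (l : List Stmt) :
    (seqs (p :: l)).ok = (p.ok && (seqs l).ok) := rfl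

/-- Search loops: if some index has the property `P`, then register `x` receives the value of an
index with this property. -/
theorem search {x j b : ℕ} {cond e : Expr} {σ : State} (hxj : x ≠ j) (P : ℕ → Prop) (val : ℕ → ℕ)
    (h : ∀ k < σ.reg b, ∀ τ : State, τ.arr = σ.arr →
      (∀ y, y ≠ j → y ≠ x → τ.reg y = σ.reg y) → τ.reg j = k →
      (cond.eval τ ≠ 0 ↔ P k) ∧ e.eval τ = val k) :
    ∃ τ, (rep j b (when cond (set x e))).eval σ = τ ∧ τ.arr = σ.arr ∧
      (∀ y, y ≠ j → y ≠ x → τ.reg y = σ.reg y) ∧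
      ((∃ k < σ.reg b, P k ∧ τ.reg x = val k) ∨
        (∀ k < σ.reg b, ¬ P k) ∧ τ.reg x = σ.reg x) := by
  refine ⟨_, rfl, ?_⟩
  simp only [eval]
  refine iter_inv (fun N τ => τ.arr = σ.arr ∧ (∀ y, y ≠ j → y ≠ x → τ.reg y = σ.reg y) ∧
    ((∃ k < N, P k ∧ τ.reg x = val k) ∨ (∀ k < N, ¬ P k) ∧ τ.reg x = σ.reg x))
    ⟨rfl, fun _ _ _ => rfl, .inr ⟨by simp, rfl⟩⟩ ?_
  rintro k τ hk ⟨h1, h2, h3⟩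
  have hk' := h k hk (τ.setReg j k) (by simpa using h1) (fun y hy hyx => by simp [hy, h2 y hy hyx])
    (by simp)
  by_cases hP : P k
  · have hc := hk'.1.2 hP
    rw [when_eval, if_neg hc]
    refine ⟨by simpa using h1, fun y hy hyx => by simp [hy, hyx, h2 y hy hyx],
      .inl ⟨k, by omega, hP, by simp [hk'.2]⟩⟩
  · have hc : cond.eval (τ.setReg j k) = 0 := by
      by_contra hc
      exact hP (hk'.1.1 hc)
    rw [when_eval, if_pos hc]
    refine ⟨by simpa using h1, fun y hy hyx => by simp [hy, h2 y hy hyx], ?_⟩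
    rcases h3 with ⟨l, hl, hl'⟩ | ⟨h3, h4⟩
    · exact .inl ⟨l, by omega, by simpa [hxj] using hl'⟩
    · refine .inr ⟨fun l hl => ?_, by simpa [hxj] using h4⟩
      rcases Nat.lt_succ_iff_lt_or_eq.1 hl with h | rfl
      exacts [h3 l h, hP]

end Stmt

end LoopLang

/-! ### Edge colouring of bipartite multigraphs -/

namespace EdgeColouring

/-- `c` is a proper partial colouring (`0` means no colour) of the edges `0, …, n - 1` of the
bipartite multigraph in which edge `i` joins `p i` and `q i`. -/
def Proper (n : ℕ) (p q c : ℕ → ℕ) : Prop :=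
  ∀ i < n, ∀ j < n, i ≠ j → c i ≠ 0 → c i = c j → p i ≠ p j ∧ q i ≠ q j

/-- State of the recolouring along an alternating chain: `S` is the set of recoloured edges, among
them the new edge `i`, and conflicts occur only at the `p`-end of the last one, `e`. -/
structure Chain (n : ℕ) (c₀ : ℕ → ℕ) (i : ℕ) (p q : ℕ → ℕ) (α β : ℕ) (c : ℕ → ℕ) (e : ℕ)
    (S : Finset ℕ) : Prop where
  mem : i ∈ S
  last : e ∈ S
  lt : ∀ j ∈ S, j < n
  col_last : c e = α
  out : ∀ j ∉ S, c j = c₀ j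
  flip : ∀ j ∈ S, j ≠ i → c₀ j = α ∧ c j = β ∨ c₀ j = β ∧ c j = α
  col_new : c i = α ∨ c i = β
  clean : ∀ j < n, ∀ k < n, j ≠ k → c j ≠ 0 → c j = c k → q j ≠ q k
  conflict : ∀ j < n, ∀ k < n, j ≠ k → c j ≠ 0 → c j = c k → p j = p k → j = e ∨ k = e

/-- The Kempe chain argument: the conflicting edge `f` takes the other colour, and the two sides and
the two colours exchange roles. The chain does not revisit an edge: a recoloured old edge that now
has colour `α` had colour `β` before, and so had `e` unless it is the new edge; two such edges
cannot share an end in the proper colouring `c₀`, and `β` was missing at the `p`-end of `i`. The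
same facts show that `f` has no conflict in its new colour at the common end, so only its other end
remains in question. -/
theorem Chain.step {n i α β e f : ℕ} {c₀ p q c : ℕ → ℕ} {S : Finset ℕ}
    (H : Chain n c₀ i p q α β c e S) (h₀ : Proper n p q c₀) (hα : α ≠ 0) (hβ : β ≠ 0)
    (hp : ∀ j < n, p j = p i → c₀ j ≠ β) (hf : f < n) (hfe : f ≠ e)
    (hc : c f = c e) (hpf : p f = p e) :
    f ∉ S ∧ Chain n c₀ i q p β α (Function.update c f β) f (insert f S) := by
  have hen := H.lt e H.last
  have hcf : c f = α := hc.trans H.col_last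
  -- Every old edge of the chain has exchanged `α` and `β`.
  have e_old : e ≠ i → c₀ e = β := fun h => by
    rcases H.flip e H.last h with ⟨h1, h2⟩ | ⟨h1, h2⟩
    · exact h1.trans (H.col_last.symm.trans h2)
    · exact h1
  have hfS : f ∉ S := by
    intro hfS
    by_cases hfi : f = i
    · subst hfi
      exact hp e hen hpf.symm (e_old fun h => hfe h.symm)
    · have f_old : c₀ f = β := by
        rcases H.flip f hfS hfi with ⟨h1, h2⟩ | ⟨h1, h2⟩
        · exact h1.trans (hcf.symm.trans h2)
        · exact h1
      by_cases hei : e = i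
      · exact hp f hf (hei ▸ hpf) f_old
      · exact (h₀ f hf e hen hfe (f_old ▸ hβ) (f_old.trans (e_old hei).symm)).1 hpf
  have hfi : f ≠ i := fun h => hfS (h ▸ H.mem)
  have f_old : c₀ f = α := (H.out f hfS).symm.trans hcf
  have key : ∀ k < n, k ≠ f → c k = β → p k ≠ p f := by
    intro k hk hkf hck hpk
    by_cases hki : k = i
    · subst hki
      by_cases hei : e = k
      · subst hei
        exact hp f hf hpf (f_old.trans (H.col_last.symm.trans hck))
      · exact hp e hen (hpf.symm.trans hpk.symm) (e_old hei)
    · by_cases hkS : k ∈ S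
      · have k_old : c₀ k = α := by
          rcases H.flip k hkS hki with ⟨h1, h2⟩ | ⟨h1, h2⟩
          · exact h1
          · exact h1.trans (hck.symm.trans h2)
        exact (h₀ k hk f hf hkf (k_old ▸ hα) (k_old.trans f_old.symm)).1 hpk
      · have k_old : c₀ k = β := (H.out k hkS).symm.trans hck
        by_cases hei : e = i
        · exact hp k hk (by rw [hpk, hpf, hei]) k_old
        · exact (h₀ k hk e hen (fun h => hkS (h ▸ H.last)) (k_old ▸ hβ)
            (k_old.trans (e_old hei).symm)).1 (hpk.trans hpf)
  refine ⟨hfS, ⟨by simp [H.mem], by simp, ?_, by simp, ?_, ?_, ?_, ?_, ?_⟩⟩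
  · intro j hj
    rcases Finset.mem_insert.1 hj with rfl | hj
    exacts [hf, H.lt j hj]
  · intro j hj
    simp only [Finset.mem_insert, not_or] at hj
    rw [Function.update_of_ne hj.1, H.out j hj.2]
  · intro j hj hji
    rcases Finset.mem_insert.1 hj with rfl | hj
    · exact .inr ⟨f_old, by simp⟩
    · rw [Function.update_of_ne (show j ≠ f from fun h => hfS (h ▸ hj))]
      exact (H.flip j hj hji).symm
  · rw [Function.update_of_ne hfi.symm]; exact H.col_new.symm
  · intro j hj k hk hjk h0 hjk'
    by_cases hjf : j = f
    · subst hjf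
      rw [Function.update_self, Function.update_of_ne hjk.symm] at hjk'
      exact (key k hk hjk.symm hjk'.symm).symm
    · by_cases hkf : k = f
      · subst hkf
        rw [Function.update_self, Function.update_of_ne hjf] at hjk'
        exact key j hj hjf hjk'
      · rw [Function.update_of_ne hjf] at h0 hjk'
        rw [Function.update_of_ne hkf] at hjk'
        intro hpp
        have h1 := H.conflict j hj k hk hjk h0 hjk' hpp
        rcases h1 with rfl | rfl
        · rcases H.conflict k hk f hf hkf (hjk' ▸ h0) (hjk'.symm.trans hc.symm)
            (hpp.symm.trans hpf.symm) with h | h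
          exacts [hjk h.symm, hfe h]
        · rcases H.conflict j hj f hf hjf h0 (hjk'.trans hc.symm) (hpp.trans hpf.symm) with h | h
          exacts [hjk h, hfe h]
  · intro j hj k hk hjk h0 hjk' hqq
    by_contra hne
    push Not at hne
    rw [Function.update_of_ne hne.1] at h0 hjk'
    rw [Function.update_of_ne hne.2] at hjk'
    exact H.clean j hj k hk hjk h0 hjk' hqq

/-- Since `α` is missing at the `q`-end of the new edge, only its `p`-end can be in conflict. -/
theorem Chain.start {n i α β : ℕ} {c₀ p q : ℕ → ℕ} (h₀ : Proper n p q c₀) (hi : i < n)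
    (hq : ∀ j < n, q j = q i → c₀ j ≠ α) :
    Chain n c₀ i p q α β (Function.update c₀ i α) i {i} := by
  refine ⟨by simp, by simp, by simp [hi], by simp, fun j hj => ?_, fun j hj h => ?_, by simp, ?_, ?_⟩
  · rw [Function.update_of_ne (by simpa using hj)]
  · exact absurd (by simpa using hj) h
  · intro j hj k hk hjk h0 hjk'
    by_cases hji : j = i
    · subst hji
      rw [Function.update_self, Function.update_of_ne hjk.symm] at hjk'
      exact fun h => hq k hk h.symm hjk'.symm
    · by_cases hki : k = i
      · subst hki
        rw [Function.update_self, Function.update_of_ne hji] at hjk'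
        exact fun h => hq j hj h hjk'
      · rw [Function.update_of_ne hji] at h0 hjk'
        rw [Function.update_of_ne hki] at hjk'
        exact (h₀ j hj k hk hjk h0 hjk').2
  · intro j hj k hk hjk h0 hjk' hpp
    by_contra hne
    push Not at hne
    rw [Function.update_of_ne hne.1] at h0 hjk'
    rw [Function.update_of_ne hne.2] at hjk'
    exact (h₀ j hj k hk hjk h0 hjk').1 hpp

theorem Chain.proper {n i α β e : ℕ} {c₀ p q c : ℕ → ℕ} {S : Finset ℕ}
    (H : Chain n c₀ i p q α β c e S) (h : ∀ f < n, f ≠ e → c f = c e → p f ≠ p e) :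
    Proper n p q c := by
  intro j hj k hk hjk h0 hjk'
  refine ⟨fun hpp => ?_, H.clean j hj k hk hjk h0 hjk'⟩
  rcases H.conflict j hj k hk hjk h0 hjk' hpp with rfl | rfl
  · exact h k hk hjk.symm hjk'.symm hpp.symm
  · exact h j hj hjk hjk' hpp

theorem Proper.symm {n : ℕ} {p q c : ℕ → ℕ} (h : Proper n p q c) : Proper n q p c :=
  fun i hi j hj hij h0 hc => (h i hi j hj hij h0 hc).symm

/-- A vertex of degree at most `d` with an uncoloured edge misses one of `d` colours. -/
theorem exists_free {n d i : ℕ} {p c : ℕ → ℕ} (hi : i < n) (hc : c i = 0)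
    (hd : ((Finset.range n).filter fun j => p j = p i).card ≤ d) :
    ∃ a < d, ∀ j < n, p j = p i → c j ≠ a + 1 := by
  by_contra! h
  have hsub : (Finset.range d).image (· + 1) ⊆
      (((Finset.range n).filter fun j => p j = p i).erase i).image c := by
    intro a ha
    obtain ⟨b, hb, rfl⟩ := Finset.mem_image.1 ha
    obtain ⟨j, hj, hpj, hcj⟩ := h b (Finset.mem_range.1 hb)
    refine Finset.mem_image.2 ⟨j, Finset.mem_erase.2 ⟨?_, ?_⟩, hcj⟩
    · rintro rfl; omega
    · simp [hj, hpj]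
  have h1 := (Finset.card_le_card hsub).trans Finset.card_image_le
  rw [Finset.card_image_of_injective _ (fun a b h => by simpa using h), Finset.card_range,
    Finset.card_erase_of_mem (by simp [hi])] at h1
  have : 0 < ((Finset.range n).filter fun j => p j = p i).card :=
    Finset.card_pos.2 ⟨i, by simp [hi]⟩
  omega

end EdgeColouring

namespace GridProgram

open RAM LoopLang EdgeColouring
open LoopLang.Expr (reg lit arr add sub ne eq lt le not and or)
open LoopLang.Stmt (set store rep repc when seqs)

/-! ### The colouring program

Array `6` holds the colours of the agents, which are seen as edges between their start rows
(array `0`) and their goal rows (array `2`). -/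

/-- Put into register `x` a colour that is missing at the end of edge `reg 3` given by array `K`. -/
def freeColour (x K : ℕ) : Stmt :=
  rep 4 1 (seqs [
    set 5 (lit 0),
    rep 6 2 (when (and (eq (arr 6 (reg 6)) (add (reg 4) (lit 1)))
      (eq (arr K (reg 6)) (arr K (reg 3)))) (set 5 (lit 1))),
    when (not (reg 5)) (set x (add (reg 4) (lit 1)))])

/-- One step along an alternating chain with colours `reg 7` and `reg 8`: if the last recoloured edge
`reg 9` has a conflict at its end of side `reg 10`, recolour the other edge. -/
def chainStep : Stmt :=
  seqs [
    set 11 (reg 2),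
    rep 6 2 (when (and (and (ne (reg 6) (reg 9)) (eq (arr 6 (reg 6)) (arr 6 (reg 9))))
      (or (and (not (reg 10)) (eq (arr 2 (reg 6)) (arr 2 (reg 9))))
        (and (reg 10) (eq (arr 0 (reg 6)) (arr 0 (reg 9)))))) (set 11 (reg 6))),
    when (lt (reg 11) (reg 2)) (seqs [
      store 6 (reg 11) (sub (add (reg 7) (reg 8)) (arr 6 (reg 9))),
      set 9 (reg 11),
      set 10 (sub (lit 1) (reg 10))])]

/-- Colour the edge `reg 3`. -/
def insertEdge : Stmt :=
  seqs [freeColour 7 0, freeColour 8 2, store 6 (reg 3) (reg 7), set 9 (reg 3), set 10 (lit 0),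
    rep 12 2 chainStep]

/-- Colour all edges, and put the colours, counted from `0`, into array `7`. -/
def colouring : Stmt :=
  seqs [rep 3 2 insertEdge, rep 3 2 (store 7 (reg 3) (sub (arr 6 (reg 3)) (lit 1)))]

/-- Register `4` runs through the candidates, shifted by one because colour `0` means uncoloured;
register `5` flags a candidate that already occurs at the vertex. -/
theorem freeColour_eval {x K : ℕ} (hx : x = 7 ∨ x = 8) (σ : State)
    (hfree : ∃ a < σ.reg 1, ∀ j < σ.reg 2, σ.arr K j = σ.arr K (σ.reg 3) → σ.arr 6 j ≠ a + 1) :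
    ∃ τ, (freeColour x K).eval σ = τ ∧ τ.arr = σ.arr ∧
      (∀ y, y ≠ 4 → y ≠ 5 → y ≠ 6 → y ≠ x → τ.reg y = σ.reg y) ∧
      1 ≤ τ.reg x ∧ τ.reg x ≤ σ.reg 1 ∧
      ∀ j < σ.reg 2, σ.arr K j = σ.arr K (σ.reg 3) → σ.arr 6 j ≠ τ.reg x := by
  refine ⟨_, rfl, ?_⟩
  set Free : ℕ → Prop := fun a => ∀ j < σ.reg 2, σ.arr K j = σ.arr K (σ.reg 3) → σ.arr 6 j ≠ a
    with hFree
  have main : ∀ N ≤ σ.reg 1, ∀ τ, τ = iter (fun k τ => Stmt.eval (seqs [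
      set 5 (lit 0),
      rep 6 2 (when (and (eq (arr 6 (reg 6)) (add (reg 4) (lit 1)))
        (eq (arr K (reg 6)) (arr K (reg 3)))) (set 5 (lit 1))),
      when (not (reg 5)) (set x (add (reg 4) (lit 1)))]) (τ.setReg 4 k)) N σ →
      τ.arr = σ.arr ∧ (∀ y, y ≠ 4 → y ≠ 5 → y ≠ 6 → y ≠ x → τ.reg y = σ.reg y) ∧
      ((∃ a < N, Free (a + 1)) → 1 ≤ τ.reg x ∧ τ.reg x ≤ N ∧ Free (τ.reg x)) := by
    intro N hN τ hτ
    subst hτ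
    refine iter_inv (fun N τ => τ.arr = σ.arr ∧
      (∀ y, y ≠ 4 → y ≠ 5 → y ≠ 6 → y ≠ x → τ.reg y = σ.reg y) ∧
      ((∃ a < N, Free (a + 1)) → 1 ≤ τ.reg x ∧ τ.reg x ≤ N ∧ Free (τ.reg x)))
      ⟨rfl, fun _ _ _ _ _ => rfl, by simp⟩ ?_
    rintro k τ hk ⟨h1, h2, h3⟩
    obtain ⟨ρ, e1, e2, e3, e4⟩ := Stmt.search (x := 5) (j := 6) (b := 2)
      (cond := and (eq (arr 6 (reg 6)) (add (reg 4) (lit 1))) (eq (arr K (reg 6)) (arr K (reg 3))))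
      (e := lit 1) (σ := (τ.setReg 4 k).setReg 5 0) (by decide)
      (fun j => σ.arr 6 j = k + 1 ∧ σ.arr K j = σ.arr K (σ.reg 3)) (fun _ => 1) (by
        intro j hj ρ hρ hρr hρj
        have r4 := hρr 4 (by decide) (by decide)
        have r3 := hρr 3 (by decide) (by decide)
        have r3' := h2 3 (by decide) (by decide) (by decide) (by omega)
        simp at r4 r3 hρ
        simp [hρj, r4, r3, hρ, h1, r3'])
    have r2 := h2 2 (by decide) (by decide) (by decide) (by omega)
    have hfk : ρ.reg 5 = 0 ↔ Free (k + 1) := by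
      simp [r2] at e4
      rcases e4 with ⟨j, hj, ⟨hj1, hj2⟩, h5⟩ | ⟨hn, h5⟩
      · exact ⟨fun h => by omega, fun h => absurd hj1 (h j hj hj2)⟩
      · exact ⟨fun _ j hj h2 h1 => hn j hj h1 h2, fun _ => h5⟩
    have r4 : ρ.reg 4 = k := by rw [e3 4 (by decide) (by decide)]; simp
    rw [Stmt.seqs_eval_cons, Stmt.seqs_eval_cons, Stmt.eval, Expr.eval, e1]
    by_cases hF : Free (k + 1)
    · have h5 := hfk.2 hF
      simp [h5]
      refine ⟨by simpa [h1] using e2, fun y y4 y5 y6 yx => ?_, fun _ _ _ => ⟨by omega, ?_⟩⟩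
      · simp [yx, e3 y y6 y5, y4, y5, h2 y y4 y5 y6 yx]
      · rw [r4]; exact hF
    · have h5 : ρ.reg 5 ≠ 0 := fun h => hF (hfk.1 h)
      simp [h5]
      refine ⟨by simpa [h1] using e2, fun y y4 y5 y6 yx => ?_, fun a ha hFa => ?_⟩
      · simp [e3 y y6 y5, y4, y5, h2 y y4 y5 y6 yx]
      · have hak : a < k := by
          rcases Nat.lt_or_eq_of_le (Nat.le_of_lt_succ (by omega : a < k + 1)) with h | rfl
          exacts [h, absurd hFa hF]
        have := h3 ⟨a, hak, hFa⟩
        have rx : ρ.reg x = τ.reg x := by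
          rw [e3 x (by omega) (by omega)]; simp [show x ≠ 5 by omega, show x ≠ 4 by omega]
        rw [rx]
        exact ⟨this.1, by omega, this.2.2⟩
  obtain ⟨h1, h2, h3⟩ := main _ le_rfl _ rfl
  exact ⟨h1, h2, (h3 hfree).1, (h3 hfree).2.1, (h3 hfree).2.2⟩

/-- Invariant of the recolouring loop, for old colours `c₀` and new edge `i`. -/
def ChainInv (n : ℕ) (c₀ : ℕ → ℕ) (i : ℕ) (u v : ℕ → ℕ) (a b t : ℕ) (τ : State) : Prop :=
  ∃ (S : Finset ℕ) (p q : ℕ → ℕ) (α β : ℕ),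
    (τ.reg 10 = 0 ∧ p = v ∧ q = u ∧ α = a ∧ β = b ∨
      τ.reg 10 = 1 ∧ p = u ∧ q = v ∧ α = b ∧ β = a) ∧
    Chain n c₀ i p q α β (τ.arr 6) (τ.reg 9) S ∧
    (t + 1 ≤ S.card ∨ ∀ f < n, f ≠ τ.reg 9 → τ.arr 6 f = τ.arr 6 (τ.reg 9) → p f ≠ p (τ.reg 9))

/-- One execution either lengthens the chain by a new edge or finds it finished, and a finished
chain is left as it is. Thus a fixed number of executions can replace an unbounded loop. -/
theorem chainStep_eval {c₀ : ℕ → ℕ} {i t a b : ℕ} {u v : ℕ → ℕ} {σ : State}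
    (hu : σ.arr 0 = u) (hv : σ.arr 2 = v) (h7 : σ.reg 7 = a) (h8 : σ.reg 8 = b)
    (h₀ : Proper (σ.reg 2) u v c₀) (ha : a ≠ 0) (hb : b ≠ 0)
    (fa : ∀ j < σ.reg 2, u j = u i → c₀ j ≠ a) (fb : ∀ j < σ.reg 2, v j = v i → c₀ j ≠ b)
    (hinv : ChainInv (σ.reg 2) c₀ i u v a b t σ) :
    ∃ τ, chainStep.eval σ = τ ∧ (∀ y, y ≠ 6 → y ≠ 9 → y ≠ 10 → y ≠ 11 → τ.reg y = σ.reg y) ∧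
      (∀ y, y ≠ 6 → τ.arr y = σ.arr y) ∧ ChainInv (σ.reg 2) c₀ i u v a b (t + 1) τ := by
  obtain ⟨S, p, q, α, β, hside, hC, hcard⟩ := hinv
  have h₀' : Proper (σ.reg 2) p q c₀ := by
    rcases hside with ⟨-, rfl, rfl, -, -⟩ | ⟨-, rfl, rfl, -, -⟩
    exacts [h₀.symm, h₀]
  -- Register `11` is preset to the number of edges, which signals that no conflicting edge was
  -- found.
  obtain ⟨ρ, e1, e2, e3, e4⟩ := Stmt.search (x := 11) (j := 6) (b := 2)
      (cond := and (and (ne (reg 6) (reg 9)) (eq (arr 6 (reg 6)) (arr 6 (reg 9))))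
      (or (and (not (reg 10)) (eq (arr 2 (reg 6)) (arr 2 (reg 9))))
        (and (reg 10) (eq (arr 0 (reg 6)) (arr 0 (reg 9))))))
      (e := reg 6) (σ := σ.setReg 11 (σ.reg 2)) (by decide)
      (fun f => f ≠ σ.reg 9 ∧ σ.arr 6 f = σ.arr 6 (σ.reg 9) ∧ p f = p (σ.reg 9)) id (by
        intro j hj ρ hρ hρr hρj
        have r9 := hρr 9 (by decide) (by decide)
        have r10 := hρr 10 (by decide) (by decide)
        simp at r9 r10 hρ
        rcases hside with ⟨h10, rfl, rfl, -, -⟩ | ⟨h10, rfl, rfl, -, -⟩ <;>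
        simp [hρj, r9, r10, hρ, h10, hu, hv] <;> tauto)
  have er2 : (σ.setReg 11 (σ.reg 2)).reg 2 = σ.reg 2 := by simp
  rw [er2] at e4
  have r2 : ρ.reg 2 = σ.reg 2 := by rw [e3 2 (by decide) (by decide)]; simp
  have r7 : ρ.reg 7 = a := by rw [e3 7 (by decide) (by decide)]; simpa using h7
  have r8 : ρ.reg 8 = b := by rw [e3 8 (by decide) (by decide)]; simpa using h8
  have r9 : ρ.reg 9 = σ.reg 9 := by rw [e3 9 (by decide) (by decide)]; simp
  have r10 : ρ.reg 10 = σ.reg 10 := by rw [e3 10 (by decide) (by decide)]; simp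
  have ra : ρ.arr = σ.arr := by simpa using e2
  refine ⟨_, rfl, ?_⟩
  unfold chainStep
  rw [Stmt.seqs_eval_cons, Stmt.seqs_eval_cons, Stmt.eval, Expr.eval, e1]
  rcases e4 with ⟨f, hf, ⟨hfe, hc, hpf⟩, h11⟩ | ⟨hno, h11⟩
  · simp only [id] at h11
    obtain ⟨hfS, hC'⟩ := hC.step h₀' (by rcases hside with ⟨_, _, _, rfl, _⟩ | ⟨_, _, _, rfl, _⟩ <;> assumption)
      (by rcases hside with ⟨_, _, _, _, rfl⟩ | ⟨_, _, _, _, rfl⟩ <;> assumption)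
      (by rcases hside with ⟨_, rfl, _, _, rfl⟩ | ⟨_, rfl, _, _, rfl⟩ <;> assumption) hf hfe hc hpf
    have hlt : ¬ ρ.reg 2 ≤ ρ.reg 11 := by rw [r2, h11]; omega
    -- Since `α` and `β` are `a` and `b` in some order, subtracting the current colour from the sum
    -- gives the other one.
    have hsum : a + b - σ.arr 6 (σ.reg 9) = β := by
      rw [hC.col_last]
      rcases hside with ⟨_, _, _, rfl, rfl⟩ | ⟨_, _, _, rfl, rfl⟩ <;> omega
    simp only [Stmt.seqs_eval_cons, Stmt.seqs_eval_nil, Stmt.when_eval, Expr.lt_eval, Expr.eval, hlt,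
      if_false, Stmt.eval]
    refine ⟨fun y y6 y9 y10 y11 => ?_, fun y y6 => ?_, insert f S, q, p, β, α, ?_, ?_, ?_⟩
    · simp [y9, y10, e3 y y6 y11, y11]
    · funext k; simp [y6, ra]
    · simp only [setReg_reg, setArr_reg, r10]
      rcases hside with ⟨h, rfl, rfl, rfl, rfl⟩ | ⟨h, rfl, rfl, rfl, rfl⟩ <;> simp [h]
    · convert hC' using 1
      · funext k
        simp [Function.update_apply, h11, r7, r8, r9, ra, hsum]
      · simp [h11]
    · rw [Finset.card_insert_of_notMem hfS]
      rcases hcard with h | h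
      · exact .inl (by omega)
      · exact absurd hpf (h f hf hfe hc)
  · have hle : ρ.reg 2 ≤ ρ.reg 11 := by rw [r2, h11]; simp
    simp only [Stmt.seqs_eval_cons, Stmt.seqs_eval_nil, Stmt.when_eval, Expr.lt_eval, Expr.eval, hle,
      if_true]
    refine ⟨fun y y6 y9 y10 y11 => by simp [e3 y y6 y11, y11], fun y _ => by rw [ra],
      S, p, q, α, β, by rw [r10]; exact hside, by rw [ra, r9]; exact hC, .inr ?_⟩
    rw [ra, r9]
    exact fun f hf hfe hc hpf => hno f hf ⟨hfe, hc, hpf⟩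

/-- The first `k` edges are properly coloured with at most `m` colours, the others not at all. -/
structure Coloured (n m : ℕ) (u v : ℕ → ℕ) (k : ℕ) (c : ℕ → ℕ) : Prop where
  proper : Proper n u v c
  pos : ∀ j < k, 1 ≤ c j
  le : ∀ j < k, c j ≤ m
  zero : ∀ j, k ≤ j → c j = 0

theorem insertEdge_eval {u v : ℕ → ℕ} {i : ℕ} {σ : State} (hu : σ.arr 0 = u) (hv : σ.arr 2 = v)
    (hi : σ.reg 3 = i) (hin : i < σ.reg 2)
    (hdu : ((Finset.range (σ.reg 2)).filter fun j => u j = u i).card ≤ σ.reg 1)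
    (hdv : ((Finset.range (σ.reg 2)).filter fun j => v j = v i).card ≤ σ.reg 1)
    (hc : Coloured (σ.reg 2) (σ.reg 1) u v i (σ.arr 6)) :
    ∃ τ, insertEdge.eval σ = τ ∧ (∀ y, y ≠ 6 → τ.arr y = σ.arr y) ∧
      Coloured (σ.reg 2) (σ.reg 1) u v (i + 1) (τ.arr 6) := by
  obtain ⟨τ₁, e1, a1, r1, p1, l1, f1⟩ := freeColour_eval (x := 7) (K := 0) (.inl rfl) σ (by
    rw [hu, hi]; exact exists_free hin (hc.zero i le_rfl) hdu)
  obtain ⟨τ₂, e2, a2, r2, p2, l2, f2⟩ := freeColour_eval (x := 8) (K := 2) (.inr rfl) τ₁ (by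
    rw [a1, r1 1 (by decide) (by decide) (by decide) (by decide),
      r1 2 (by decide) (by decide) (by decide) (by decide),
      r1 3 (by decide) (by decide) (by decide) (by decide), hv, hi]
    exact exists_free hin (hc.zero i le_rfl) hdv)
  rw [a1, r1 2 (by decide) (by decide) (by decide) (by decide),
      r1 3 (by decide) (by decide) (by decide) (by decide), hv, hi] at f2
  rw [hu, hi] at f1
  have q1 : τ₂.reg 1 = σ.reg 1 := by rw [r2 1, r1 1] <;> decide
  have q2 : τ₂.reg 2 = σ.reg 2 := by rw [r2 2, r1 2] <;> decide
  have q3 : τ₂.reg 3 = i := by rw [r2 3, r1 3, hi] <;> decide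
  have q7 : τ₂.reg 7 = τ₁.reg 7 := by rw [r2 7] <;> decide
  rw [r1 1 (by decide) (by decide) (by decide) (by decide)] at l2
  set n := σ.reg 2
  set a := τ₁.reg 7
  set b := τ₂.reg 8
  set c₀ := σ.arr 6 with hc₀
  set τ₃ := ((τ₂.setArr 6 i a).setReg 9 i).setReg 10 0 with hτ₃
  have hrun : insertEdge.eval σ =
      iter (fun k τ => chainStep.eval (τ.setReg 12 k)) n τ₃ := by
    simp [insertEdge, e1, e2, q2, q3, q7, hτ₃]
  have arr6 : τ₃.arr 6 = Function.update c₀ i a := by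
    funext k; simp [hτ₃, a2, a1, Function.update_apply, hc₀]
  have arr0 : ∀ y, y ≠ 6 → τ₃.arr y = σ.arr y := fun y hy => by
    funext k; simp [hτ₃, hy, a2, a1]
  have key := iter_inv (f := fun k τ => chainStep.eval (τ.setReg 12 k)) (N := n) (σ := τ₃)
    (fun t τ => (∀ y, y ≠ 6 → y ≠ 9 → y ≠ 10 → y ≠ 11 → y ≠ 12 → τ.reg y = τ₃.reg y) ∧
      (∀ y, y ≠ 6 → τ.arr y = σ.arr y) ∧ ChainInv n c₀ i u v a b t τ)
    ⟨fun _ _ _ _ _ _ => rfl, arr0, {i}, v, u, a, b, .inl ⟨by simp [hτ₃], rfl, rfl, rfl, rfl⟩, by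
      rw [arr6]; simpa [hτ₃] using Chain.start hc.proper.symm hin f1, .inl (by simp)⟩ (by
      rintro t τ ht ⟨h1, h2, h3⟩
      have t2 : (τ.setReg 12 t).reg 2 = n := by
        simpa [hτ₃, q2] using h1 2 (by decide) (by decide) (by decide) (by decide) (by decide)
      obtain ⟨ρ, g1, g2, g3, g4⟩ := chainStep_eval (σ := τ.setReg 12 t) (u := u) (v := v) (c₀ := c₀)
        (i := i) (t := t) (a := a) (b := b)
        (by simpa [hu] using h2 0 (by decide)) (by simpa [hv] using h2 2 (by decide))
        (by simpa [hτ₃, q7] using h1 7 (by decide) (by decide) (by decide) (by decide) (by decide))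
        (by simpa [hτ₃, b] using h1 8 (by decide) (by decide) (by decide) (by decide) (by decide))
        (by rw [t2]; exact hc.proper) (by omega) (by omega) (by rw [t2]; exact f1)
        (by rw [t2]; exact f2) (by rw [t2]; simpa [ChainInv] using h3)
      rw [g1]
      refine ⟨fun y y6 y9 y10 y11 y12 => ?_, fun y hy => ?_, by rw [t2] at g4; exact g4⟩
      · rw [g2 y y6 y9 y10 y11]; simpa [y12] using h1 y y6 y9 y10 y11 y12
      · rw [g3 y hy]; simpa using h2 y hy)
  refine ⟨_, rfl, ?_⟩
  rw [hrun]
  set τ := iter (fun k τ => chainStep.eval (τ.setReg 12 k)) n τ₃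
  obtain ⟨-, h2, S, p, q, α, β, hside, hC, hcard⟩ := key
  -- All edges of `S` are below `n`, so `S` cannot have `n + 1` elements and the chain has ended.
  have hno := hcard.resolve_left (by
    have : S ⊆ Finset.range n := fun j hj => Finset.mem_range.2 (hC.lt j hj)
    have := Finset.card_le_card this
    rw [Finset.card_range] at this
    omega)
  have hpr := hC.proper hno
  have hα : 1 ≤ α ∧ α ≤ σ.reg 1 := by
    rcases hside with ⟨_, _, _, rfl, _⟩ | ⟨_, _, _, rfl, _⟩ <;> constructor <;> assumption
  have hβ : 1 ≤ β ∧ β ≤ σ.reg 1 := by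
    rcases hside with ⟨_, _, _, _, rfl⟩ | ⟨_, _, _, _, rfl⟩ <;> constructor <;> assumption
  have hcol : ∀ j, j ∈ S → 1 ≤ τ.arr 6 j ∧ τ.arr 6 j ≤ σ.reg 1 := by
    intro j hj
    by_cases hji : j = i
    · subst hji
      rcases hC.col_new with h | h <;> rw [h] <;> assumption
    · rcases hC.flip j hj hji with ⟨_, h⟩ | ⟨_, h⟩ <;> rw [h] <;> assumption
  refine ⟨h2, ⟨?_, fun j hj => ?_, fun j hj => ?_, fun j hj => ?_⟩⟩
  · rcases hside with ⟨_, rfl, rfl, _, _⟩ | ⟨_, rfl, rfl, _, _⟩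
    exacts [hpr.symm, hpr]
  · by_cases hjS : j ∈ S
    · exact (hcol j hjS).1
    · rw [hC.out j hjS]
      exact hc.pos j (lt_of_le_of_ne (by omega) fun h => hjS (h ▸ hC.mem))
  · by_cases hjS : j ∈ S
    · exact (hcol j hjS).2
    · rw [hC.out j hjS]
      exact hc.le j (lt_of_le_of_ne (by omega) fun h => hjS (h ▸ hC.mem))
  · have h0 := hc.zero j (by omega)
    have hjS : j ∉ S := by
      intro hjS
      have h0' : c₀ j = 0 := h0
      rcases hC.flip j hjS (by omega) with ⟨h, _⟩ | ⟨h, _⟩ <;> omega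
    rw [hC.out j hjS]; exact h0

/-- König's theorem in algorithmic form: the edges are inserted one by one. The colours in array `7`
are counted from zero, so that they can serve as column numbers. -/
theorem colouring_eval {u v : ℕ → ℕ} {σ : State} (hu : σ.arr 0 = u) (hv : σ.arr 2 = v)
    (h6 : ∀ j, σ.arr 6 j = 0)
    (hdu : ∀ i < σ.reg 2, ((Finset.range (σ.reg 2)).filter fun j => u j = u i).card ≤ σ.reg 1)
    (hdv : ∀ i < σ.reg 2, ((Finset.range (σ.reg 2)).filter fun j => v j = v i).card ≤ σ.reg 1) :
    ∃ τ, colouring.eval σ = τ ∧ (∀ y, y ≠ 6 → y ≠ 7 → τ.arr y = σ.arr y) ∧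
      (∀ j < σ.reg 2, τ.arr 7 j < σ.reg 1) ∧
      ∀ i < σ.reg 2, ∀ j < σ.reg 2, i ≠ j → τ.arr 7 i = τ.arr 7 j → u i ≠ u j ∧ v i ≠ v j := by
  refine ⟨_, rfl, ?_⟩
  set n := σ.reg 2 with hn
  have hw1 : insertEdge.writes 1 = false := by decide
  have hw2 : insertEdge.writes 2 = false := by decide
  obtain ⟨h1, h2, h3⟩ := iter_inv (f := fun k τ => insertEdge.eval (τ.setReg 3 k)) (N := n) (σ := σ)
    (fun k τ => (∀ y, y ≠ 6 → τ.arr y = σ.arr y) ∧ (τ.reg 1 = σ.reg 1 ∧ τ.reg 2 = n) ∧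
      Coloured n (σ.reg 1) u v k (τ.arr 6))
    ⟨fun _ _ => rfl, ⟨rfl, rfl⟩, ⟨fun i _ j _ _ h => absurd (h6 i) h, by simp, by simp, fun j _ => h6 j⟩⟩
    (by
      rintro k τ hk ⟨h1, ⟨h2, h2'⟩, h3⟩
      obtain ⟨ρ, g1, g2, g3⟩ := insertEdge_eval (σ := τ.setReg 3 k) (u := u) (v := v) (i := k)
        (by simpa [hu] using h1 0 (by decide)) (by simpa [hv] using h1 2 (by decide)) (by simp)
        (by simpa [h2'] using hk) (by simpa [h2, h2'] using hdu k hk)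
        (by simpa [h2, h2'] using hdv k hk) (by simpa [h2, h2'] using h3)
      refine ⟨fun y hy => ?_, ⟨?_, ?_⟩, ?_⟩
      · rw [g1, g2 y hy]; simpa using h1 y hy
      · rw [Stmt.eval_reg _ hw1]; simpa using h2
      · rw [Stmt.eval_reg _ hw2]; simpa using h2'
      · rw [g1]; simpa [h2, h2'] using g3)
  set τ := iter (fun k τ => insertEdge.eval (τ.setReg 3 k)) n σ with hτ
  have hrun : colouring.eval σ = iter (fun k τ => Stmt.eval
      (store 7 (reg 3) (sub (arr 6 (reg 3)) (lit 1))) (τ.setReg 3 k)) n τ := by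
    simp [colouring, ← hn, ← hτ, h2.2]
  rw [hrun]
  obtain ⟨g1, g2⟩ := iter_inv (f := fun k τ => Stmt.eval
      (store 7 (reg 3) (sub (arr 6 (reg 3)) (lit 1))) (τ.setReg 3 k)) (N := n) (σ := τ)
    (fun k ρ => (∀ y, y ≠ 7 → ρ.arr y = τ.arr y) ∧ ∀ j < k, ρ.arr 7 j = τ.arr 6 j - 1)
    ⟨fun _ _ => rfl, by simp⟩ (by
      rintro k ρ hk ⟨g1, g2⟩
      refine ⟨fun y hy => ?_, fun j hj => ?_⟩
      · funext l; simp [hy, g1 y hy]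
      · by_cases hjk : j = k
        · simp [hjk, g1 6 (by decide)]
        · simp [hjk, g2 j (by omega)])
  refine ⟨fun y y6 y7 => by rw [g1 y y7, h1 y y6], fun j hj => ?_, fun i hi j hj hij h => ?_⟩
  · have := h3.pos j hj
    have := h3.le j hj
    rw [g2 j hj]; omega
  · rw [g2 i hi, g2 j hj] at h
    have pi := h3.pos i hi
    have pj := h3.pos j hj
    exact h3.proper i hi j hj hij (by omega) (by omega)

end GridProgram

/-! ### One round of the routing: all blocks move in parallel -/

/-- First row of the block that contains row `x`; the topmost block has `2 + o` rows, the others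
have two. -/
def rowBase (o x : ℕ) : ℕ := if x < 2 + o then 0 else x - (x - o) % 2

/-- Number of rows of the block that contains row `x`. -/
def rowHeight (o x : ℕ) : ℕ := if x < 2 + o then 2 + o else 2

/-- Number of columns of a window that begins at column `b` of `L`. -/
def width (L b : ℕ) : ℕ := 4 - (b + 4 - L)

theorem rowBase_spec {W x : ℕ} (hW : 3 ≤ W) (hx : x < W) :
    rowBase (W % 2) x ≤ x ∧ x < rowBase (W % 2) x + rowHeight (W % 2) x ∧
      (rowHeight (W % 2) x = 2 ∨ rowHeight (W % 2) x = 3) ∧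
      rowBase (W % 2) x + rowHeight (W % 2) x ≤ W := by
  unfold rowBase rowHeight; split_ifs <;> omega

theorem rowBase_congr {o x y : ℕ} (h : rowBase o x ≤ y) (h' : y < rowBase o x + rowHeight o x) :
    rowBase o y = rowBase o x ∧ rowHeight o y = rowHeight o x := by
  unfold rowBase rowHeight at *; split_ifs at * <;> omega

open LineSort in
theorem base_spec {L r y : ℕ} (h : Active L r y) (hy : y < L) :
    base r y ≤ y ∧ y < base r y + width L (base r y) ∧
      (width L (base r y) = 3 ∨ width L (base r y) = 4) ∧ base r y + width L (base r y) ≤ L ∧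
      (width L (base r y) = 4 ∨ base r y + width L (base r y) = L) := by
  unfold Active at h; unfold width; unfold base at *; omega

open LineSort in
theorem base_congr {L r x y : ℕ} (h : Active L r x) (h1 : base r x ≤ y)
    (h2 : y < base r x + width L (base r x)) : base r y = base r x ∧ Active L r y := by
  unfold Active at *; unfold width at *; unfold base at *; omega

/-- The number of entries among four consecutive ones that are smaller than entry `q`. -/
def rankDigit (κ : ℕ → ℕ) (q : ℕ) : ℕ := ((Finset.range 4).filter fun j => κ (4 * (q / 4) + j) < κ q).card

theorem rankDigit_le (κ : ℕ → ℕ) (q : ℕ) : rankDigit κ q ≤ 4 :=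
  (Finset.card_filter_le _ _).trans (by simp)

/-- Columns that a narrow window lacks carry a mark not below `D`, hence larger than all keys, and
never count in the rank of an agent. -/
theorem rankDigit_lt {κ : ℕ → ℕ} {D a b w : ℕ} (hw : w ≤ 4) (h : ∀ c < w, κ (4 * a + c) < D)
    (h' : ∀ c < 4, w ≤ c → D ≤ κ (4 * a + c)) (hb : b < w) : rankDigit κ (4 * a + b) < w := by
  have : ((Finset.range 4).filter fun j => κ (4 * ((4 * a + b) / 4) + j) < κ (4 * a + b)) ⊆
      (Finset.range w).erase b := by
    intro j hj
    rw [Finset.mem_filter, Finset.mem_range, show (4 * a + b) / 4 = a by omega] at hj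
    rw [Finset.mem_erase, Finset.mem_range]
    refine ⟨fun e => ?_, ?_⟩
    · rw [e] at hj; exact lt_irrefl _ hj.2
    · by_contra hwj
      have := h' j hj.1 (by omega)
      have := h b hb
      omega
  have := Finset.card_le_card this
  rw [Finset.card_erase_of_mem (by simpa using hb), Finset.card_range] at this
  unfold rankDigit
  omega

theorem rankDigit_lt_iff {κ : ℕ → ℕ} {a b c : ℕ} (hb : b < 4) (hc : c < 4) :
    rankDigit κ (4 * a + b) < rankDigit κ (4 * a + c) ↔ κ (4 * a + b) < κ (4 * a + c) := by
  unfold rankDigit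
  rw [show (4 * a + b) / 4 = a by omega, show (4 * a + c) / 4 = a by omega]
  constructor
  · intro h
    by_contra hle
    refine absurd (Finset.card_le_card fun j hj => ?_) (not_le.2 h)
    rw [Finset.mem_filter] at hj ⊢
    exact ⟨hj.1, by omega⟩
  · intro h
    refine Finset.card_lt_card (Finset.ssubset_iff_of_subset (fun j hj => ?_) |>.2 ⟨b, ?_, ?_⟩)
    · rw [Finset.mem_filter] at hj ⊢
      exact ⟨hj.1, by omega⟩
    · simpa [hb] using h
    · simp

open Classical in
/-- A motion plan for a block, in which the agents of row `r` are sorted by the ranks `ρ r`, completely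
if `m = 0`, and otherwise into the first two columns and the others. -/
noncomputable def plan (m h w : ℕ) (ρ : ℕ → ℕ → ℕ) : ℕ → ℕ → ℕ :=
  if H : ((h = 2 ∨ h = 3) ∧ (w = 3 ∨ w = 4)) ∧ (∀ r < h, ∀ j < w, ρ r j < w) ∧
      ∀ r < h, ∀ j < w, ∀ i < w, ρ r j = ρ r i → j = i then
    if m = 0 then (BlockPlan.exists_full_plan H.1.1 H.1.2 ρ H.2.1 H.2.2).choose
    else (BlockPlan.exists_split_plan H.1.1 H.1.2 ρ H.2.1 H.2.2).choose
  else fun _ q => q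

/-- The duration `8 - 2 * m` covers both kinds: eight steps for a complete sort, six for a split. -/
theorem plan_spec {m h w : ℕ} (hm : m ≤ 1) (hh : h = 2 ∨ h = 3) (hw : w = 3 ∨ w = 4) {ρ : ℕ → ℕ → ℕ}
    (hρ : ∀ r < h, ∀ j < w, ρ r j < w)
    (inj : ∀ r < h, ∀ j < w, ∀ i < w, ρ r j = ρ r i → j = i) :
    BlockPlan.IsPlan h w (8 - 2 * m) (plan m h w ρ) ∧
    (∀ q < h * w, plan m h w ρ (8 - 2 * m) q / w = q / w ∧
      (plan m h w ρ (8 - 2 * m) q % w < 2 ↔ ρ (q / w) (q % w) < 2) ∧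
      (m = 0 → plan m h w ρ (8 - 2 * m) q % w = ρ (q / w) (q % w))) := by
  have H : ((h = 2 ∨ h = 3) ∧ (w = 3 ∨ w = 4)) ∧ (∀ r < h, ∀ j < w, ρ r j < w) ∧
      ∀ r < h, ∀ j < w, ∀ i < w, ρ r j = ρ r i → j = i := ⟨⟨hh, hw⟩, hρ, inj⟩
  unfold plan
  rw [dif_pos H]
  by_cases h0 : m = 0
  · rw [if_pos h0]
    subst h0
    obtain ⟨h1, h2⟩ := (BlockPlan.exists_full_plan H.1.1 H.1.2 ρ H.2.1 H.2.2).choose_spec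
    refine ⟨h1, fun q hq => ?_⟩
    have hw0 : 0 < w := by omega
    have hlt := hρ (q / w) (Nat.div_lt_of_lt_mul (by rwa [mul_comm] at hq)) (q % w) (Nat.mod_lt _ hw0)
    rw [show 8 - 2 * 0 = 8 from rfl, h2 q hq, Nat.mul_add_div hw0, Nat.div_eq_of_lt hlt,
      Nat.mul_add_mod, Nat.mod_eq_of_lt hlt]
    simp
  · rw [if_neg h0]
    obtain rfl : m = 1 := by omega
    obtain ⟨h1, h2⟩ := (BlockPlan.exists_split_plan H.1.1 H.1.2 ρ H.2.1 H.2.2).choose_spec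
    exact ⟨h1, fun q hq => ⟨(h2 q hq).1, (h2 q hq).2, by simp⟩⟩

/-- The data of a round: the positions `(X i, Y i)` of the `n` agents in a `W × L` grid, their keys,
the number of the round, and its kind `m` (`0` for complete sorting of the windows). The number `D`
marks cells without agent. -/
structure Snapshot where
  (n W L r m D : ℕ)
  (X Y key : ℕ → ℕ)

theorem near_iff {w a b : ℕ} (hw : w = 3 ∨ w = 4) (h : BlockPlan.near w a b = true) :
    a / w = b / w ∧ (a % w = b % w ∨ a % w + 1 = b % w ∨ b % w + 1 = a % w) ∨
      a % w = b % w ∧ (a / w + 1 = b / w ∨ b / w + 1 = a / w) := by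
  simp only [BlockPlan.near, Bool.or_eq_true, Bool.and_eq_true, Nat.beq_eq] at h
  rcases hw with rfl | rfl <;> omega

namespace Snapshot

/-- The conditions under which a round works. -/
structure Good (S : Snapshot) : Prop where
  three_le : 3 ≤ S.W
  kind : S.m ≤ 1
  mark : S.L ≤ S.D
  card : S.n = S.W * S.L
  ltX : ∀ i < S.n, S.X i < S.W
  ltY : ∀ i < S.n, S.Y i < S.L
  inj : ∀ i < S.n, ∀ j < S.n, S.X i = S.X j → S.Y i = S.Y j → i = j
  key_lt : ∀ i < S.n, S.key i < S.L
  key_inj : ∀ i < S.n, ∀ j < S.n, S.X i = S.X j → S.key i = S.key j → i = j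

/-- Fullness of the grid: an injective placement of as many agents as cells is onto. -/
theorem exists_agent {n W L : ℕ} {X Y : ℕ → ℕ} (card : n = W * L) (ltX : ∀ i < n, X i < W)
    (ltY : ∀ i < n, Y i < L) (inj : ∀ i < n, ∀ j < n, X i = X j → Y i = Y j → i = j)
    {x y : ℕ} (hx : x < W) (hy : y < L) : ∃ i < n, X i = x ∧ Y i = y := by
  have hinj : Function.Injective fun i : Fin n =>
      ((⟨X i, ltX i i.2⟩, ⟨Y i, ltY i i.2⟩) : Fin W × Fin L) := by
    intro i j h
    simp only [Prod.mk.injEq, Fin.mk.injEq] at h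
    exact Fin.ext (inj i i.2 j j.2 h.1 h.2)
  obtain ⟨i, hi⟩ := (hinj.bijective_of_nat_card_le (by simp [card])).2 (⟨x, hx⟩, ⟨y, hy⟩)
  simp only [Prod.mk.injEq, Fin.mk.injEq] at hi
  exact ⟨i, i.2, hi⟩

variable (S : Snapshot)

open Classical in
/-- The key of the agent in cell `q` of the block at `(a, b)`, cells being numbered row by row with
four cells in each row. -/
noncomputable def cellKey (a b q : ℕ) : ℕ :=
  if h : ∃ j < S.n, (a ≤ S.X j ∧ b ≤ S.Y j ∧ S.Y j < b + 4) ∧ 4 * (S.X j - a) + (S.Y j - b) = q then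
    S.key h.choose
  else S.D

/-- First row of the block of agent `i`. -/
def xb (i : ℕ) : ℕ := rowBase (S.W % 2) (S.X i)
/-- Height of the block of agent `i`. -/
def ht (i : ℕ) : ℕ := rowHeight (S.W % 2) (S.X i)
/-- First column of the block of agent `i`. -/
def yb (i : ℕ) : ℕ := LineSort.base S.r (S.Y i)
/-- Width of the block of agent `i`. -/
def wd (i : ℕ) : ℕ := width S.L (S.yb i)

/-- The ranks of the agents of a block, cell by cell. -/
noncomputable def digits (i : ℕ) : List ℕ :=
  (List.range 12).map (rankDigit (S.cellKey (S.xb i) (S.yb i)))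

/-- The ranks of the agents of a block, by row and column. -/
noncomputable def rank (i : ℕ) (a b : ℕ) : ℕ := (S.digits i).getD (4 * a + b) 0

/-- The cell of agent `i` in its block. -/
def cell (i : ℕ) : ℕ := S.wd i * (S.X i - S.xb i) + (S.Y i - S.yb i)

/-- The cell of agent `i` in its block after `s` steps. -/
noncomputable def newCell (s i : ℕ) : ℕ :=
  plan S.m (S.ht i) (S.wd i) (S.rank i) (min s (8 - 2 * S.m)) (S.cell i)

open Classical in
/-- Row of agent `i` after `s` steps. -/
noncomputable def newX (s i : ℕ) : ℕ :=
  if LineSort.Active S.L S.r (S.Y i) then S.xb i + S.newCell s i / S.wd i else S.X i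

open Classical in
/-- Column of agent `i` after `s` steps. -/
noncomputable def newY (s i : ℕ) : ℕ :=
  if LineSort.Active S.L S.r (S.Y i) then S.yb i + S.newCell s i % S.wd i else S.Y i

variable {S} (G : S.Good)
include G

/-- Columns of the block differ by less than four, so the number `4 * row + column` determines the
cell, and agents have distinct cells; the choice in `cellKey` is therefore forced. -/
theorem Good.cellKey_agent {a b j : ℕ} (hj : j < S.n) (h : a ≤ S.X j ∧ b ≤ S.Y j ∧ S.Y j < b + 4) :
    S.cellKey a b (4 * (S.X j - a) + (S.Y j - b)) = S.key j := by
  have H : ∃ i < S.n, (a ≤ S.X i ∧ b ≤ S.Y i ∧ S.Y i < b + 4) ∧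
    4 * (S.X i - a) + (S.Y i - b) = 4 * (S.X j - a) + (S.Y j - b) := ⟨j, hj, h, rfl⟩
  unfold cellKey
  rw [dif_pos H]
  obtain ⟨h1, h2, h3⟩ := H.choose_spec
  congr 1
  exact G.inj _ h1 _ hj (by omega) (by omega)

omit G in
theorem cellKey_mark {a b q : ℕ}
    (h : ∀ j < S.n, a ≤ S.X j ∧ b ≤ S.Y j ∧ S.Y j < b + 4 → 4 * (S.X j - a) + (S.Y j - b) ≠ q) :
    S.cellKey a b q = S.D := by
  unfold cellKey
  rw [dif_neg]
  rintro ⟨j, h1, h2, h3⟩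
  exact h j h1 h2 h3

theorem Good.block {i : ℕ} (hi : i < S.n) (hA : LineSort.Active S.L S.r (S.Y i)) :
    (S.xb i ≤ S.X i ∧ S.X i < S.xb i + S.ht i ∧ (S.ht i = 2 ∨ S.ht i = 3) ∧ S.xb i + S.ht i ≤ S.W) ∧
    S.yb i ≤ S.Y i ∧ S.Y i < S.yb i + S.wd i ∧ (S.wd i = 3 ∨ S.wd i = 4) ∧ S.yb i + S.wd i ≤ S.L ∧
      (S.wd i = 4 ∨ S.yb i + S.wd i = S.L) :=
  ⟨rowBase_spec G.three_le (G.ltX i hi), base_spec hA (G.ltY i hi)⟩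

/-- Every cell of the block holds an agent, and agents of one line have different keys. Hence the
ranks permute the columns of each row and reflect the order of the keys; these are the conditions
under which `plan` is meaningful. -/
theorem Good.rank_spec {i : ℕ} (hi : i < S.n) (hA : LineSort.Active S.L S.r (S.Y i)) :
    (∀ a < S.ht i, ∀ b < S.wd i, S.rank i a b < S.wd i) ∧
    (∀ a < S.ht i, ∀ b < S.wd i, ∀ c < S.wd i, S.rank i a b = S.rank i a c → b = c) ∧
    ∀ j < S.n, ∀ k < S.n, S.X j = S.X k → S.xb i ≤ S.X j → S.X j < S.xb i + S.ht i →
      S.yb i ≤ S.Y j → S.Y j < S.yb i + S.wd i → S.yb i ≤ S.Y k → S.Y k < S.yb i + S.wd i →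
      S.rank i (S.X j - S.xb i) (S.Y j - S.yb i) < S.rank i (S.X k - S.xb i) (S.Y k - S.yb i) →
      S.key j < S.key k := by
  obtain ⟨⟨-, -, hh, hW⟩, -, -, hw, hL, hw'⟩ := G.block hi hA
  set κ := S.cellKey (S.xb i) (S.yb i) with hκ
  have hrank : ∀ a < S.ht i, ∀ b < S.wd i, S.rank i a b = rankDigit κ (4 * a + b) := by
    intro a ha b hb
    have : 4 * a + b < 12 := by omega
    rw [rank, digits, List.getD_eq_getElem?_getD, List.getElem?_map, List.getElem?_range this]
    rfl
  have hcell : ∀ a < S.ht i, ∀ b < S.wd i, ∃ j < S.n, S.X j = S.xb i + a ∧ S.Y j = S.yb i + b ∧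
      κ (4 * a + b) = S.key j := by
    intro a ha b hb
    obtain ⟨j, hj, hx, hy⟩ := exists_agent G.card G.ltX G.ltY G.inj
      (x := S.xb i + a) (y := S.yb i + b) (by omega) (by omega)
    refine ⟨j, hj, hx, hy, ?_⟩
    rw [← G.cellKey_agent (a := S.xb i) (b := S.yb i) hj (by omega), hx, hy]
    simp [hκ]
  have hlt : ∀ a < S.ht i, ∀ b < S.wd i, κ (4 * a + b) < S.D := by
    intro a ha b hb
    obtain ⟨j, hj, -, -, h⟩ := hcell a ha b hb
    rw [h]
    exact (G.key_lt j hj).trans_le G.mark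
  -- A window of width three ends at the end of the line, so a fourth column would lie outside the
  -- grid.
  have hge : ∀ a < S.ht i, ∀ b < 4, S.wd i ≤ b → S.D ≤ κ (4 * a + b) := by
    intro a ha b hb hwb
    refine (cellKey_mark fun j hj h => ?_).ge
    have := G.ltY j hj
    omega
  refine ⟨fun a ha b hb => ?_, fun a ha b hb c hc h => ?_, ?_⟩
  · rw [hrank a ha b hb]
    exact rankDigit_lt (by omega) (hlt a ha) (hge a ha) hb
  · rw [hrank a ha b hb, hrank a ha c hc] at h
    have h1 := (rankDigit_lt_iff (κ := κ) (a := a) (b := b) (c := c) (by omega) (by omega))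
    have h2 := (rankDigit_lt_iff (κ := κ) (a := a) (b := c) (c := b) (by omega) (by omega))
    obtain ⟨j, hj, hjx, hjy, ej⟩ := hcell a ha b hb
    obtain ⟨k, hk, hkx, hky, ek⟩ := hcell a ha c hc
    have := G.key_inj j hj k hk (by omega) (by omega)
    subst this
    omega
  · intro j hj k hk hx hx1 hx2 hy1 hy2 hy3 hy4 h
    rw [hrank (S.X j - S.xb i) (by omega) (S.Y j - S.yb i) (by omega),
      hrank (S.X k - S.xb i) (by omega) (S.Y k - S.yb i) (by omega),
      ← hx, rankDigit_lt_iff (a := S.X j - S.xb i) (b := S.Y j - S.yb i) (c := S.Y k - S.yb i)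
        (by omega) (by omega)] at h
    have ej : κ _ = _ := G.cellKey_agent (a := S.xb i) (b := S.yb i) hj (by omega)
    have ek : κ _ = _ := G.cellKey_agent (a := S.xb i) (b := S.yb i) hk (by omega)
    rw [← hx] at ek
    rwa [ej, ek] at h

theorem Good.isPlan {i : ℕ} (hi : i < S.n) (hA : LineSort.Active S.L S.r (S.Y i)) :
    BlockPlan.IsPlan (S.ht i) (S.wd i) (8 - 2 * S.m)
      (plan S.m (S.ht i) (S.wd i) (S.rank i)) ∧
    (∀ q < S.ht i * S.wd i,
      plan S.m (S.ht i) (S.wd i) (S.rank i) (8 - 2 * S.m) q / S.wd i = q / S.wd i ∧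
      (plan S.m (S.ht i) (S.wd i) (S.rank i) (8 - 2 * S.m) q % S.wd i < 2 ↔
        S.rank i (q / S.wd i) (q % S.wd i) < 2) ∧
      (S.m = 0 → plan S.m (S.ht i) (S.wd i) (S.rank i) (8 - 2 * S.m) q % S.wd i =
        S.rank i (q / S.wd i) (q % S.wd i))) := by
  obtain ⟨⟨-, -, hh, -⟩, -, -, hw, -⟩ := G.block hi hA
  obtain ⟨h1, h2, -⟩ := G.rank_spec hi hA
  exact plan_spec G.kind hh hw h1 h2

theorem Good.cell_spec {i : ℕ} (hi : i < S.n) (hA : LineSort.Active S.L S.r (S.Y i)) :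
    S.cell i < S.ht i * S.wd i ∧ S.cell i / S.wd i = S.X i - S.xb i ∧
      S.cell i % S.wd i = S.Y i - S.yb i := by
  obtain ⟨⟨hx1, hx2, hh, -⟩, hy1, hy2, hw, -⟩ := G.block hi hA
  have hq : S.Y i - S.yb i < S.wd i := by omega
  unfold cell
  refine ⟨?_, ?_, ?_⟩
  · rcases hw with hw | hw <;> rw [hw] at hq ⊢ <;> omega
  · rw [Nat.mul_add_div (by omega), Nat.div_eq_of_lt hq, add_zero]
  · rw [Nat.mul_add_mod, Nat.mod_eq_of_lt hq]

theorem Good.newCell_lt {i : ℕ} (hi : i < S.n) (hA : LineSort.Active S.L S.r (S.Y i)) (s : ℕ) :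
    S.newCell s i / S.wd i < S.ht i ∧ S.newCell s i % S.wd i < S.wd i := by
  obtain ⟨-, -, -, hw, -⟩ := G.block hi hA
  refine ⟨Nat.div_lt_of_lt_mul ?_, Nat.mod_lt _ (by omega)⟩
  rw [mul_comm]
  exact (G.isPlan hi hA).1.bound _ (min_le_right _ _) _ (G.cell_spec hi hA).1

/-- Moving agents stay in their blocks. -/
theorem Good.stay {i : ℕ} (hi : i < S.n) (s : ℕ) :
    (LineSort.Active S.L S.r (S.newY s i) ↔ LineSort.Active S.L S.r (S.Y i)) ∧
    (LineSort.Active S.L S.r (S.Y i) → rowBase (S.W % 2) (S.newX s i) = S.xb i ∧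
      rowHeight (S.W % 2) (S.newX s i) = S.ht i ∧ LineSort.base S.r (S.newY s i) = S.yb i) := by
  by_cases hA : LineSort.Active S.L S.r (S.Y i)
  · obtain ⟨h1, h2⟩ := G.newCell_lt hi hA s
    have hx := rowBase_congr (o := S.W % 2) (x := S.X i) (y := S.xb i + S.newCell s i / S.wd i)
      (Nat.le_add_right _ _) (Nat.add_lt_add_left h1 _)
    have hy := base_congr hA (y := S.yb i + S.newCell s i % S.wd i)
      (Nat.le_add_right _ _) (Nat.add_lt_add_left h2 _)
    simp only [newX, newY, hA, if_true, iff_true, true_implies]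
    exact ⟨hy.2, hx.1, hx.2, hy.1⟩
  · simp [newY, hA]

theorem Good.newX_lt {i : ℕ} (hi : i < S.n) (s : ℕ) : S.newX s i < S.W := by
  unfold newX
  split_ifs with hA
  · have := (G.newCell_lt hi hA s).1
    have := (G.block hi hA).1.2.2.2
    omega
  · exact G.ltX i hi

theorem Good.newY_lt {i : ℕ} (hi : i < S.n) (s : ℕ) : S.newY s i < S.L := by
  unfold newY
  split_ifs with hA
  · have := (G.newCell_lt hi hA s).2
    have := (G.block hi hA).2.2.2.2.1
    omega
  · exact G.ltY i hi

omit G in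
theorem digits_congr {i j : ℕ} (hx : S.xb i = S.xb j) (hy : S.yb i = S.yb j) :
    S.rank i = S.rank j := by
  funext a b; simp only [rank, digits, hx, hy]

/-- Two agents one of which comes to a place where the other one has been are in the same block. -/
theorem Good.same_block {i j s t : ℕ} (hi : i < S.n) (hj : j < S.n) (hx : S.newX s i = S.newX t j)
    (hy : S.newY s i = S.newY t j) :
    (LineSort.Active S.L S.r (S.Y i) ↔ LineSort.Active S.L S.r (S.Y j)) ∧
    (LineSort.Active S.L S.r (S.Y i) → S.xb i = S.xb j ∧ S.ht i = S.ht j ∧ S.yb i = S.yb j ∧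
      S.wd i = S.wd j ∧ S.rank i = S.rank j ∧ S.newCell s i = S.newCell t j) := by
  obtain ⟨a1, b1⟩ := G.stay hi s
  obtain ⟨a2, b2⟩ := G.stay hj t
  have hA : LineSort.Active S.L S.r (S.Y i) ↔ LineSort.Active S.L S.r (S.Y j) := by
    rw [← a1, ← a2, hy]
  refine ⟨hA, fun h => ?_⟩
  obtain ⟨c1, c2, c3⟩ := b1 h
  obtain ⟨d1, d2, d3⟩ := b2 (hA.1 h)
  have ex : S.xb i = S.xb j := by rw [← c1, ← d1, hx]
  have ey : S.yb i = S.yb j := by rw [← c3, ← d3, hy]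
  have ew : S.wd i = S.wd j := by rw [wd, wd, ey]
  refine ⟨ex, by rw [← c2, ← d2, hx], ey, ew, digits_congr ex ey, ?_⟩
  simp only [newX, newY, if_pos h, if_pos (hA.1 h), ex, ey, ew, Nat.add_left_cancel_iff] at hx hy
  rw [← Nat.div_add_mod (S.newCell s i) (S.wd j), hx, hy, Nat.div_add_mod]

theorem Good.eq_of_cell {i j : ℕ} (hi : i < S.n) (hj : j < S.n)
    (hA : LineSort.Active S.L S.r (S.Y i)) (hA' : LineSort.Active S.L S.r (S.Y j))
    (hx : S.xb i = S.xb j) (hy : S.yb i = S.yb j) (h : S.cell i = S.cell j) : i = j := by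
  obtain ⟨-, h1, h2⟩ := G.cell_spec hi hA
  obtain ⟨-, g1, g2⟩ := G.cell_spec hj hA'
  have ew : S.wd i = S.wd j := by rw [wd, wd, hy]
  rw [h, ew] at h1 h2
  have := (G.block hi hA).1.1
  have := (G.block hj hA').1.1
  have := (G.block hi hA).2.1
  have := (G.block hj hA').2.1
  exact G.inj i hi j hj (by omega) (by omega)

/-- Moving agents stay in their blocks and idle ones outside of all blocks, so a collision could
only happen between agents of one block, where the plan excludes it. -/
theorem Good.new_inj {i j s : ℕ} (hi : i < S.n) (hj : j < S.n) (hx : S.newX s i = S.newX s j)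
    (hy : S.newY s i = S.newY s j) : i = j := by
  obtain ⟨hA, h⟩ := G.same_block hi hj hx hy
  by_cases hAi : LineSort.Active S.L S.r (S.Y i)
  · obtain ⟨e1, e2, e3, e4, e5, e6⟩ := h hAi
    refine G.eq_of_cell hi hj hAi (hA.1 hAi) e1 e3 ?_
    have hj' := (G.cell_spec hj (hA.1 hAi)).1
    rw [← e2, ← e4] at hj'
    refine (G.isPlan hi hAi).1.inj _ (min_le_right s _) _ (G.cell_spec hi hAi).1 _ hj' ?_
    rw [newCell, newCell, ← e2, ← e4, ← e5] at e6
    exact e6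
  · simp only [newX, newY, if_neg hAi, if_neg fun h => hAi (hA.2 h)] at hx hy
    exact G.inj i hi j hj hx hy

theorem Good.new_zero {i : ℕ} (hi : i < S.n) : S.newX 0 i = S.X i ∧ S.newY 0 i = S.Y i := by
  unfold newX newY
  split_ifs with hA
  · obtain ⟨h0, h1, h2⟩ := G.cell_spec hi hA
    have := (G.block hi hA).1.1
    have := (G.block hi hA).2.1
    rw [newCell, Nat.zero_min, (G.isPlan hi hA).1.init _ h0, h1, h2]
    omega
  · exact ⟨rfl, rfl⟩

theorem Good.new_move {i s : ℕ} (hi : i < S.n) (hs : s < 8 - 2 * S.m) :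
    S.newX s i = S.newX (s + 1) i ∧ (S.newY s i = S.newY (s + 1) i ∨
        S.newY s i + 1 = S.newY (s + 1) i ∨ S.newY (s + 1) i + 1 = S.newY s i) ∨
      S.newY s i = S.newY (s + 1) i ∧
        (S.newX s i + 1 = S.newX (s + 1) i ∨ S.newX (s + 1) i + 1 = S.newX s i) := by
  unfold newX newY
  split_ifs with hA
  · have h := (G.isPlan hi hA).1.move s hs _ (G.cell_spec hi hA).1
    have := near_iff (G.block hi hA).2.2.2.1 h
    simp only [newCell]
    rw [min_eq_left hs.le, min_eq_left (show s + 1 ≤ 8 - 2 * S.m from hs)]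
    omega
  · simp

theorem Good.new_noswap {i j s : ℕ} (hi : i < S.n) (hj : j < S.n) (hij : i ≠ j)
    (hs : s < 8 - 2 * S.m) (h1 : S.newX s i = S.newX (s + 1) j) (h2 : S.newY s i = S.newY (s + 1) j)
    (h3 : S.newX s j = S.newX (s + 1) i) (h4 : S.newY s j = S.newY (s + 1) i) : False := by
  obtain ⟨hA, h⟩ := G.same_block hi hj h1 h2
  by_cases hAi : LineSort.Active S.L S.r (S.Y i)
  · obtain ⟨e1, e2, e3, e4, e5, e6⟩ := h hAi
    obtain ⟨-, -, -, -, -, e7⟩ := (G.same_block hj hi h3 h4).2 (hA.1 hAi)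
    have hj' := (G.cell_spec hj (hA.1 hAi)).1
    rw [← e2, ← e4] at hj'
    rw [newCell, newCell, ← e2, ← e4, ← e5, min_eq_left hs.le,
      min_eq_left (show s + 1 ≤ 8 - 2 * S.m from hs)] at e6 e7
    exact (G.isPlan hi hAi).1.noswap s hs _ (G.cell_spec hi hAi).1 _ hj'
      (fun hc => hij (G.eq_of_cell hi hj hAi (hA.1 hAi) e1 e3 hc)) ⟨e6, e7⟩
  · have hAj : ¬ LineSort.Active S.L S.r (S.Y j) := fun h => hAi (hA.2 h)
    simp only [newX, newY, if_neg hAi, if_neg hAj] at h1 h2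
    exact hij (G.inj i hi j hj h1 h2)

/-- After the last step of a round, the agents are back in their rows. -/
theorem Good.newX_last {i : ℕ} (hi : i < S.n) : S.newX (8 - 2 * S.m) i = S.X i := by
  unfold newX
  split_ifs with hA
  · obtain ⟨h0, h1, -⟩ := G.cell_spec hi hA
    rw [newCell, min_self, ((G.isPlan hi hA).2 _ h0).1, h1]
    have := (G.block hi hA).1.1
    omega
  · rfl

omit G in
theorem newY_idle {i s : ℕ} (hA : ¬ LineSort.Active S.L S.r (S.Y i)) : S.newY s i = S.Y i := by
  rw [newY, if_neg hA]

theorem Good.newY_window {i s : ℕ} (hi : i < S.n) (hA : LineSort.Active S.L S.r (S.Y i)) :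
    LineSort.base S.r (S.Y i) ≤ S.newY s i ∧ S.newY s i < LineSort.base S.r (S.Y i) + 4 := by
  have h1 := (G.newCell_lt hi hA s).2
  have h2 := (G.block hi hA).2.2.2.1
  rw [newY, if_pos hA]
  unfold yb at *
  omega

/-- Final columns are compared through ranks, and ranks through keys. After a split only the half of
the window is known, whence the columns divided by two. -/
theorem Good.newY_lt_newY {i j : ℕ} (hi : i < S.n) (hj : j < S.n)
    (hA : LineSort.Active S.L S.r (S.Y i)) (hA' : LineSort.Active S.L S.r (S.Y j))
    (hx : S.X i = S.X j) (hy : LineSort.base S.r (S.Y i) = LineSort.base S.r (S.Y j))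
    (h : S.newY (8 - 2 * S.m) i / 2 < S.newY (8 - 2 * S.m) j / 2 ∨
      S.m = 0 ∧ S.newY (8 - 2 * S.m) i < S.newY (8 - 2 * S.m) j) : S.key i < S.key j := by
  have ex : S.xb i = S.xb j := by rw [xb, xb, hx]
  have ey : S.yb i = S.yb j := hy
  have ew : S.wd i = S.wd j := by rw [wd, wd, ey]
  obtain ⟨h0, h1, h2⟩ := G.cell_spec hi hA
  obtain ⟨g0, g1, g2⟩ := G.cell_spec hj hA'
  obtain ⟨-, f1, f2⟩ := (G.isPlan hi hA).2 _ h0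
  obtain ⟨-, k1, k2⟩ := (G.isPlan hj hA').2 _ g0
  obtain ⟨⟨b1, b2, -⟩, b3, b4, b5, -⟩ := G.block hi hA
  obtain ⟨⟨c1, c2, -⟩, c3, c4, c5, -⟩ := G.block hj hA'
  have hr := (G.rank_spec hi hA).2.2 i hi j hj hx b1 b2 b3 b4 (by omega) (by omega)
  rw [h1, h2] at f1 f2
  rw [g1, g2, ← digits_congr ex ey] at k1 k2
  rw [← hx, ← ex, ← ey] at k1 k2
  rw [← hx] at hr
  refine hr ?_
  -- A block begins at an even column, so its first two columns form a cell of the line.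
  have even : S.yb i % 2 = 0 := by unfold yb LineSort.base; omega
  have l1 := (G.newCell_lt hi hA (8 - 2 * S.m)).2
  have l2 := (G.newCell_lt hj hA' (8 - 2 * S.m)).2
  simp only [newY, if_pos hA, if_pos hA', newCell, min_self] at h l1 l2
  rw [← digits_congr ex ey] at h l2
  rw [← ey] at h
  rcases h with h | ⟨hm, h⟩
  · omega
  · rw [f2 hm, k2 hm] at h
    omega

end Snapshot

/-! ### Encoding of digit lists -/

namespace LoopLang.Expr

/-- truth value -/
def ind (e : Expr) : Expr := not (not e)

theorem ind_eval (e : Expr) (σ : RAM.State) : (ind e).eval σ = if e.eval σ = 0 then 0 else 1 := by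
  by_cases h : e.eval σ = 0 <;> simp [ind, not, h]; omega

@[simp] theorem ind_ok (e : Expr) : (ind e).ok = e.ok := by simp [ind]

/-- multiplication by two -/
def double (e : Expr) : Expr := add e e

@[simp] theorem double_eval (e : Expr) (σ : RAM.State) : (double e).eval σ = 2 * e.eval σ := by
  simp [double]; omega

@[simp] theorem double_ok (e : Expr) : (double e).ok = e.ok := by simp [double]

/-- The value of a list of hexadecimal digits. -/
def encode (l : List Expr) : Expr :=
  l.foldl (fun c d => add (double (double (double (double c)))) d) (lit 0)

end LoopLang.Expr

/-- The number with hexadecimal digits `l`, leading digit first. -/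
def encode (l : List ℕ) : ℕ := l.foldl (fun c d => 16 * c + d) 0

theorem encode_concat (l : List ℕ) (d : ℕ) : encode (l ++ [d]) = 16 * encode l + d := by
  simp [encode]

theorem encode_inj {l l' : List ℕ} (hl : l.length = l'.length) (h : ∀ d ∈ l, d < 16)
    (h' : ∀ d ∈ l', d < 16) (e : encode l = encode l') : l = l' := by
  induction l using List.reverseRecOn generalizing l' with
  | nil => exact (List.eq_nil_of_length_eq_zero hl.symm).symm
  | append_singleton l d ih =>
    rcases List.eq_nil_or_concat' l' with rfl | ⟨k, c, rfl⟩
    · simp at hl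
    · rw [encode_concat, encode_concat] at e
      have h1 := h d (by simp)
      have h2 := h' c (by simp)
      rw [ih (l' := k) (by simpa using hl) (fun x hx => h x (by simp [hx]))
        (fun x hx => h' x (by simp [hx])) (by omega), show d = c by omega]

theorem encode_lt {l : List ℕ} (h : ∀ d ∈ l, d < 16) : encode l < 16 ^ l.length := by
  induction l using List.reverseRecOn with
  | nil => simp [encode]
  | append_singleton l d ih =>
    have := ih fun x hx => h x (by simp [hx])
    have := h d (by simp)
    rw [encode_concat, List.length_append, List.length_singleton, pow_succ]
    omega

namespace LoopLang.Expr

theorem encode_eval (l : List Expr) (σ : RAM.State) :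
    (encode l).eval σ = _root_.encode (l.map fun e => e.eval σ) := by
  induction l using List.reverseRecOn with
  | nil => rfl
  | append_singleton l d ih =>
    rw [List.map_append, List.map_singleton, encode_concat, ← ih]
    simp [encode]; omega

theorem encode_ok {l : List Expr} (h : ∀ e ∈ l, e.ok = true) : (encode l).ok = true := by
  induction l using List.reverseRecOn with
  | nil => rfl
  | append_singleton l d ih =>
    have h1 := ih fun e he => h e (by simp [he])
    have h2 := h d (by simp)
    simp only [encode] at h1
    simp [encode, h1, h2]

end LoopLang.Expr

namespace GridProgram

open RAM LoopLang
open LoopLang.Expr (reg lit arr add sub ne eq lt le not and or ind double)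
open LoopLang.Stmt (set store rep repc when seqs)

/-! ### Tables of motion plans -/

/-- The lists that occur as arguments of the tables. -/
def IsKey (l : List ℕ) : Prop := l.length = 18 ∧ ∀ d ∈ l, d < 16

/-- The cell that an agent reaches according to its motion plan; the entries of `l` are the number of
the step, column and row of the agent in its block, the kind of the round, width and height of the
block, and the ranks of the agents in the block. -/
noncomputable def target (l : List ℕ) : ℕ :=
  plan (l.getD 3 0) (l.getD 5 0) (l.getD 4 0) (fun a b => l.getD (4 * a + b + 6) 0)
    (min (l.getD 0 0 + 1) (8 - 2 * l.getD 3 0)) (l.getD 4 0 * l.getD 2 0 + l.getD 1 0)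

open Classical in
/-- The table of a function of digit lists. -/
noncomputable def table (f : List ℕ → ℕ) (N : ℕ) : ℕ :=
  if H : ∃ l, IsKey l ∧ encode l = N then f H.choose else 0

theorem table_encode (f : List ℕ → ℕ) {l : List ℕ} (hl : IsKey l) : table f (encode l) = f l := by
  have H : ∃ k, IsKey k ∧ encode k = encode l := ⟨l, hl, rfl⟩
  rw [table, dif_pos H]
  obtain ⟨h1, h2⟩ := H.choose_spec
  rw [encode_inj (h1.1.trans hl.1.symm) h1.2 hl.2 h2]

/-- Store the first `B` values of `f` in array `a`. -/
def loadTable (a : ℕ) (f : ℕ → ℕ) : ℕ → Stmt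
  | 0 => .skip
  | B + 1 => .seq (loadTable a f B) (store a (lit B) (lit (f B)))

theorem loadTable_eval (a : ℕ) (f : ℕ → ℕ) (B : ℕ) (σ : State) :
    ((loadTable a f B).eval σ).reg = σ.reg ∧
      (∀ b, b ≠ a → ((loadTable a f B).eval σ).arr b = σ.arr b) ∧
      ∀ N < B, ((loadTable a f B).eval σ).arr a N = f N := by
  induction B with
  | zero => simp [loadTable]
  | succ B ih =>
    refine ⟨ih.1, fun b hb => ?_, fun N hN => ?_⟩
    · funext k; simp [loadTable, hb, ih.2.1 b hb]
    · by_cases h : N = B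
      · simp [loadTable, h]
      · simp [loadTable, h, ih.2.2 N (by omega)]

theorem loadTable_ok (a : ℕ) (f : ℕ → ℕ) (B : ℕ) : (loadTable a f B).ok = true := by
  induction B with
  | zero => rfl
  | succ B ih => simp [loadTable, ih]

/-! ### The program of a round

Registers `W` and `L` hold the numbers of lines and of places in each line, arrays `X` and `Y` the
lines and places of the agents at all times, array `K` the keys. Register `20` holds the offset of
the current time in these arrays, register `14` the kind of the round, register `13` the parity of
its number. Arrays `13` and `14` hold the numbers `v % 2` and `4 * (v / 4)`, arrays `10` and `11` the
motion plans. -/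

/-- Find the block of the agent `reg 16`. -/
def locate (W L X Y : ℕ) : Stmt :=
  seqs [
    set 17 (arr X (add (reg 20) (reg 16))),
    set 18 (arr Y (add (reg 20) (reg 16))),
    .ite (lt (reg 17) (add (lit 2) (arr 13 (reg W))))
      (seqs [set 19 (lit 0), set 22 (add (lit 2) (arr 13 (reg W)))])
      (seqs [set 19 (sub (reg 17) (arr 13 (sub (reg 17) (arr 13 (reg W))))), set 22 (lit 2)]),
    set 23 (add (arr 14 (sub (reg 18) (double (reg 13)))) (double (reg 13))),
    set 24 (sub (lit 4) (sub (add (reg 23) (lit 4)) (reg L))),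
    set 26 (add (reg 20) (reg 16))]

/-- Put the keys of the agents of the block into array `12`. -/
def gather (X Y K : ℕ) : Stmt :=
  seqs [
    repc 25 12 (store 12 (reg 25) (add (reg 0) (reg 1))),
    rep 25 2 (when
      (and (and (le (reg 19) (arr X (add (reg 20) (reg 25))))
        (le (reg 23) (arr Y (add (reg 20) (reg 25)))))
        (lt (arr Y (add (reg 20) (reg 25))) (add (reg 23) (lit 4))))
      (store 12 (add (double (double (sub (arr X (add (reg 20) (reg 25))) (reg 19))))
        (sub (arr Y (add (reg 20) (reg 25))) (reg 23))) (arr K (reg 25))))]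

/-- The rank of the agent in cell `q` of the block. -/
def rankExpr (q : ℕ) : Expr :=
  add (add (ind (lt (arr 12 (lit (4 * (q / 4) + 0))) (arr 12 (lit q))))
      (ind (lt (arr 12 (lit (4 * (q / 4) + 1))) (arr 12 (lit q)))))
    (add (ind (lt (arr 12 (lit (4 * (q / 4) + 2))) (arr 12 (lit q))))
      (ind (lt (arr 12 (lit (4 * (q / 4) + 3))) (arr 12 (lit q)))))

/-- The place in the tables where the motion of an agent is found. -/
def tableIndex : List Expr :=
  reg 27 :: sub (reg 18) (reg 23) :: sub (reg 17) (reg 19) :: reg 14 :: reg 24 :: reg 22 ::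
    (List.range 12).map rankExpr

/-- Write down eight steps of an agent. -/
def writeSteps (X Y : ℕ) (ex ey : Expr) : Stmt :=
  repc 27 8 (seqs [set 26 (add (reg 26) (reg 2)), store X (reg 26) ex, store Y (reg 26) ey])

/-- Move the agent `reg 16`. -/
def moveAgent (W L X Y K : ℕ) : Stmt :=
  seqs [locate W L X Y,
    .ite (and (le (double (reg 13)) (reg 18)) (le (add (reg 23) (lit 3)) (reg L)))
      (seqs [gather X Y K,
        writeSteps X Y (add (reg 19) (arr 10 (Expr.encode tableIndex)))
          (add (reg 23) (arr 11 (Expr.encode tableIndex)))])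
      (writeSteps X Y (reg 17) (reg 18))]

/-- What a round needs to know about the memory. -/
structure Frame (S : Snapshot) (W L X Y K B : ℕ) (σ : State) : Prop where
  n : σ.reg 2 = S.n
  W : σ.reg W = S.W
  L : σ.reg L = S.L
  D : σ.reg 0 + σ.reg 1 = S.D
  m : σ.reg 14 = S.m
  par : σ.reg 13 = S.r % 2
  offset : σ.reg 20 = B
  parity : ∀ v ≤ S.W + S.L, v ≤ S.W ∨ v ≤ S.L → σ.arr 13 v = v % 2 ∧ σ.arr 14 v = 4 * (v / 4)
  row : ∀ l, IsKey l → σ.arr 10 (encode l) = target l / l.getD 4 0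
  col : ∀ l, IsKey l → σ.arr 11 (encode l) = target l % l.getD 4 0
  X : ∀ j < S.n, σ.arr X (B + j) = S.X j
  Y : ∀ j < S.n, σ.arr Y (B + j) = S.Y j
  key : ∀ j < S.n, σ.arr K j = S.key j

/-- The two possible roles of rows and columns. -/
structure Layout (W L X Y K : ℕ) : Prop where
  hW : W < 3
  hL : L < 3
  hX : X = 4 ∨ X = 5
  hY : Y = 4 ∨ Y = 5
  ne : X ≠ Y
  hK : K = 2 ∨ K = 3 ∨ K = 7

/-- Moving one agent writes only later times, the buffer in array `12` and registers that the frame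
ignores. So every agent of the round sees the same snapshot. -/
theorem Frame.congr {S : Snapshot} {W L X Y K B : ℕ} (hl : Layout W L X Y K) {σ τ : State}
    (F : Frame S W L X Y K B σ)
    (hr : ∀ y, y < 15 ∨ y = 20 → τ.reg y = σ.reg y)
    (ha : ∀ a, a ≠ X → a ≠ Y → a ≠ 12 → τ.arr a = σ.arr a)
    (hX : ∀ j < S.n, τ.arr X (B + j) = σ.arr X (B + j))
    (hY : ∀ j < S.n, τ.arr Y (B + j) = σ.arr Y (B + j)) : Frame S W L X Y K B τ := by
  obtain ⟨hW, hL, hX', hY', -, hK⟩ := hl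
  have a10 := ha 10 (by omega) (by omega) (by omega)
  have a11 := ha 11 (by omega) (by omega) (by omega)
  have a13 := ha 13 (by omega) (by omega) (by omega)
  have a14 := ha 14 (by omega) (by omega) (by omega)
  have aK := ha K (by omega) (by omega) (by omega)
  constructor
  · rw [hr _ (by omega)]; exact F.n
  · rw [hr _ (by omega)]; exact F.W
  · rw [hr _ (by omega)]; exact F.L
  · rw [hr _ (by omega), hr _ (by omega)]; exact F.D
  · rw [hr _ (by omega)]; exact F.m
  · rw [hr _ (by omega)]; exact F.par
  · rw [hr _ (by omega)]; exact F.offset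
  · rw [a13, a14]; exact F.parity
  · rw [a10]; exact F.row
  · rw [a11]; exact F.col
  · exact fun j hj => (hX j hj).trans (F.X j hj)
  · exact fun j hj => (hY j hj).trans (F.Y j hj)
  · rw [aK]; exact F.key

theorem rankExpr_eval (q : ℕ) (σ : State) : (rankExpr q).eval σ = rankDigit (σ.arr 12) q := by
  rw [rankDigit, Finset.card_filter]
  simp only [rankExpr, Expr.eval, Expr.ind_eval, Finset.sum_range_succ, Finset.sum_range_zero,
    Expr.lt_eval, ← not_lt, ite_not]
  omega

section

variable {S : Snapshot} {W L X Y K B : ℕ} (hl : Layout W L X Y K) (G : S.Good)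
include hl G

theorem locate_eval {σ : State} (F : Frame S W L X Y K B σ) {i : ℕ} (hi : i < S.n)
    (h16 : σ.reg 16 = i) :
    ∃ τ, (locate W L X Y).eval σ = τ ∧ τ.arr = σ.arr ∧
      (∀ y, y < 17 ∨ y = 20 ∨ y = 21 → τ.reg y = σ.reg y) ∧
      τ.reg 17 = S.X i ∧ τ.reg 18 = S.Y i ∧ τ.reg 19 = S.xb i ∧ τ.reg 22 = S.ht i ∧
      τ.reg 23 = S.yb i ∧ τ.reg 24 = S.wd i ∧ τ.reg 26 = B + i := by
  have hx := G.ltX i hi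
  have hy := G.ltY i hi
  have hW := hl.hW
  have hL := hl.hL
  -- Without division, remainders and multiples of four are read from tables, at exactly these three
  -- arguments.
  have p1 := (F.parity S.W (by omega) (by omega)).1
  have p2 := (F.parity (S.X i - S.W % 2) (by omega) (by omega)).1
  have p3 := (F.parity (S.Y i - 2 * (S.r % 2)) (by omega) (by omega)).2
  refine ⟨_, rfl, ?_⟩
  by_cases hlt : S.X i < 2 + S.W % 2
  · have := not_le.2 hlt
    simp [locate, h16, F.offset, F.X i hi, F.Y i hi, F.W, F.L, F.par, p1, p3, this,
      show W ≠ 17 by omega, show W ≠ 18 by omega, show W ≠ 19 by omega, show L ≠ 17 by omega,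
      show L ≠ 18 by omega, show L ≠ 19 by omega, show L ≠ 22 by omega, show L ≠ 23 by omega,
      Snapshot.xb, Snapshot.ht, Snapshot.yb, Snapshot.wd, rowBase, rowHeight, width, LineSort.base, hlt]
    intro y hy
    simp [show y ≠ 17 by omega, show y ≠ 18 by omega, show y ≠ 19 by omega, show y ≠ 22 by omega,
      show y ≠ 23 by omega, show y ≠ 24 by omega, show y ≠ 26 by omega]
  · have := not_lt.1 hlt
    simp [locate, h16, F.offset, F.X i hi, F.Y i hi, F.W, F.L, F.par, p1, p2, p3, this,
      show W ≠ 17 by omega, show W ≠ 18 by omega, show L ≠ 17 by omega,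
      show L ≠ 18 by omega, show L ≠ 19 by omega, show L ≠ 22 by omega, show L ≠ 23 by omega,
      Snapshot.xb, Snapshot.ht, Snapshot.yb, Snapshot.wd, rowBase, rowHeight, width, LineSort.base, hlt]
    intro y hy
    simp [show y ≠ 17 by omega, show y ≠ 18 by omega, show y ≠ 19 by omega, show y ≠ 22 by omega,
      show y ≠ 23 by omega, show y ≠ 24 by omega, show y ≠ 26 by omega]

/-- All agents are scanned to find those of the block. Rows are not bounded from above, so below a
block of height two a third row may be recorded; `cellKey` includes it as well, and the conditions
on a plan concern only the rows of the block. -/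
theorem gather_eval {σ : State} (F : Frame S W L X Y K B σ) {a b : ℕ} (h19 : σ.reg 19 = a)
    (h23 : σ.reg 23 = b) :
    ∃ τ, (gather X Y K).eval σ = τ ∧ (∀ y, y ≠ 25 → τ.reg y = σ.reg y) ∧
      (∀ y, y ≠ 12 → τ.arr y = σ.arr y) ∧ ∀ q < 12, τ.arr 12 q = S.cellKey a b q := by
  refine ⟨_, rfl, ?_⟩
  obtain ⟨-, -, hX, hY, -, hK⟩ := hl
  unfold gather
  rw [Stmt.seqs_eval_cons, Stmt.seqs_eval_cons, Stmt.seqs_eval_nil]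
  set ρ := Stmt.eval (repc 25 12 (store 12 (reg 25) (add (reg 0) (reg 1)))) σ with hρ
  obtain ⟨c1, c2, c3⟩ : (∀ y, y ≠ 25 → ρ.reg y = σ.reg y) ∧ (∀ y, y ≠ 12 → ρ.arr y = σ.arr y) ∧
      ∀ q < 12, ρ.arr 12 q = S.D := by
    rw [hρ, Stmt.eval]
    refine iter_inv (fun k τ => (∀ y, y ≠ 25 → τ.reg y = σ.reg y) ∧
      (∀ y, y ≠ 12 → τ.arr y = σ.arr y) ∧ ∀ q < k, τ.arr 12 q = S.D)
      ⟨fun _ _ => rfl, fun _ _ => rfl, by simp⟩ ?_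
    rintro k τ - ⟨h1, h2, h3⟩
    refine ⟨fun y hy => by simp [hy, h1 y hy], fun y hy => by funext l; simp [hy, h2 y hy],
      fun q hq => ?_⟩
    by_cases hqk : q = k
    · simp [hqk, h1 0 (by decide), h1 1 (by decide), F.D]
    · simp [hqk, h3 q (by omega)]
  rw [Stmt.eval, c1 2 (by decide), F.n]
  obtain ⟨d1, d2, d3⟩ := iter_inv (N := S.n) (σ := ρ)
    (f := fun k τ => Stmt.eval (when
      (and (and (le (reg 19) (arr X (add (reg 20) (reg 25))))
        (le (reg 23) (arr Y (add (reg 20) (reg 25)))))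
        (lt (arr Y (add (reg 20) (reg 25))) (add (reg 23) (lit 4))))
      (store 12 (add (double (double (sub (arr X (add (reg 20) (reg 25))) (reg 19))))
        (sub (arr Y (add (reg 20) (reg 25))) (reg 23))) (arr K (reg 25)))) (τ.setReg 25 k))
    (fun k τ => (∀ y, y ≠ 25 → τ.reg y = σ.reg y) ∧
      (∀ y, y ≠ 12 → τ.arr y = σ.arr y) ∧ ∀ q < 12,
        ((∃ j < k, (a ≤ S.X j ∧ b ≤ S.Y j ∧ S.Y j < b + 4) ∧ 4 * (S.X j - a) + (S.Y j - b) = q) →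
          τ.arr 12 q = S.cellKey a b q) ∧
        ((∀ j < k, a ≤ S.X j ∧ b ≤ S.Y j ∧ S.Y j < b + 4 → 4 * (S.X j - a) + (S.Y j - b) ≠ q) →
          τ.arr 12 q = S.D))
    ⟨c1, c2, fun q hq => ⟨by simp, fun _ => c3 q hq⟩⟩ (by
      rintro k τ hk ⟨h1, h2, h3⟩
      have eX : τ.arr X (B + k) = S.X k := by rw [h2 X (by omega)]; exact F.X k hk
      have eY : τ.arr Y (B + k) = S.Y k := by rw [h2 Y (by omega)]; exact F.Y k hk
      have eK : τ.arr K k = S.key k := by rw [h2 K (by omega)]; exact F.key k hk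
      have e20 : τ.reg 20 = B := by rw [h1 20 (by decide)]; exact F.offset
      have e19 : τ.reg 19 = a := by rw [h1 19 (by decide)]; exact h19
      have e23 : τ.reg 23 = b := by rw [h1 23 (by decide)]; exact h23
      rw [Stmt.when_eval]
      by_cases hin : a ≤ S.X k ∧ b ≤ S.Y k ∧ S.Y k < b + 4
      · rw [if_neg (by simp [eX, eY, e20, e19, e23]; omega)]
        refine ⟨fun y hy => by simp [hy, h1 y hy], fun y hy => by funext l; simp [hy, h2 y hy],
          fun q hq => ?_⟩
        simp only [Stmt.eval, Expr.eval, Expr.double_eval, setReg_reg, setReg_arr, setArr_arr,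
          if_true, true_and, eX, eY, eK, e20, e19, e23, show (20 : ℕ) ≠ 25 by decide,
          show (19 : ℕ) ≠ 25 by decide, show (23 : ℕ) ≠ 25 by decide, if_false]
        by_cases hq' : 4 * (S.X k - a) + (S.Y k - b) = q
        · rw [if_pos (by omega)]
          refine ⟨fun _ => ?_, fun h => absurd hq' (h k (by omega) hin)⟩
          rw [← hq', G.cellKey_agent hk hin]
        · rw [if_neg (by omega)]
          refine ⟨?_, fun h => (h3 q hq).2 fun j hj => h j (by omega)⟩
          rintro ⟨j, hj, hj'⟩
          have : j ≠ k := fun h => hq' (h ▸ hj'.2)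
          exact (h3 q hq).1 ⟨j, by omega, hj'⟩
      · rw [if_pos (by simp [eX, eY, e20, e19, e23]; omega)]
        refine ⟨fun y hy => by simp [hy, h1 y hy], by simpa using h2, fun q hq => ?_⟩
        refine ⟨?_, fun h => (h3 q hq).2 fun j hj => h j (by omega)⟩
        rintro ⟨j, hj, hj'⟩
        have : j ≠ k := fun h => hin (h ▸ hj'.1)
        exact (h3 q hq).1 ⟨j, by omega, hj'⟩)
  refine ⟨d1, d2, fun q hq => ?_⟩
  by_cases h : ∃ j < S.n, (a ≤ S.X j ∧ b ≤ S.Y j ∧ S.Y j < b + 4) ∧ 4 * (S.X j - a) + (S.Y j - b) = q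
  · exact (d3 q hq).1 h
  · push Not at h
    rw [(d3 q hq).2 h, Snapshot.cellKey_mark h]

omit G in
theorem writeSteps_eval {σ : State} {ex ey : Expr} {fx fy : ℕ → ℕ} {n p : ℕ} (hn : σ.reg 2 = n)
    (hn0 : 0 < n) (hp : σ.reg 26 = p)
    (h : ∀ τ : State, ∀ k < 8, (∀ a, a ≠ X → a ≠ Y → τ.arr a = σ.arr a) →
      (∀ y, y ≠ 26 → y ≠ 27 → τ.reg y = σ.reg y) → τ.reg 27 = k → ex.eval τ = fx k ∧ ey.eval τ = fy k) :
    ∃ τ, (writeSteps X Y ex ey).eval σ = τ ∧ (∀ y, y ≠ 26 → y ≠ 27 → τ.reg y = σ.reg y) ∧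
      (∀ a, a ≠ X → a ≠ Y → τ.arr a = σ.arr a) ∧
      (∀ k < 8, τ.arr X (p + (k + 1) * n) = fx k ∧ τ.arr Y (p + (k + 1) * n) = fy k) ∧
      ∀ l, (∀ k < 8, l ≠ p + (k + 1) * n) → τ.arr X l = σ.arr X l ∧ τ.arr Y l = σ.arr Y l := by
  have hXY := hl.ne
  have step : ∀ (ρ : State) (v : ℕ), v = ρ.reg 26 + ρ.reg 2 →
      Stmt.eval (seqs [set 26 (add (reg 26) (reg 2)), store X (reg 26) ex, store Y (reg 26) ey]) ρ =
        (((ρ.setReg 26 v).setArr X ((ρ.setReg 26 v).reg 26) (ex.eval (ρ.setReg 26 v))).setArr Y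
          ((ρ.setReg 26 v).reg 26) (ey.eval ((ρ.setReg 26 v).setArr X ((ρ.setReg 26 v).reg 26)
            (ex.eval (ρ.setReg 26 v))))) := by
    rintro ρ _ rfl; rfl
  refine ⟨_, rfl, ?_⟩
  rw [writeSteps, Stmt.eval]
  suffices H : ∀ k ≤ 8, ∀ τ, τ = iter (fun k τ => Stmt.eval (seqs [set 26 (add (reg 26) (reg 2)),
      store X (reg 26) ex, store Y (reg 26) ey]) (τ.setReg 27 k)) k σ →
      (τ.reg 26 = p + k * n ∧ ∀ y, y ≠ 26 → y ≠ 27 → τ.reg y = σ.reg y) ∧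
      (∀ a, a ≠ X → a ≠ Y → τ.arr a = σ.arr a) ∧
      (∀ j < k, τ.arr X (p + (j + 1) * n) = fx j ∧ τ.arr Y (p + (j + 1) * n) = fy j) ∧
      ∀ l, (∀ j < k, l ≠ p + (j + 1) * n) → τ.arr X l = σ.arr X l ∧ τ.arr Y l = σ.arr Y l by
    obtain ⟨h1, h2⟩ := H 8 le_rfl _ rfl
    exact ⟨h1.2, h2⟩
  intro k hk τ hτ
  induction k generalizing τ with
  | zero => subst hτ; simp [hp]
  | succ k ih =>
    obtain ⟨⟨h1, h2⟩, h3, h4, h5⟩ := ih (by omega) _ rfl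
    set ρ := iter (fun k τ => Stmt.eval (seqs [set 26 (add (reg 26) (reg 2)),
      store X (reg 26) ex, store Y (reg 26) ey]) (τ.setReg 27 k)) k σ
    have e2 : ρ.reg 2 = n := by rw [h2 2 (by decide) (by decide), hn]
    set ρ' := (ρ.setReg 27 k).setReg 26 (p + (k + 1) * n) with hρ'
    -- `ey` is evaluated after the store to array `X`, so its value must be known for any content of
    -- that array.
    have ev := fun v => (h (ρ'.setArr X (p + (k + 1) * n) v) k (by omega)
      (fun a ha ha' => by funext l; simp [hρ', ha, h3 a ha ha'])
      (fun y hy hy' => by simp [hρ', hy, hy', h2 y hy hy']) (by simp [hρ'])).2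
    have eu := (h ρ' k (by omega)
      (fun a ha ha' => by simp [hρ', h3 a ha ha'])
      (fun y hy hy' => by simp [hρ', hy, hy', h2 y hy hy']) (by simp [hρ'])).1
    have hτ' : τ = (ρ'.setArr X (p + (k + 1) * n) (fx k)).setArr Y (p + (k + 1) * n) (fy k) := by
      have : ρ.reg 26 + ρ.reg 2 = p + (k + 1) * n := by rw [h1, e2]; ring
      rw [hτ, iter]
      change Stmt.eval _ (ρ.setReg 27 k) = _
      rw [step _ _ (by simpa using this.symm)]
      rw [show ρ'.reg 26 = p + (k + 1) * n by simp [hρ'], ev, eu]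
    have hne : ∀ j < k, p + (j + 1) * n ≠ p + (k + 1) * n := by
      intro j hj e
      have := Nat.eq_of_mul_eq_mul_right hn0 (Nat.add_left_cancel e)
      omega
    rw [hτ']
    refine ⟨⟨by simp [hρ'], fun y hy hy' => by simp [hρ', hy, hy', h2 y hy hy']⟩,
      fun a ha ha' => by funext l; simp [hρ', ha, ha', h3 a ha ha'], fun j hj => ?_, fun l hl => ?_⟩
    · by_cases hjk : j = k
      · subst hjk; simp [hXY, hρ']
      · have := h4 j (by omega)
        have hne' := hne j (by omega)
        simp only [setArr_arr, hne', and_false, if_false, hρ', setReg_arr]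
        exact this
    · have hlk := hl k (by omega)
      simp only [setArr_arr, hlk, and_false, if_false, hρ', setReg_arr]
      exact h5 l fun j hj => hl j (by omega)

/-- Each agent computes the plan of its block separately. Agents of one block obtain the same ranks,
hence the same plan, and read off their own trajectories. -/
theorem moveAgent_eval {σ : State} (F : Frame S W L X Y K B σ) {i : ℕ} (hi : i < S.n)
    (h16 : σ.reg 16 = i) :
    ∃ τ, (moveAgent W L X Y K).eval σ = τ ∧
      (∀ y, y < 17 ∨ y = 20 ∨ y = 21 → τ.reg y = σ.reg y) ∧
      (∀ a, a ≠ X → a ≠ Y → a ≠ 12 → τ.arr a = σ.arr a) ∧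
      (∀ k < 8, τ.arr X (B + i + (k + 1) * S.n) = S.newX (k + 1) i ∧
        τ.arr Y (B + i + (k + 1) * S.n) = S.newY (k + 1) i) ∧
      ∀ l, (∀ k < 8, l ≠ B + i + (k + 1) * S.n) → τ.arr X l = σ.arr X l ∧ τ.arr Y l = σ.arr Y l := by
  obtain ⟨ρ, e0, e1, e2, r17, r18, r19, r22, r23, r24, r26⟩ := locate_eval hl G F hi h16
  have hW := hl.hW
  have hL := hl.hL
  have hX := hl.hX
  have hY := hl.hY
  have Fρ : Frame S W L X Y K B ρ := F.congr hl (fun y hy => e2 y (by omega))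
    (fun a _ _ _ => by rw [e1]) (fun j _ => by rw [e1]) fun j _ => by rw [e1]
  have hact : (and (le (double (reg 13)) (reg 18)) (le (add (reg 23) (lit 3)) (reg L))).eval ρ ≠ 0 ↔
      LineSort.Active S.L S.r (S.Y i) := by
    simp [r18, r23, Fρ.par, Fρ.L, Snapshot.yb, LineSort.Active]
  refine ⟨_, rfl, ?_⟩
  rw [moveAgent, Stmt.seqs_eval_cons, Stmt.seqs_eval_cons, Stmt.seqs_eval_nil, e0, Stmt.eval]
  by_cases hA : LineSort.Active S.L S.r (S.Y i)
  · rw [if_pos (hact.2 hA), Stmt.seqs_eval_cons, Stmt.seqs_eval_cons, Stmt.seqs_eval_nil]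
    obtain ⟨θ, g0, g1, g2, g3⟩ := gather_eval hl G Fρ r19 r23
    rw [g0]
    obtain ⟨⟨b1, b2, b3, -⟩, b4, b5, b6, -⟩ := G.block hi hA
    have hm := G.kind
    -- Eighteen digits: step, two coordinates, kind, width and height, and twelve ranks.
    have hkey : ∀ k < 8, IsKey (k :: (S.Y i - S.yb i) :: (S.X i - S.xb i) :: S.m :: S.wd i :: S.ht i ::
        S.digits i) := by
      intro k hk
      refine ⟨by simp [Snapshot.digits], fun d hd => ?_⟩
      simp only [List.mem_cons, Snapshot.digits, List.mem_map] at hd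
      rcases hd with rfl | rfl | rfl | rfl | rfl | rfl | ⟨q, -, rfl⟩
      any_goals omega
      exact (rankDigit_le _ _).trans_lt (by decide)
    have hidx : ∀ (τ : State) (k : ℕ), k < 8 → (∀ a, a ≠ X → a ≠ Y → τ.arr a = θ.arr a) →
        (∀ y, y ≠ 26 → y ≠ 27 → τ.reg y = θ.reg y) → τ.reg 27 = k →
        (add (reg 19) (arr 10 (Expr.encode tableIndex))).eval τ = S.newX (k + 1) i ∧
          (add (reg 23) (arr 11 (Expr.encode tableIndex))).eval τ = S.newY (k + 1) i := by
      intro τ k hk ha hr h27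
      have q : ∀ y, y ≠ 25 → y ≠ 26 → y ≠ 27 → τ.reg y = ρ.reg y := fun y h1 h2 h3 =>
        (hr y h2 h3).trans (g1 y h1)
      have c : (Expr.encode tableIndex).eval τ = encode (k :: (S.Y i - S.yb i) :: (S.X i - S.xb i) ::
          S.m :: S.wd i :: S.ht i :: S.digits i) := by
        rw [Expr.encode_eval, tableIndex]
        simp only [List.map_cons, Expr.eval, h27, q 18 (by decide) (by decide) (by decide),
          q 23 (by decide) (by decide) (by decide), q 17 (by decide) (by decide) (by decide),
          q 19 (by decide) (by decide) (by decide), q 14 (by decide) (by decide) (by decide),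
          q 24 (by decide) (by decide) (by decide), q 22 (by decide) (by decide) (by decide),
          r17, r18, r19, r22, r23, r24, Fρ.m, List.map_map]
        congr 7
        refine List.map_congr_left fun p hp => ?_
        rw [List.mem_range] at hp
        rw [Function.comp_apply, rankExpr_eval, rankDigit, rankDigit, ha 12 (by omega) (by omega),
          g3 p hp]
        congr 1
        refine Finset.filter_congr fun j hj => ?_
        rw [Finset.mem_range] at hj
        rw [g3 _ (by omega)]
      have a10 : τ.arr 10 = ρ.arr 10 := (ha 10 (by omega) (by omega)).trans (g2 10 (by decide))
      have a11 : τ.arr 11 = ρ.arr 11 := (ha 11 (by omega) (by omega)).trans (g2 11 (by decide))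
      have r19' := (q 19 (by decide) (by decide) (by decide)).trans r19
      have r23' := (q 23 (by decide) (by decide) (by decide)).trans r23
      simp only [Expr.eval, c, a10, a11, r19', r23', Fρ.row _ (hkey k hk), Fρ.col _ (hkey k hk),
        Snapshot.newX, Snapshot.newY, if_pos hA]
      -- `target` of this list is by definition `newCell (k + 1) i`, and the tables hold its
      -- quotient and remainder by the width.
      exact ⟨rfl, rfl⟩
    obtain ⟨τ, f0, f1, f2, f3, f4⟩ := writeSteps_eval hl ((g1 2 (by decide)).trans Fρ.n)
      (by omega) ((g1 26 (by decide)).trans r26) hidx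
    rw [f0]
    refine ⟨fun y hy => ?_, fun a h1 h2 h3 => ?_, f3, fun l hl => ?_⟩
    · rw [f1 y (by omega) (by omega), g1 y (by omega), e2 y hy]
    · rw [f2 a h1 h2, g2 a h3, e1]
    · rw [(f4 l hl).1, (f4 l hl).2, g2 X (by omega), g2 Y (by omega), e1]
      exact ⟨rfl, rfl⟩
  · rw [if_neg (fun h => hA (hact.1 h))]
    obtain ⟨τ, f0, f1, f2, f3, f4⟩ := writeSteps_eval (σ := ρ) (ex := reg 17) (ey := reg 18)
      (fx := fun k => S.newX (k + 1) i) (fy := fun k => S.newY (k + 1) i) hl Fρ.n (by omega) r26 (by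
        intro τ k _ _ hr _
        simp only [Expr.eval, hr 17 (by decide) (by decide), hr 18 (by decide) (by decide), r17, r18,
          Snapshot.newX, Snapshot.newY, if_neg hA, and_self])
    rw [f0]
    refine ⟨fun y hy => ?_, fun a h1 h2 h3 => ?_, f3, fun l hl => ?_⟩
    · rw [f1 y (by omega) (by omega), e2 y hy]
    · rw [f2 a h1 h2, e1]
    · rw [(f4 l hl).1, (f4 l hl).2, e1]
      trivial

/-- Move all agents. -/
theorem rep_moveAgent_eval {σ : State} (F : Frame S W L X Y K B σ) :
    ∃ τ, (rep 16 2 (moveAgent W L X Y K)).eval σ = τ ∧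
      (∀ y, y < 16 ∨ y = 20 ∨ y = 21 → τ.reg y = σ.reg y) ∧
      (∀ a, a ≠ X → a ≠ Y → a ≠ 12 → τ.arr a = σ.arr a) ∧
      (∀ i < S.n, ∀ k < 8, τ.arr X (B + i + (k + 1) * S.n) = S.newX (k + 1) i ∧
        τ.arr Y (B + i + (k + 1) * S.n) = S.newY (k + 1) i) ∧
      ∀ l < B + S.n, τ.arr X l = σ.arr X l ∧ τ.arr Y l = σ.arr Y l := by
  refine ⟨_, rfl, ?_⟩
  rw [Stmt.eval, F.n]
  refine iter_inv (fun N τ => (∀ y, y < 16 ∨ y = 20 ∨ y = 21 → τ.reg y = σ.reg y) ∧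
      (∀ a, a ≠ X → a ≠ Y → a ≠ 12 → τ.arr a = σ.arr a) ∧
      (∀ i < N, ∀ k < 8, τ.arr X (B + i + (k + 1) * S.n) = S.newX (k + 1) i ∧
        τ.arr Y (B + i + (k + 1) * S.n) = S.newY (k + 1) i) ∧
      ∀ l < B + S.n, τ.arr X l = σ.arr X l ∧ τ.arr Y l = σ.arr Y l)
    ⟨fun _ _ => rfl, fun _ _ _ _ => rfl, by simp, fun _ _ => ⟨rfl, rfl⟩⟩ ?_
  rintro N τ hN ⟨h1, h2, h3, h4⟩
  have Fτ : Frame S W L X Y K B (τ.setReg 16 N) := F.congr hl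
    (fun y hy => by simp [show y ≠ 16 by omega, h1 y (by omega)]) h2
    (fun j hj => (h4 _ (by omega)).1) (fun j hj => (h4 _ (by omega)).2)
  obtain ⟨ρ, e0, e1, e2, e3, e4⟩ := moveAgent_eval hl G Fτ hN (by simp)
  rw [e0]
  refine ⟨fun y hy => ?_, fun a ha ha' ha'' => ?_, fun i hi k hk => ?_, fun l hl => ?_⟩
  · rw [e1 y (by omega), ← h1 y hy]; simp [show y ≠ 16 by omega]
  · rw [e2 a ha ha' ha'', ← h2 a ha ha' ha'']; rfl
  · by_cases hiN : i = N
    · rw [hiN]; exact e3 k hk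
    -- Relative to `B`, entries of different agents have different remainders modulo `n`.
    · have hne : ∀ j < 8, B + i + (k + 1) * S.n ≠ B + N + (j + 1) * S.n := by
        intro j _ e
        have e' : i + S.n * (k + 1) = N + S.n * (j + 1) := by
          rw [mul_comm S.n, mul_comm S.n]; omega
        have := congrArg (· % S.n) e'
        simp only [Nat.add_mul_mod_self_left] at this
        rw [Nat.mod_eq_of_lt (by omega), Nat.mod_eq_of_lt hN] at this
        exact hiN this
      rw [(e4 _ hne).1, (e4 _ hne).2]
      exact h3 i (by omega) k hk
  · have hne : ∀ j < 8, l ≠ B + N + (j + 1) * S.n := by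
      intro j _ e
      have : (j + 1) * S.n = j * S.n + S.n := by ring
      omega
    rw [(e4 l hne).1, (e4 l hne).2]
    exact h4 l hl

end

end GridProgram

/-! ### Joint motions -/

/-- The arrays `A` and `B` hold, at index `t * n + i`, the row and the column of agent `i` at time
`t`, in a collision-free motion of `n` agents in a `W × L` grid up to time `T`. -/
structure Joint (n W L : ℕ) (A B : ℕ → ℕ) (T : ℕ) : Prop where
  ltA : ∀ t ≤ T, ∀ i < n, A (t * n + i) < W
  ltB : ∀ t ≤ T, ∀ i < n, B (t * n + i) < L
  inj : ∀ t ≤ T, ∀ i < n, ∀ j < n, A (t * n + i) = A (t * n + j) → B (t * n + i) = B (t * n + j) → i = j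
  move : ∀ t < T, ∀ i < n,
    A (t * n + i) = A ((t + 1) * n + i) ∧ (B (t * n + i) = B ((t + 1) * n + i) ∨
        B (t * n + i) + 1 = B ((t + 1) * n + i) ∨ B ((t + 1) * n + i) + 1 = B (t * n + i)) ∨
      B (t * n + i) = B ((t + 1) * n + i) ∧
        (A (t * n + i) + 1 = A ((t + 1) * n + i) ∨ A ((t + 1) * n + i) + 1 = A (t * n + i))
  noswap : ∀ t < T, ∀ i < n, ∀ j < n, i ≠ j → A (t * n + i) = A ((t + 1) * n + j) →
    B (t * n + i) = B ((t + 1) * n + j) → A (t * n + j) = A ((t + 1) * n + i) →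
    B (t * n + j) = B ((t + 1) * n + i) → False

namespace Joint

variable {n W L : ℕ} {A B A' B' : ℕ → ℕ} {T : ℕ}

theorem swap (J : Joint n W L A B T) : Joint n L W B A T where
  ltA := J.ltB
  ltB := J.ltA
  inj t ht i hi j hj h h' := J.inj t ht i hi j hj h' h
  move t ht i hi := by have := J.move t ht i hi; omega
  noswap t ht i hi j hj hij h1 h2 h3 h4 := J.noswap t ht i hi j hj hij h2 h1 h4 h3

theorem index_lt {t i : ℕ} (ht : t ≤ T) (hi : i < n) : t * n + i < T * n + n :=
  add_lt_add_of_le_of_lt (Nat.mul_le_mul_right n ht) hi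

/-- Eight times are written in every round. After a split, which lasts six steps, the last two only
repeat the final positions; they lie beyond the time claimed here, and the next round may overwrite
them. -/
theorem extend (J : Joint n W L A B T) {S : Snapshot} (G : S.Good) (hn : S.n = n) (hW : S.W = W)
    (hL : S.L = L) (hX : ∀ i < n, S.X i = A (T * n + i)) (hY : ∀ i < n, S.Y i = B (T * n + i))
    (hA : ∀ l < T * n + n, A' l = A l) (hB : ∀ l < T * n + n, B' l = B l)
    (hnew : ∀ i < n, ∀ k < 8, A' (T * n + i + (k + 1) * n) = S.newX (k + 1) i ∧
      B' (T * n + i + (k + 1) * n) = S.newY (k + 1) i) :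
    Joint n W L A' B' (T + (8 - 2 * S.m)) ∧
      ∀ s ≤ 8, ∀ i < n, A' ((T + s) * n + i) = S.newX s i ∧ B' ((T + s) * n + i) = S.newY s i := by
  subst hn hW hL
  have new : ∀ s ≤ 8, ∀ i < S.n,
      A' ((T + s) * S.n + i) = S.newX s i ∧ B' ((T + s) * S.n + i) = S.newY s i := by
    intro s hs i hi
    rcases s with _ | s
    · rw [add_zero, (G.new_zero hi).1, (G.new_zero hi).2, hA _ (index_lt le_rfl hi),
        hB _ (index_lt le_rfl hi), hX i hi, hY i hi]
      exact ⟨rfl, rfl⟩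
    · rw [← (hnew i hi s hs).1, ← (hnew i hi s hs).2,
        show (T + (s + 1)) * S.n + i = T * S.n + i + (s + 1) * S.n by ring]
      exact ⟨rfl, rfl⟩
  have split : ∀ t ≤ T + (8 - 2 * S.m), t < T ∨ ∃ s ≤ 8 - 2 * S.m, s ≤ 8 ∧ t = T + s := fun t ht => by
    rcases Nat.lt_or_ge t T with h | h
    exacts [.inl h, .inr ⟨t - T, by omega, by omega, by omega⟩]
  have old : ∀ t ≤ T, ∀ i < S.n, A' (t * S.n + i) = A (t * S.n + i) ∧ B' (t * S.n + i) = B (t * S.n + i) :=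
    fun t ht i hi => ⟨hA _ (index_lt ht hi), hB _ (index_lt ht hi)⟩
  refine ⟨⟨?_, ?_, ?_, ?_, ?_⟩, new⟩
  · intro t ht i hi
    rcases split t ht with h | ⟨s, hs, hs', rfl⟩
    · rw [(old t h.le i hi).1]; exact J.ltA t h.le i hi
    · rw [(new s hs' i hi).1]; exact G.newX_lt hi s
  · intro t ht i hi
    rcases split t ht with h | ⟨s, hs, hs', rfl⟩
    · rw [(old t h.le i hi).2]; exact J.ltB t h.le i hi
    · rw [(new s hs' i hi).2]; exact G.newY_lt hi s
  · intro t ht i hi j hj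
    rcases split t ht with h | ⟨s, hs, hs', rfl⟩
    · rw [(old t h.le i hi).1, (old t h.le i hi).2, (old t h.le j hj).1, (old t h.le j hj).2]
      exact J.inj t h.le i hi j hj
    · rw [(new s hs' i hi).1, (new s hs' i hi).2, (new s hs' j hj).1, (new s hs' j hj).2]
      exact G.new_inj hi hj
  · intro t ht i hi
    rcases split t ht.le with h | ⟨s, hs, hs', rfl⟩
    · rw [(old t h.le i hi).1, (old t h.le i hi).2, (old (t + 1) h i hi).1, (old (t + 1) h i hi).2]
      exact J.move t h i hi
    · rw [add_assoc, (new s hs' i hi).1, (new s hs' i hi).2, (new (s + 1) (by omega) i hi).1,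
        (new (s + 1) (by omega) i hi).2]
      exact G.new_move hi (by omega)
  · intro t ht i hi j hj hij
    rcases split t ht.le with h | ⟨s, hs, hs', rfl⟩
    · rw [(old t h.le i hi).1, (old t h.le i hi).2, (old (t + 1) h i hi).1, (old (t + 1) h i hi).2,
        (old t h.le j hj).1, (old t h.le j hj).2, (old (t + 1) h j hj).1, (old (t + 1) h j hj).2]
      exact J.noswap t h i hi j hj hij
    · rw [add_assoc, (new s hs' i hi).1, (new s hs' i hi).2, (new (s + 1) (by omega) i hi).1,
        (new (s + 1) (by omega) i hi).2, (new s hs' j hj).1, (new s hs' j hj).2,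
        (new (s + 1) (by omega) j hj).1, (new (s + 1) (by omega) j hj).2]
      exact G.new_noswap hi hj hij (by omega)

end Joint

/-! ### Rounds of a phase -/

namespace LineSort

/-- The kind of round `r`: `0` if it sorts the windows completely, otherwise `1`. -/
def kind (L r : ℕ) : ℕ := if L % 2 = 1 ∧ 5 ≤ L ∧ r < 2 then 1 else 0

theorem kind_eq_zero {L r : ℕ} : kind L r = 0 ↔ Full L r := by simp [kind, Full]

theorem kind_le (L r : ℕ) : kind L r ≤ 1 := by unfold kind; split_ifs <;> omega

/-- The number of time steps of the first `r` rounds. -/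
def elapsed (L : ℕ) : ℕ → ℕ
  | 0 => 0
  | r + 1 => elapsed L r + (8 - 2 * kind L r)

theorem elapsed_eq (L r : ℕ) :
    elapsed L r + (if L % 2 = 1 ∧ 5 ≤ L then 2 * min r 2 else 0) = 8 * r := by
  induction r with
  | zero => simp [elapsed]
  | succ r ih =>
    unfold elapsed kind
    split_ifs at * <;> omega

/-- For even `L` there are `L / 2` rounds of eight steps. For odd `L ≥ 5` the `(L + 1) / 2` rounds
would take `4 * L + 4` steps, but each of the two split rounds saves two. For `L = 3` one round of
eight steps suffices. -/
theorem elapsed_le {L : ℕ} (hL : 3 ≤ L) : elapsed L (rounds L) ≤ 4 * L := by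
  have := elapsed_eq L (rounds L)
  unfold rounds at *
  split_ifs at * <;> omega

theorem elapsed_mono (L : ℕ) : Monotone (elapsed L) :=
  monotone_nat_of_le_succ fun _ => Nat.le_add_right _ _

/-- The effect of a round on the places `p` of `n` agents with lines `X`. -/
structure Step (n L r : ℕ) (X key p p' : ℕ → ℕ) : Prop where
  idle : ∀ i < n, ¬ Active L r (p i) → p' i = p i
  window : ∀ i < n, Active L r (p i) → base r (p i) ≤ p' i ∧ p' i < base r (p i) + 4
  sort : ∀ i < n, ∀ j < n, Active L r (p i) → Active L r (p j) → X i = X j →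
    base r (p i) = base r (p j) → (p' i / 2 < p' j / 2 ∨ Full L r ∧ p' i < p' j) → key i < key j

theorem Step.congr {n L r : ℕ} {X key p p' q q' : ℕ → ℕ} (h : Step n L r X key p p')
    (hq : ∀ i < n, q i = p i) (hq' : ∀ i < n, q' i = p' i) : Step n L r X key q q' where
  idle i hi := by rw [hq i hi, hq' i hi]; exact h.idle i hi
  window i hi := by rw [hq i hi, hq' i hi]; exact h.window i hi
  sort i hi j hj := by rw [hq i hi, hq' i hi, hq j hj, hq' j hj]; exact h.sort i hi j hj

theorem step_newY {S : Snapshot} (G : S.Good) (hm : S.m = kind S.L S.r) :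
    Step S.n S.L S.r S.X S.key S.Y (S.newY (8 - 2 * S.m)) where
  idle _ _ h := Snapshot.newY_idle h
  window _ hi h := G.newY_window hi h
  sort _ hi _ hj hA hA' hx hb h := G.newY_lt_newY hi hj hA hA' hx hb
    (h.imp_right fun h => ⟨hm.trans (kind_eq_zero.2 h.1), h.2⟩)

/-- After all rounds, the agents of every line are sorted. -/
theorem sorted_of_steps {n W L : ℕ} {X key : ℕ → ℕ} {pos : ℕ → ℕ → ℕ} (hL : 3 ≤ L) (hn : n = W * L)
    (hX : ∀ i < n, X i < W) (hpos : ∀ r ≤ rounds L, ∀ i < n, pos r i < L)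
    (hinj : ∀ r ≤ rounds L, ∀ i < n, ∀ j < n, X i = X j → pos r i = pos r j → i = j)
    (hstep : ∀ r < rounds L, Step n L r X key (pos r) (pos (r + 1)))
    (hkL : ∀ i < n, key i < L) (hk : ∀ i < n, ∀ j < n, X i = X j → key i = key j → i = j)
    {i : ℕ} (hi : i < n) : pos (rounds L) i = key i := by
  -- The items are the agents in the line of `i`; there are `L` of them because the grid is full.
  have H : Run (ι := {j : Fin n // X j = X i}) L (fun j => key j) fun r j => pos r j := by
    refine ⟨?_, ?_, ?_, ?_, ?_, ?_⟩
    · exact fun r hr j k h => Subtype.ext (Fin.ext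
        (hinj r hr j j.1.2 k k.1.2 (j.2.trans k.2.symm) h))
    · exact fun r hr j => hpos r hr j j.1.2
    · exact fun r hr j => (hstep r hr).idle j j.1.2
    · exact fun r hr j => (hstep r hr).window j j.1.2
    · exact fun r hr j k hA hA' hb h => (hstep r hr).sort j j.1.2 k k.1.2 hA hA'
        (j.2.trans k.2.symm) hb (.inl h)
    · exact fun r hr hf j k hA hA' hb h => (hstep r hr).sort j j.1.2 k k.1.2 hA hA'
        (j.2.trans k.2.symm) hb (.inr ⟨hf, h⟩)
  have hc : Fintype.card {j : Fin n // X j = X i} = L := by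
    rw [← Fintype.card_fin L]
    refine Fintype.card_of_bijective
      (f := fun j => (⟨pos 0 j, hpos 0 (Nat.zero_le _) j j.1.2⟩ : Fin L)) ⟨fun j k h => ?_, fun y => ?_⟩
    · exact H.inj 0 (Nat.zero_le _) (by simpa using h)
    · obtain ⟨j, hj, hx, hy⟩ := Snapshot.exists_agent hn hX (hpos 0 (Nat.zero_le _))
        (hinj 0 (Nat.zero_le _)) (hX i hi) y.2
      exact ⟨⟨⟨j, hj⟩, hx⟩, Fin.ext hy⟩
  exact H.sorted hL hc (fun j k h => Subtype.ext (Fin.ext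
    (hk j j.1.2 k k.1.2 (j.2.trans k.2.symm) h))) (fun j => hkL j j.1.2) ⟨⟨i, hi⟩, rfl⟩

end LineSort

/-! ### Correctness of the programs for a round and for a phase -/

namespace GridProgram

open RAM LoopLang
open LoopLang.Expr (reg lit arr add sub ne eq lt le not and or ind double)
open LoopLang.Stmt (set store rep repc when seqs)

/-- Round `reg 3`; register `21` is the clock. -/
def round (W L X Y K : ℕ) : Stmt :=
  seqs [
    set 13 (arr 13 (reg 3)),
    set 14 (ind (and (arr 13 (reg L)) (and (le (lit 5) (reg L)) (lt (reg 3) (lit 2))))),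
    rep 16 2 (moveAgent W L X Y K),
    set 20 (add (reg 20) (add (double (double (reg 2))) (double (reg 2)))),
    when (not (reg 14)) (set 20 (add (reg 20) (double (reg 2)))),
    set 21 (sub (add (reg 21) (lit 8)) (double (reg 14)))]

/-- Sort all lines by the keys in array `K`. -/
def phase (W L X Y K : ℕ) : Stmt :=
  rep 3 L (when (and (lt (double (reg 3)) (reg L)) (or (not (reg 3)) (ne (reg L) (lit 3))))
    (round W L X Y K))

/-- The tables are loaded. -/
structure Tables (V : ℕ) (σ : State) : Prop where
  parity : ∀ v ≤ V, σ.arr 13 v = v % 2 ∧ σ.arr 14 v = 4 * (v / 4)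
  row : ∀ l, IsKey l → σ.arr 10 (encode l) = target l / l.getD 4 0
  col : ∀ l, IsKey l → σ.arr 11 (encode l) = target l % l.getD 4 0

theorem round_eval {W L X Y K B V : ℕ} (hl : Layout W L X Y K) {S : Snapshot} (G : S.Good) {σ : State}
    (hT : Tables V σ) (hLV : S.L ≤ V) (hr : S.r ≤ V)
    (h3 : σ.reg 3 = S.r) (hm : S.m = LineSort.kind S.L S.r) (hL : σ.reg L = S.L)
    (F : Frame S W L X Y K B ((σ.setReg 13 (S.r % 2)).setReg 14 S.m)) :
    ∃ τ, (round W L X Y K).eval σ = τ ∧ (∀ y < 13, τ.reg y = σ.reg y) ∧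
      τ.reg 20 = B + (8 - 2 * S.m) * S.n ∧ τ.reg 21 = σ.reg 21 + (8 - 2 * S.m) ∧
      (∀ a, a ≠ X → a ≠ Y → a ≠ 12 → τ.arr a = σ.arr a) ∧
      (∀ i < S.n, ∀ k < 8, τ.arr X (B + i + (k + 1) * S.n) = S.newX (k + 1) i ∧
        τ.arr Y (B + i + (k + 1) * S.n) = S.newY (k + 1) i) ∧
      ∀ l < B + S.n, τ.arr X l = σ.arr X l ∧ τ.arr Y l = σ.arr Y l := by
  obtain ⟨ρ, e0, e1, e2, e3, e4⟩ := rep_moveAgent_eval hl G F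
  have hL3 := hl.hL
  have hind : (ind (and (arr 13 (reg L)) (and (le (lit 5) (reg L)) (lt (reg 3) (lit 2))))).eval
      (σ.setReg 13 (S.r % 2)) = S.m := by
    rw [Expr.ind_eval, hm, LineSort.kind]
    simp only [Expr.and_eval, Expr.le_eval, Expr.lt_eval, Expr.eval, setReg_reg, setReg_arr, h3,
      show L ≠ 13 by omega, show (3 : ℕ) ≠ 13 by decide, if_false, hL, (hT.parity S.L hLV).1]
    split_ifs <;> omega
  have hρ : Stmt.eval (seqs [set 13 (arr 13 (reg 3)),
      set 14 (ind (and (arr 13 (reg L)) (and (le (lit 5) (reg L)) (lt (reg 3) (lit 2))))),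
      rep 16 2 (moveAgent W L X Y K)]) σ = ρ := by
    change Stmt.eval _ ((σ.setReg 13 (σ.arr 13 (σ.reg 3))).setReg 14
      (Expr.eval _ (σ.setReg 13 (σ.arr 13 (σ.reg 3))))) = ρ
    rw [h3, (hT.parity S.r hr).1, hind]
    exact e0
  have hρ14 : ρ.reg 14 = S.m := by rw [e1 14 (by decide)]; simp
  have hρ2 : ρ.reg 2 = S.n := by rw [e1 2 (by decide)]; exact F.n
  have hρ20 : ρ.reg 20 = B := by rw [e1 20 (by decide)]; exact F.offset
  have hρ21 : ρ.reg 21 = σ.reg 21 := by rw [e1 21 (by decide)]; simp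
  refine ⟨_, rfl, ?_⟩
  -- Without multiplication, the offset advances by `6 * n`, and in a full round by another `2 * n`;
  -- this second write to register `20` causes the two forms.
  have hev : (round W L X Y K).eval σ = ((ρ.setReg 20 (B + (8 - 2 * S.m) * S.n)).setReg 21
      (σ.reg 21 + (8 - 2 * S.m))) ∨ (round W L X Y K).eval σ =
      (((ρ.setReg 20 (B + 6 * S.n)).setReg 20 (B + (8 - 2 * S.m) * S.n)).setReg 21
      (σ.reg 21 + (8 - 2 * S.m))) := by
    have : (round W L X Y K).eval σ = Stmt.eval (seqs [
        set 20 (add (reg 20) (add (double (double (reg 2))) (double (reg 2)))),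
        when (not (reg 14)) (set 20 (add (reg 20) (double (reg 2)))),
        set 21 (sub (add (reg 21) (lit 8)) (double (reg 14)))]) ρ := by
      rw [← hρ]; rfl
    rw [this]
    have e6 : B + (2 * (2 * S.n) + 2 * S.n) = B + 6 * S.n := by ring
    have hk := G.kind
    rcases Nat.le_one_iff_eq_zero_or_eq_one.1 hk with h | h
    · right
      have e8 : B + 6 * S.n + 2 * S.n = B + 8 * S.n := by ring
      simp [hρ14, hρ2, hρ20, hρ21, h, e6, e8]
    · left
      simp [hρ14, hρ2, hρ20, hρ21, h, e6]
  rcases hev with h | h <;> rw [h]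
  all_goals
    refine ⟨fun y hy => ?_, by simp, by simp, e2, e3, e4⟩
    simp [show y ≠ 21 by omega, show y ≠ 20 by omega, e1 y (by omega), show y ≠ 14 by omega,
      show y ≠ 13 by omega]

theorem phase_eval {W L X Y K w l n T V : ℕ} (hl : Layout W L X Y K) {σ : State} (hw : 3 ≤ w)
    (hl3 : 3 ≤ l) (hn : n = w * l) (h2 : σ.reg 2 = n) (hW : σ.reg W = w) (hL : σ.reg L = l)
    (hD : l ≤ σ.reg 0 + σ.reg 1) (hT : Tables V σ) (hwV : w ≤ V) (hlV : l ≤ V)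
    (h20 : σ.reg 20 = T * n) (h21 : σ.reg 21 = T) (J : Joint n w l (σ.arr X) (σ.arr Y) T)
    (hk : ∀ i < n, σ.arr K i < l)
    (hkinj : ∀ i < n, ∀ j < n, σ.arr X (T * n + i) = σ.arr X (T * n + j) →
      σ.arr K i = σ.arr K j → i = j) :
    ∃ τ T', (phase W L X Y K).eval σ = τ ∧ T' ≤ T + 4 * l ∧ τ.reg 20 = T' * n ∧ τ.reg 21 = T' ∧
      (∀ y < 3, τ.reg y = σ.reg y) ∧ (∀ a, a ≠ X → a ≠ Y → a ≠ 12 → τ.arr a = σ.arr a) ∧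
      Joint n w l (τ.arr X) (τ.arr Y) T' ∧
      (∀ q < T * n + n, τ.arr X q = σ.arr X q ∧ τ.arr Y q = σ.arr Y q) ∧
      ∀ i < n, τ.arr X (T' * n + i) = σ.arr X (T * n + i) ∧ τ.arr Y (T' * n + i) = σ.arr K i := by
  set e := LineSort.elapsed l with he
  set R := LineSort.rounds l with hR
  -- The invariant keeps the whole history: the lines of the agents at the end of each round and the
  -- effect of each round, as needed by `sorted_of_steps`.
  set Inv : ℕ → State → Prop := fun k τ =>
    (τ.reg 20 = (T + e k) * n ∧ τ.reg 21 = T + e k ∧ ∀ y < 3, τ.reg y = σ.reg y) ∧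
    (∀ a, a ≠ X → a ≠ Y → a ≠ 12 → τ.arr a = σ.arr a) ∧
    Joint n w l (τ.arr X) (τ.arr Y) (T + e k) ∧
    (∀ q < T * n + n, τ.arr X q = σ.arr X q ∧ τ.arr Y q = σ.arr Y q) ∧
    (∀ r ≤ k, ∀ i < n, τ.arr X ((T + e r) * n + i) = σ.arr X (T * n + i)) ∧
    ∀ r < k, LineSort.Step n l r (fun i => σ.arr X (T * n + i)) (σ.arr K)
      (fun i => τ.arr Y ((T + e r) * n + i)) (fun i => τ.arr Y ((T + e (r + 1)) * n + i)) with hInv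
  have hW3 := hl.hW
  have hL3 := hl.hL
  have hX' := hl.hX
  have hY' := hl.hY
  have hK' := hl.hK
  have main : Inv R ((phase W L X Y K).eval σ) := by
    have hRl : R ≤ l := by rw [hR, LineSort.rounds]; split_ifs <;> omega
    rw [phase, Stmt.eval, hL]
    suffices H : ∀ τ, τ = iter (fun k τ => Stmt.eval (when (and (lt (double (reg 3)) (reg L))
        (or (not (reg 3)) (ne (reg L) (lit 3)))) (round W L X Y K)) (τ.setReg 3 k)) l σ →
        Inv (min l R) τ by
      have := H _ rfl
      rwa [min_eq_right hRl] at this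
    rintro τ rfl
    refine iter_inv (fun k τ => Inv (min k R) τ) ?_ ?_
    · rw [Nat.zero_min]
      have e0 : e 0 = 0 := rfl
      refine ⟨⟨by rw [h20, e0, add_zero], by rw [h21, e0, add_zero], fun _ _ => rfl⟩,
        fun _ _ _ _ => rfl, by simpa [e0] using J, fun _ _ => ⟨rfl, rfl⟩, fun r hr i hi => ?_,
        by simp⟩
      rw [Nat.le_zero.1 hr, e0, add_zero]
    · rintro k τ hkl ⟨⟨i20, i21, i3⟩, ia, iJ, iq, iX, iS⟩
      have tL : (τ.setReg 3 k).reg L = l := by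
        rw [setReg_reg, if_neg (by omega), i3 L hL3, hL]
      -- The loop runs `l` times since only input registers bound loops, and the test disables the
      -- surplus rounds. The condition `2 * r < l` means `r < (l + 1) / 2`, and the second part
      -- leaves a single round for `l = 3`.
      have hguard : (and (lt (double (reg 3)) (reg L))
          (or (not (reg 3)) (ne (reg L) (lit 3)))).eval (τ.setReg 3 k) = 0 ↔ R ≤ k := by
        simp only [Expr.and_eval, Expr.lt_eval, Expr.or_eval, Expr.not_eval, Expr.ne_eval, Expr.eval,
          Expr.double_eval, tL, hR, LineSort.rounds]
        simp only [setReg_reg, if_true]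
        split_ifs <;> omega
      rw [Stmt.when_eval]
      by_cases hkR : R ≤ k
      · rw [if_pos (hguard.2 hkR), min_eq_right (by omega)]
        rw [min_eq_right hkR] at i20 i21 iJ iX iS
        exact ⟨⟨by simpa using i20, by simpa using i21, fun y hy => by
          simpa [show y ≠ 3 by omega] using i3 y hy⟩, ia, iJ, iq, iX, iS⟩
      · rw [if_neg (fun h => hkR (hguard.1 h)), min_eq_left (show k + 1 ≤ R by omega)]
        rw [min_eq_left (show k ≤ R by omega)] at i20 i21 iJ iX iS
        set S : Snapshot := ⟨n, w, l, k, LineSort.kind l k, σ.reg 0 + σ.reg 1,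
          fun i => τ.arr X ((T + e k) * n + i), fun i => τ.arr Y ((T + e k) * n + i), σ.arr K⟩ with hS
        have G : S.Good := by
          refine ⟨hw, LineSort.kind_le _ _, hD, hn, iJ.ltA _ le_rfl, iJ.ltB _ le_rfl, iJ.inj _ le_rfl,
            hk, fun i hi j hj hx hK => hkinj i hi j hj ?_ hK⟩
          rw [← iX k le_rfl i hi, ← iX k le_rfl j hj]
          exact hx
        have aK := ia K (by omega) (by omega) (by omega)
        have a10 := ia 10 (by omega) (by omega) (by omega)
        have a11 := ia 11 (by omega) (by omega) (by omega)
        have a13 := ia 13 (by omega) (by omega) (by omega)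
        have a14 := ia 14 (by omega) (by omega) (by omega)
        have hTτ : Tables V (τ.setReg 3 k) :=
          ⟨by rw [setReg_arr, a13, a14]; exact hT.parity, by rw [setReg_arr, a10]; exact hT.row,
            by rw [setReg_arr, a11]; exact hT.col⟩
        have F : Frame S W L X Y K ((T + e k) * n)
            (((τ.setReg 3 k).setReg 13 (S.r % 2)).setReg 14 S.m) := by
          constructor
          · simp [i3, h2, hS]
          · simp [i3 W hW3, hW, hS, show W ≠ 14 by omega, show W ≠ 13 by omega, show W ≠ 3 by omega]
          · simp [i3 L hL3, hL, hS, show L ≠ 14 by omega, show L ≠ 13 by omega, show L ≠ 3 by omega]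
          · simp [i3, hS]
          · simp
          · simp
          · simp [i20]
          · exact fun v _ hv => hTτ.parity v (by rcases hv with h | h <;> exact h.trans ‹_›)
          · exact hTτ.row
          · exact hTτ.col
          · exact fun _ _ => rfl
          · exact fun _ _ => rfl
          · exact fun j _ => congrFun aK j
        obtain ⟨ρ, r0, r1, r20, r21, ra, rn, ro⟩ := round_eval hl G hTτ hlV
          (show k ≤ V by omega) (by simp [hS]) rfl tL F
        rw [r0]
        have ek : e (k + 1) = e k + (8 - 2 * LineSort.kind l k) := rfl
        obtain ⟨J', new⟩ := iJ.extend G rfl rfl rfl (fun _ _ => rfl) (fun _ _ => rfl)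
          (fun q hq => (ro q hq).1) (fun q hq => (ro q hq).2) rn
        have old : ∀ r ≤ k, ∀ i < n, ρ.arr X ((T + e r) * n + i) = τ.arr X ((T + e r) * n + i) ∧
            ρ.arr Y ((T + e r) * n + i) = τ.arr Y ((T + e r) * n + i) := fun r hr i hi =>
          ro _ (Joint.index_lt (Nat.add_le_add_left (LineSort.elapsed_mono l hr) T) hi)
        have last : ∀ i < n, ρ.arr X ((T + e (k + 1)) * n + i) = σ.arr X (T * n + i) ∧
            ρ.arr Y ((T + e (k + 1)) * n + i) = S.newY (8 - 2 * S.m) i := by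
          intro i hi
          obtain ⟨n1, n2⟩ := new (8 - 2 * S.m) (Nat.sub_le _ _) i hi
          rw [G.newX_last hi] at n1
          rw [ek, ← add_assoc]
          exact ⟨n1.trans (iX k le_rfl i hi), n2⟩
        refine ⟨⟨?_, ?_, fun y hy => ?_⟩, fun a h1 h2 h3 => ?_, ?_, fun q hq => ?_, fun r hr i hi => ?_,
          fun r hr => ?_⟩
        · rw [r20, ek, ← add_assoc, add_mul (T + e k)]
        · rw [r21, ek]; simp [i21, hS, add_assoc]
        · rw [r1 y (by omega), setReg_reg, if_neg (by omega), i3 y hy]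
        · rw [ra a h1 h2 h3]; exact ia a h1 h2 h3
        · rw [ek, ← add_assoc]; exact J'
        · have := Nat.mul_le_mul_right n (Nat.le_add_right T (e k))
          have := ro q (by show q < (T + e k) * n + n; omega)
          exact ⟨this.1.trans (iq q hq).1, this.2.trans (iq q hq).2⟩
        · rcases Nat.lt_or_eq_of_le hr with h | rfl
          · rw [(old r (by omega) i hi).1]; exact iX r (by omega) i hi
          · exact (last i hi).1
        · rcases Nat.lt_or_eq_of_le (Nat.le_of_lt_succ hr) with h | rfl
          · exact (iS r h).congr (fun i hi => (old r h.le i hi).2)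
              fun i hi => (old (r + 1) h i hi).2
          · have st := LineSort.step_newY G rfl
            refine ⟨fun i hi => ?_, fun i hi => ?_, fun i hi j hj hA hA' hx => ?_⟩
            · simp only [(last i hi).2, (old r le_rfl i hi).2]; exact st.idle i hi
            · simp only [(last i hi).2, (old r le_rfl i hi).2]; exact st.window i hi
            · simp only [(last i hi).2, (last j hj).2, (old r le_rfl i hi).2, (old r le_rfl j hj).2]
                at hA hA' ⊢
              exact st.sort i hi j hj hA hA' (by
                show τ.arr X _ = τ.arr X _
                rw [iX r le_rfl i hi, iX r le_rfl j hj]; exact hx)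
  obtain ⟨⟨i20, i21, i3⟩, ia, iJ, iq, iX, iS⟩ := main
  refine ⟨_, T + e R, rfl, Nat.add_le_add_left (LineSort.elapsed_le hl3) T, i20, i21, i3, ia, iJ, iq,
    fun i hi => ⟨iX R le_rfl i hi, ?_⟩⟩
  have hmono : ∀ r ≤ R, T + e r ≤ T + e R := fun r hr =>
    Nat.add_le_add_left (LineSort.elapsed_mono l hr) T
  exact LineSort.sorted_of_steps (pos := fun r i =>
      ((phase W L X Y K).eval σ).arr Y ((T + e r) * n + i)) hl3 hn (J.ltA T le_rfl)
    (fun r hr i hi => iJ.ltB _ (hmono r hr) i hi)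
    (fun r hr i hi j hj hx => iJ.inj _ (hmono r hr) i hi j hj (by rw [iX r hr i hi, iX r hr j hj]; exact hx))
    iS hk hkinj hi

end GridProgram

namespace GridProgram

open RAM LoopLang
open LoopLang.Expr (reg lit arr add sub ne eq lt le not and or ind double)
open LoopLang.Stmt (set store rep repc when seqs)

/-! ### The complete program -/

/-- Load the tables, whose arguments are below `B`. -/
noncomputable def loadTables (B : ℕ) : Stmt :=
  seqs [
    loadTable 10 (table fun l => target l / l.getD 4 0) B,
    loadTable 11 (table fun l => target l % l.getD 4 0) B,
    store 13 (lit 1) (lit 1),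
    rep 3 0 (seqs [
      store 13 (add (reg 3) (lit 2)) (arr 13 (reg 3)),
      store 14 (add (reg 3) (lit 4)) (add (arr 14 (reg 3)) (lit 4))])]

/-- Write down the start positions. -/
def copyStarts : Stmt :=
  rep 3 2 (seqs [store 4 (reg 3) (arr 0 (reg 3)), store 5 (reg 3) (arr 1 (reg 3))])

/-- The three sorting phases. -/
def routing : Stmt :=
  seqs [set 20 (lit 0), set 21 (lit 0), phase 0 1 4 5 7, phase 1 0 5 4 2, phase 0 1 4 5 3]

/-- Plan the motion of all agents; the last time is put into register `21`. -/
noncomputable def main (B : ℕ) : Stmt :=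
  seqs [loadTables B, copyStarts, colouring, routing]

/-- The plan tables are written by straight-line code of fixed size. The arithmetic tables are
filled by the recursions `v % 2 = (v - 2) % 2` and `4 * (v / 4) = 4 * ((v - 4) / 4) + 4`, starting
from memory that is zero. -/
theorem loadTables_eval {B : ℕ} (hB : 16 ^ 18 ≤ B) {σ : State} (h13 : ∀ v, σ.arr 13 v = 0)
    (h14 : ∀ v, σ.arr 14 v = 0) :
    ∃ τ, (loadTables B).eval σ = τ ∧ (∀ y, y ≠ 3 → τ.reg y = σ.reg y) ∧
      (∀ a < 10, τ.arr a = σ.arr a) ∧ Tables (σ.reg 0) τ := by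
  set σ₁ := (loadTable 10 (table fun l => target l / l.getD 4 0) B).eval σ with hσ₁
  set σ₂ := (loadTable 11 (table fun l => target l % l.getD 4 0) B).eval σ₁ with hσ₂
  obtain ⟨a1, a2, a3⟩ := loadTable_eval 10 (table fun l => target l / l.getD 4 0) B σ
  obtain ⟨b1, b2, b3⟩ := loadTable_eval 11 (table fun l => target l % l.getD 4 0) B σ₁
  rw [← hσ₁] at a1 a2 a3
  rw [← hσ₂] at b1 b2 b3
  set σ₃ := σ₂.setArr 13 1 1 with hσ₃
  -- Eighteen hexadecimal digits code a number below `16 ^ 18`.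
  have hlt : ∀ l, IsKey l → encode l < B := fun l hl => by
    have := encode_lt hl.2
    rw [hl.1] at this
    exact this.trans_le hB
  have r₃ : σ₃.reg = σ.reg := b1.trans a1
  have hrun : (loadTables B).eval σ = iter (fun k τ => Stmt.eval (seqs [
      store 13 (add (reg 3) (lit 2)) (arr 13 (reg 3)),
      store 14 (add (reg 3) (lit 4)) (add (arr 14 (reg 3)) (lit 4))]) (τ.setReg 3 k))
      (σ.reg 0) σ₃ := by rw [← r₃]; rfl
  refine ⟨_, rfl, ?_⟩
  rw [hrun]
  obtain ⟨h1, h2, h3, h4⟩ := iter_inv (N := σ.reg 0) (σ := σ₃) (f := fun k τ => Stmt.eval (seqs [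
      store 13 (add (reg 3) (lit 2)) (arr 13 (reg 3)),
      store 14 (add (reg 3) (lit 4)) (add (arr 14 (reg 3)) (lit 4))]) (τ.setReg 3 k))
    (fun k τ => (∀ y, y ≠ 3 → τ.reg y = σ.reg y) ∧ (∀ a < 13, τ.arr a = σ₂.arr a) ∧
      (∀ v < k + 2, τ.arr 13 v = v % 2) ∧ ∀ v < k + 4, τ.arr 14 v = 4 * (v / 4))
    ⟨fun y _ => by rw [r₃], fun a ha => by funext l; simp [hσ₃, show a ≠ 13 by omega],
      fun v hv => by
        have : v = 0 ∨ v = 1 := by omega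
        rcases this with rfl | rfl <;> simp [hσ₃, b2, a2, h13],
      fun v hv => by simp [hσ₃, b2, a2, h14]; omega⟩ (by
      rintro k τ - ⟨h1, h2, h3, h4⟩
      refine ⟨fun y hy => by simp [hy, h1 y hy], fun a ha => ?_, fun v hv => ?_, fun v hv => ?_⟩
      · funext l; simp [show a ≠ 13 by omega, show a ≠ 14 by omega, h2 a ha]
      · by_cases hvk : v = k + 2
        · simp [hvk, h3 k (by omega)]
        · simp [hvk, h3 v (by omega)]
      · by_cases hvk : v = k + 4
        · simp [hvk, h4 k (by omega)]; omega
        · simp [hvk, h4 v (by omega)])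
  refine ⟨h1, fun a ha => ?_, ⟨fun v hv => ⟨h3 v (by omega), h4 v (by omega)⟩, fun l hl => ?_,
    fun l hl => ?_⟩⟩
  · rw [h2 a (by omega), b2 a (by omega), a2 a (by omega)]
  · rw [h2 10 (by omega), b2 10 (by omega), a3 _ (hlt l hl), table_encode _ hl]
  · rw [h2 11 (by omega), b3 _ (hlt l hl), table_encode _ hl]

theorem copyStarts_eval (σ : State) :
    ∃ τ, copyStarts.eval σ = τ ∧ (∀ y, y ≠ 3 → τ.reg y = σ.reg y) ∧
      (∀ a, a ≠ 4 → a ≠ 5 → τ.arr a = σ.arr a) ∧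
      ∀ i < σ.reg 2, τ.arr 4 i = σ.arr 0 i ∧ τ.arr 5 i = σ.arr 1 i := by
  refine ⟨_, rfl, ?_⟩
  refine iter_inv (fun k τ => (∀ y, y ≠ 3 → τ.reg y = σ.reg y) ∧
      (∀ a, a ≠ 4 → a ≠ 5 → τ.arr a = σ.arr a) ∧
      ∀ i < k, τ.arr 4 i = σ.arr 0 i ∧ τ.arr 5 i = σ.arr 1 i)
    ⟨fun _ _ => rfl, fun _ _ _ => rfl, by simp⟩ ?_
  rintro k τ - ⟨h1, h2, h3⟩
  refine ⟨fun y hy => by simp [hy, h1 y hy], fun a h4 h5 => ?_, fun i hi => ?_⟩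
  · funext l; simp [h4, h5, h2 a h4 h5]
  · by_cases hik : i = k
    · simp [hik, h2 0 (by decide) (by decide), h2 1 (by decide) (by decide)]
    · simp [hik, h3 i (by omega)]

/-- The keys must be distinct within each line. For the colours this is properness at the start
rows, for the goal rows in the second phase properness at the goal rows, and for the goal columns in
the third phase distinctness of the goals. The second phase exchanges the roles of rows and columns
(`Joint.swap`). -/
theorem routing_eval {σ : State} {m₁ m₂ n : ℕ} (hm : m₂ ≤ m₁) (h3 : 3 ≤ m₂) (hn : n = m₁ * m₂)
    (h0 : σ.reg 0 = m₁) (h1 : σ.reg 1 = m₂) (h2 : σ.reg 2 = n) (hT : Tables m₁ σ)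
    (J : Joint n m₁ m₂ (σ.arr 4) (σ.arr 5) 0) (hc : ∀ i < n, σ.arr 7 i < m₂)
    (hu : ∀ i < n, σ.arr 2 i < m₁) (hv : ∀ i < n, σ.arr 3 i < m₂)
    (hcs : ∀ i < n, ∀ j < n, i ≠ j → σ.arr 7 i = σ.arr 7 j →
      σ.arr 4 i ≠ σ.arr 4 j ∧ σ.arr 2 i ≠ σ.arr 2 j)
    (huv : ∀ i < n, ∀ j < n, σ.arr 2 i = σ.arr 2 j → σ.arr 3 i = σ.arr 3 j → i = j) :
    ∃ τ T, routing.eval σ = τ ∧ T ≤ 4 * m₁ + 8 * m₂ ∧ τ.reg 21 = T ∧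
      Joint n m₁ m₂ (τ.arr 4) (τ.arr 5) T ∧
      ∀ i < n, (τ.arr 4 i = σ.arr 4 i ∧ τ.arr 5 i = σ.arr 5 i) ∧
        τ.arr 4 (T * n + i) = σ.arr 2 i ∧ τ.arr 5 (T * n + i) = σ.arr 3 i := by
  set σ' := (σ.setReg 20 0).setReg 21 0 with hσ'
  have l1 : Layout 0 1 4 5 7 := ⟨by decide, by decide, by decide, by decide, by decide, by decide⟩
  have l2 : Layout 1 0 5 4 2 := ⟨by decide, by decide, by decide, by decide, by decide, by decide⟩
  have l3 : Layout 0 1 4 5 3 := ⟨by decide, by decide, by decide, by decide, by decide, by decide⟩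
  have tables : ∀ {τ ρ : State}, Tables m₁ τ → (∀ a, a ≠ 4 → a ≠ 5 → a ≠ 12 → ρ.arr a = τ.arr a) →
      Tables m₁ ρ := by
    intro τ ρ h ha
    have a10 := ha 10 (by decide) (by decide) (by decide)
    have a11 := ha 11 (by decide) (by decide) (by decide)
    have a13 := ha 13 (by decide) (by decide) (by decide)
    have a14 := ha 14 (by decide) (by decide) (by decide)
    exact ⟨by rw [a13, a14]; exact h.parity, by rw [a10]; exact h.row, by rw [a11]; exact h.col⟩
  obtain ⟨τ₁, T₁, e1, t1, o1, c1, r1, a1, J1, p1, q1⟩ := phase_eval (σ := σ') (T := 0) l1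
    (h3.trans hm) h3 hn (by simpa [hσ'] using h2) (by simpa [hσ'] using h0) (by simpa [hσ'] using h1)
    (by simp [hσ', h0, h1]) (tables hT fun _ _ _ _ => rfl) le_rfl hm (by simp [hσ']) (by simp [hσ'])
    (by simpa [hσ'] using J) (by simpa [hσ'] using hc) (by
      intro i hi j hj hx hk
      by_contra hij
      exact (hcs i hi j hj hij (by simpa [hσ'] using hk)).1 (by simpa [hσ'] using hx))
  have T1 := tables (τ := σ') (ρ := τ₁) (tables hT fun _ _ _ _ => rfl) a1
  have k2 : τ₁.arr 2 = σ.arr 2 := by rw [a1 2] <;> first | rfl | decide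
  have k3 : τ₁.arr 3 = σ.arr 3 := by rw [a1 3] <;> first | rfl | decide
  have k7 : σ'.arr 7 = σ.arr 7 := rfl
  obtain ⟨τ₂, T₂, e2, t2, o2, c2, r2, a2, J2, p2, q2⟩ := phase_eval (σ := τ₁) (T := T₁) l2
    h3 (h3.trans hm) (hn.trans (mul_comm _ _)) ((r1 2 (by decide)).trans (by simpa [hσ'] using h2))
    ((r1 1 (by decide)).trans (by simpa [hσ'] using h1))
    ((r1 0 (by decide)).trans (by simpa [hσ'] using h0))
    (by rw [r1 0 (by decide), r1 1 (by decide)]; simp [hσ', h0, h1]) T1 hm le_rfl o1 c1 J1.swap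
    (by rw [k2]; exact hu) (by
      intro i hi j hj hx hk
      by_contra hij
      rw [(q1 i hi).2, (q1 j hj).2] at hx
      rw [k2] at hk
      exact (hcs i hi j hj hij hx).2 hk)
  have T2 := tables (τ := τ₁) (ρ := τ₂) T1 fun a h4 h5 => a2 a h5 h4
  have k3' : τ₂.arr 3 = σ.arr 3 := by rw [a2 3, k3] <;> decide
  obtain ⟨τ₃, T₃, e3, t3, o3, c3, r3, a3, J3, p3, q3⟩ := phase_eval (σ := τ₂) (T := T₂) l3
    (h3.trans hm) h3 hn ((r2 2 (by decide)).trans ((r1 2 (by decide)).trans (by simpa [hσ'] using h2)))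
    ((r2 0 (by decide)).trans ((r1 0 (by decide)).trans (by simpa [hσ'] using h0)))
    ((r2 1 (by decide)).trans ((r1 1 (by decide)).trans (by simpa [hσ'] using h1)))
    (by rw [r2 0 (by decide), r2 1 (by decide), r1 0 (by decide), r1 1 (by decide)]; simp [hσ', h0, h1])
    T2 le_rfl hm o2 c2 J2.swap (by rw [k3']; exact hv) (by
      intro i hi j hj hx hk
      rw [(q2 i hi).2, (q2 j hj).2, k2] at hx
      rw [k3'] at hk
      exact huv i hi j hj hx hk)
  refine ⟨τ₃, T₃, ?_, by omega, c3, J3, fun i hi => ⟨⟨?_, ?_⟩, ?_, ?_⟩⟩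
  · rw [← e3, ← e2, ← e1]; rfl
  · rw [(p3 i (by omega)).1, (p2 i (by omega)).2, (p1 i (by omega)).1]; rfl
  · rw [(p3 i (by omega)).2, (p2 i (by omega)).1, (p1 i (by omega)).2]; rfl
  · rw [(q3 i hi).1, (q2 i hi).2, k2]
  · rw [(q3 i hi).2, k3']

/-- Bounds the degrees of the multigraph: a row has only `L` cells for starts or goals. -/
theorem card_filter_le {n L : ℕ} {X Y : ℕ → ℕ} (hY : ∀ i < n, Y i < L)
    (inj : ∀ i < n, ∀ j < n, X i = X j → Y i = Y j → i = j) (x : ℕ) :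
    ((Finset.range n).filter fun j => X j = x).card ≤ L := by
  rw [← Finset.card_range L]
  refine Finset.card_le_card_of_injOn Y (fun j hj => ?_) fun i hi j hj h => ?_
  · simp only [Finset.coe_filter, Finset.mem_range, Set.mem_ofPred_eq] at hj
    simpa using hY j hj.1
  · simp only [Finset.coe_filter, Finset.mem_range, Set.mem_ofPred_eq] at hi hj
    exact inj i hi.1 j hj.1 (hi.2.trans hj.2.symm) h

theorem toArray_lt {n m : ℕ} {f : Fin n → Fin m} {i : ℕ} (hi : i < n) :
    MAPF.toArray (fun j => (f j : ℕ)) i < m := by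
  rw [MAPF.toArray, dif_pos hi]; exact (f _).2

theorem toArray_inj {n m₁ m₂ : ℕ} {s : Fin n → Fin m₁ × Fin m₂} (hs : Function.Injective s) {i j : ℕ}
    (hi : i < n) (hj : j < n)
    (h1 : MAPF.toArray (fun k => ((s k).1 : ℕ)) i = MAPF.toArray (fun k => ((s k).1 : ℕ)) j)
    (h2 : MAPF.toArray (fun k => ((s k).2 : ℕ)) i = MAPF.toArray (fun k => ((s k).2 : ℕ)) j) :
    i = j := by
  simp only [MAPF.toArray, dif_pos hi, dif_pos hj] at h1 h2
  simpa using hs (Prod.ext (Fin.ext h1) (Fin.ext h2))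

theorem main_eval {B m₁ m₂ n : ℕ} (hB : 16 ^ 18 ≤ B) (hm : m₂ ≤ m₁) (h3 : 3 ≤ m₂) (hn : n = m₁ * m₂)
    (I : MAPF.Instance (Fin m₁ × Fin m₂) n) :
    ∃ τ T, (main B).eval (MAPF.inputState I) = τ ∧ T ≤ 4 * m₁ + 8 * m₂ ∧ τ.reg 21 = T ∧
      Joint n m₁ m₂ (τ.arr 4) (τ.arr 5) T ∧
      ∀ i : Fin n, (τ.arr 4 i = (I.start i).1 ∧ τ.arr 5 i = (I.start i).2) ∧
        τ.arr 4 (T * n + i) = (I.goal i).1 ∧ τ.arr 5 (T * n + i) = (I.goal i).2 := by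
  set σ := MAPF.inputState I with hσ
  have a0 : σ.arr 0 = MAPF.toArray fun i => ((I.start i).1 : ℕ) := by simp [hσ, MAPF.inputState]
  have a1 : σ.arr 1 = MAPF.toArray fun i => ((I.start i).2 : ℕ) := by simp [hσ, MAPF.inputState]
  have a2 : σ.arr 2 = MAPF.toArray fun i => ((I.goal i).1 : ℕ) := by simp [hσ, MAPF.inputState]
  have a3 : σ.arr 3 = MAPF.toArray fun i => ((I.goal i).2 : ℕ) := by simp [hσ, MAPF.inputState]
  have az : ∀ a, 4 ≤ a → ∀ v, σ.arr a v = 0 := fun a ha v => by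
    simp [hσ, MAPF.inputState, show a ≠ 0 by omega, show a ≠ 1 by omega, show a ≠ 2 by omega,
      show a ≠ 3 by omega]
  have r0 : σ.reg 0 = m₁ := by simp [hσ, MAPF.inputState]
  have r1 : σ.reg 1 = m₂ := by simp [hσ, MAPF.inputState]
  have r2 : σ.reg 2 = n := by simp [hσ, MAPF.inputState]
  have v1 : ∀ i < n, σ.arr 1 i < m₂ := fun i hi => by rw [a1]; exact toArray_lt hi
  have v3 : ∀ i < n, σ.arr 3 i < m₂ := fun i hi => by rw [a3]; exact toArray_lt hi
  have is : ∀ i < n, ∀ j < n, σ.arr 0 i = σ.arr 0 j → σ.arr 1 i = σ.arr 1 j → i = j := by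
    rw [a0, a1]; exact fun i hi j hj => toArray_inj I.start_injective hi hj
  have ig : ∀ i < n, ∀ j < n, σ.arr 2 i = σ.arr 2 j → σ.arr 3 i = σ.arr 3 j → i = j := by
    rw [a2, a3]; exact fun i hi j hj => toArray_inj I.goal_injective hi hj
  obtain ⟨σ₁, e1, b1, c1, T1⟩ := loadTables_eval hB (az 13 (by decide)) (az 14 (by decide))
  obtain ⟨σ₂, e2, b2, c2, d2⟩ := copyStarts_eval σ₁
  have s0 : σ₂.arr 0 = σ.arr 0 := (c2 0 (by decide) (by decide)).trans (c1 0 (by decide))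
  have s1 : σ₂.reg 1 = m₂ := ((b2 1 (by decide)).trans (b1 1 (by decide))).trans r1
  have s2 : σ₂.arr 2 = σ.arr 2 := (c2 2 (by decide) (by decide)).trans (c1 2 (by decide))
  have s2' : σ₂.reg 2 = n := ((b2 2 (by decide)).trans (b1 2 (by decide))).trans r2
  have s6 : σ₂.arr 6 = σ.arr 6 := (c2 6 (by decide) (by decide)).trans (c1 6 (by decide))
  obtain ⟨σ₃, e3, c3, d3, f3⟩ := colouring_eval (σ := σ₂) s0 s2 (by rw [s6]; exact az 6 (by decide))
    (by rw [s1, s2']; exact fun i _ => card_filter_le v1 is _)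
    (by rw [s1, s2']; exact fun i _ => card_filter_le v3 ig _)
  rw [s2', s1] at d3
  rw [s2'] at f3
  have hw : ∀ y < 3, colouring.writes y = false := by decide
  have b3 : ∀ y < 3, σ₃.reg y = σ.reg y := fun y hy => by
    rw [← e3, Stmt.eval_reg _ (hw y hy), b2 y (by omega), b1 y (by omega)]
  have g4 : ∀ i < n, σ₃.arr 4 i = σ.arr 0 i := fun i hi => by
    rw [c3 4 (by decide) (by decide), (d2 i (by rwa [b1 2 (by decide), r2])).1, c1 0 (by decide)]
  have g5 : ∀ i < n, σ₃.arr 5 i = σ.arr 1 i := fun i hi => by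
    rw [c3 5 (by decide) (by decide), (d2 i (by rwa [b1 2 (by decide), r2])).2, c1 1 (by decide)]
  have g2 : σ₃.arr 2 = σ.arr 2 := (c3 2 (by decide) (by decide)).trans s2
  have g3 : σ₃.arr 3 = σ.arr 3 := by
    rw [c3 3 (by decide) (by decide), c2 3 (by decide) (by decide), c1 3 (by decide)]
  rw [r0] at T1
  have T3 : Tables m₁ σ₃ := by
    have k : ∀ a, 10 ≤ a → σ₃.arr a = σ₁.arr a := fun a ha => by
      rw [c3 a (by omega) (by omega), c2 a (by omega) (by omega)]
    exact ⟨by rw [k 13 (by decide), k 14 (by decide)]; exact T1.parity,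
      by rw [k 10 (by decide)]; exact T1.row, by rw [k 11 (by decide)]; exact T1.col⟩
  obtain ⟨τ, T, e4, t4, k4, J4, p4⟩ := routing_eval (σ := σ₃) hm h3 hn ((b3 0 (by decide)).trans r0)
    ((b3 1 (by decide)).trans r1) ((b3 2 (by decide)).trans r2) T3
    (by
      refine ⟨fun t ht i hi => ?_, fun t ht i hi => ?_, fun t ht i hi j hj => ?_, by simp, by simp⟩
      · obtain rfl := Nat.le_zero.1 ht
        rw [zero_mul, zero_add, g4 i hi, a0]; exact toArray_lt hi
      · obtain rfl := Nat.le_zero.1 ht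
        rw [zero_mul, zero_add, g5 i hi]; exact v1 i hi
      · obtain rfl := Nat.le_zero.1 ht
        rw [zero_mul, zero_add, zero_add, g4 i hi, g4 j hj, g5 i hi, g5 j hj]
        exact is i hi j hj)
    d3 (fun i hi => by rw [g2, a2]; exact toArray_lt hi) (by rw [g3]; exact v3)
    (fun i hi j hj hij h => by
      rw [g4 i hi, g4 j hj, g2]; exact f3 i hi j hj hij h) (by rw [g2, g3]; exact ig)
  refine ⟨τ, T, ?_, t4, k4, J4, fun i => ?_⟩
  · rw [← e4, ← e3, ← e2, ← e1]; rfl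
  · obtain ⟨⟨h1, h2⟩, h4, h5⟩ := p4 i i.2
    rw [h1, h2, h4, h5, g4 i i.2, g5 i i.2, g2, g3, a0, a1, a2, a3]
    simp [MAPF.toArray]

theorem main_ok (B : ℕ) : (main B).ok = true := by
  have h : (Expr.encode tableIndex).ok = true := Expr.encode_ok (by decide)
  have hc : colouring.ok = true := by decide
  simp [main, loadTables, loadTable_ok, copyStarts, routing, phase, round, moveAgent, locate, gather,
    writeSteps, h, hc, userRegs]

/-- The machine program: after the compiled program, the last time is moved to register `0`. -/
noncomputable def machine (B : ℕ) : Prog :=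
  .seq ((main B).compile userRegs) (.seq (.const 0 0) (.add 0 0 21))

theorem machine_runs {B m₁ m₂ n : ℕ} (hB : 16 ^ 18 ≤ B) (hm : m₂ ≤ m₁) (h3 : 3 ≤ m₂)
    (hn : n = m₁ * m₂) (I : MAPF.Instance (Fin m₁ × Fin m₂) n) :
    ∃ k σ, Runs (machine B) (MAPF.inputState I) k σ ∧ k ≤ ((main B).cost + 2).eval (m₁ * m₂) ∧
      σ.reg 0 ≤ 4 * m₁ + 8 * m₂ ∧ Joint n m₁ m₂ (σ.arr 4) (σ.arr 5) (σ.reg 0) ∧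
      ∀ i : Fin n, (σ.arr 4 i = (I.start i).1 ∧ σ.arr 5 i = (I.start i).2) ∧
        σ.arr 4 (σ.reg 0 * n + i) = (I.goal i).1 ∧ σ.arr 5 (σ.reg 0 * n + i) = (I.goal i).2 := by
  obtain ⟨τ, T, e1, h1, h2, J, h4⟩ := main_eval hB hm h3 hn I
  -- The product bounds all three input registers, so the cost polynomial may be evaluated there.
  have hle1 : m₁ ≤ m₁ * m₂ := Nat.le_mul_of_pos_right _ (by omega)
  have hle2 : m₂ ≤ m₁ * m₂ := Nat.le_mul_of_pos_left _ (by omega)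
  obtain ⟨k, ρ, r1, r2, ⟨r3, r4⟩, -⟩ := Stmt.compile_runs (main B) (main_ok B) (m₁ * m₂) userRegs le_rfl
    (MAPF.inputState I) (MAPF.inputState I) ⟨rfl, fun _ _ => rfl⟩ (by
      intro y hy
      simp only [MAPF.inputState]
      split_ifs <;> omega)
  rw [e1] at r3 r4
  have h21 : ρ.reg 21 = T := (r4 21 (by decide)).trans h2
  refine ⟨_, _, .seq r1 (.seq (.const _ _ _) (.add _ _ _ _)), ?_, ?_, ?_, ?_⟩
  · simp only [Polynomial.eval_add, Polynomial.eval_ofNat]; omega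
  · simpa [h21] using h1
  · simpa [h21, r3] using J
  · simpa [h21, r3] using h4

end GridProgram

/-! ### The main theorem -/

theorem theoremt :
    ∃ (A : RAM.Prog) (p : Polynomial ℕ),
      ∀ (m₁ m₂ n : ℕ), m₂ ≤ m₁ → 3 ≤ m₂ →
        ∀ I : MAPF.Instance (Fin m₁ × Fin m₂) n,
          -- every vertex of the grid is occupied by an agent
          Function.Surjective I.start →
            ∃ (k : ℕ) (σ : RAM.State) (P : Fin n → ℕ → Fin m₁ × Fin m₂),
              RAM.Runs A (MAPF.inputState I) k σ ∧
              k ≤ p.eval (m₁ * m₂) ∧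
              MAPF.IsOutput σ P ∧
              MAPF.IsFeasible (MAPF.grid m₁ m₂) I P ∧
              MAPF.makespan I P ≤ 4 * m₁ + 8 * m₂ := by
  -- The table size is a constant that exceeds all codes, so one program serves all grids.
  refine ⟨GridProgram.machine (16 ^ 18), (GridProgram.main (16 ^ 18)).cost + 2, fun m₁ m₂ n hm h3 I hI => ?_⟩
  have hn : n = m₁ * m₂ := by
    simpa using Fintype.card_of_bijective (f := I.start) ⟨I.start_injective, hI⟩
  obtain ⟨k, σ, hrun, hk, hT, J, hP⟩ := GridProgram.machine_runs le_rfl hm h3 hn I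
  set T := σ.reg 0
  -- Time is capped at `T`: later array entries carry no meaning, and the agents rest.
  refine ⟨k, σ, fun i t => (⟨σ.arr 4 (min t T * n + i), J.ltA _ (min_le_right _ _) i i.2⟩,
    ⟨σ.arr 5 (min t T * n + i), J.ltB _ (min_le_right _ _) i i.2⟩), hrun, hk, ⟨?_, ?_⟩, ⟨?_, ?_, ?_⟩, ?_⟩
  · intro i t (ht : t ≤ T)
    simp [min_eq_left ht]
  · intro i t (ht : T ≤ t)
    simp [min_eq_right ht, T]
  · intro i
    obtain ⟨⟨h1, h2⟩, h4, h5⟩ := hP i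
    refine ⟨?_, ⟨T, fun t ht => ?_⟩, fun t => ?_⟩
    · exact Prod.ext (Fin.ext (by simpa using h1)) (Fin.ext (by simpa using h2))
    · exact Prod.ext (Fin.ext (by simpa [min_eq_right ht] using h4))
        (Fin.ext (by simpa [min_eq_right ht] using h5))
    · rcases Nat.lt_or_ge t T with ht | ht
      · have := J.move t ht i i.2
        simp only [SimpleGraph.boxProd_adj, SimpleGraph.pathGraph_adj, Prod.mk.injEq, Fin.mk.injEq,
          min_eq_left ht.le, min_eq_left (show t + 1 ≤ T from ht)]
        omega
      · left
        simp [min_eq_right ht, min_eq_right (ht.trans t.le_succ)]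
  · intro i j hij t h
    simp only [Prod.mk.injEq, Fin.mk.injEq] at h
    exact hij (Fin.ext (J.inj _ (min_le_right _ _) i i.2 j j.2 h.1 h.2))
  · rintro i j hij t ⟨h1, h2⟩
    simp only [Prod.mk.injEq, Fin.mk.injEq] at h1 h2
    have hne : (i : ℕ) ≠ j := fun h => hij (Fin.ext h)
    rcases Nat.lt_or_ge t T with ht | ht
    · rw [min_eq_left ht.le, min_eq_left (show t + 1 ≤ T from ht)] at h1 h2
      exact J.noswap t ht i i.2 j j.2 hne h1.1 h1.2 h2.1 h2.2
    · rw [min_eq_right ht, min_eq_right (ht.trans t.le_succ)] at h1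
      exact hne (J.inj _ le_rfl i i.2 j j.2 h1.1 h1.2)
  -- Every agent rests at its goal from `T` on, so `T` belongs to the set whose infimum is the path
  -- length.
  · refine (Finset.sup_le fun i _ => Nat.sInf_le fun t ht => ?_).trans hT
    obtain ⟨-, h4, h5⟩ := hP i
    exact Prod.ext (Fin.ext (by simpa [min_eq_right ht] using h4))
      (Fin.ext (by simpa [min_eq_right ht] using h5))
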